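/- Let $k$ be an algebraically closed field of characteristic $\neq 2$, let $l\ge 1$, and let $V$ be a $k$-vector space with basis $v_1,\dots,v_l$. Let $W=ku\oplus V\oplus V^*$ with the quadratic form $q(\alpha u+v+f)=-\alpha^2+f(v)$, and let $\mathfrak{so}_{2l+1}=\mathfrak{so}(W,q)$, which is spanned by the maps $\sigma_{w_1,w_2}=q(w_1,\cdot)w_2-q(w_2,\cdot)w_1$, where $q(\cdot,\cdot)$ is the polar form of $q$. Let $S=\bigwedge V$ be the spin module: $\rho:\mathfrak{so}_{2l+1}\to \mathrm{End}_k(S)$ is the composition of the embedding $\sigma_{w_1,w_2}\mapsto-\frac12(w_1\cdot w_2-w_2\cdot w_1)$ into the even Clifford algebra $\mathrm{Cl}_{\bar 0}(W,q)$, the inverse of the isomorphism $\mathrm{Cl}(V\oplus V^*,q)\to \mathrm{Cl}_{\bar 0}(W,q)$ that extends $x\mapsto u\cdot x$, and the representation of $\mathrm{Cl}(V\oplus V^*,q)$ on $\bigwedge V$ in which $v\in V$ acts by left multiplication and $f\in V^*$ by the odd superderivation extending $f$. Let $b(s,t)=\Phi(\bar s\,t)$ on $S$, where $s\mapsto\bar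 s$ is the involution of $\bigwedge V$ with $\bar v=-v$ for $v\in V$, and $\Phi$ is the linear form on $\bigwedge V$ that is zero in degrees $<l$ and has $\Phi(v_1\cdots v_l)=1$. Let $\mathfrak g=\mathfrak{so}_{2l+1}\oplus S$ be the $\mathbb Z/2$-graded algebra with even part $\mathfrak{so}_{2l+1}$ and odd part $S$ whose product is the Lie bracket on $\mathfrak{so}_{2l+1}$, together with $[\sigma,s]=-[s,\sigma]=\rho(\sigma)(s)$, and with $[s,t]\in\mathfrak{so}_{2l+1}$ for $s,t\in S$ determined by $$\tfrac12\,\mathrm{tr}_W(\sigma[s,t])=b(\rho(\sigma)(s),t)\qquad\text{for all }\sigma\in\mathfrak{so}_{2l+1}.$$ For an integer matrix $C=(c_{ij})$ invertible over $k$, the contragredient Lie algebra of $C$ over $k$ is the Lie algebra with generators $h_i,e_i,f_i$ and relations $[h_i,h_j]=0$, $[e_i,f_j]=\delta_{ij}h_i$, $[h_i,e_j]=c_{ij}e_j$, $[h_i,f_j]=-c_{ij}f_j$, modulo its largest ideal that is homogeneous for the root lattice grading and meets the span of the $h_i$ trivially. The Lie algebra of type $F_4$ is that of the Cartan matrix $F_4$;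 Brown's Lie algebra (in characteristic $3$) is that of the matrix $\begin{pmatrix}2&-1&0\\-1&2&-1\\0&-1&0\end{pmatrix}$. (i) $\mathfrak g$ is a Lie algebra if and only if either $l=3$ and $\mathrm{char}\,k=3$, or $l=4$. In the first case $\mathfrak g$ is isomorphic to Brown's Lie algebra, which is simple of dimension $29$; in the second case $\mathfrak g$ is isomorphic to the Lie algebra of type $F_4$, which is simple. (ii) $\mathfrak g$ is a Lie superalgebra (that is, it satisfies the super skew-symmetry and the super Jacobi identity) if and only if $l=1$, or $l=2$, or $l=5$ and $\mathrm{char}\,k=5$, or $l=6$ and $\mathrm{char}\,k=3$; in all these cases also $[[s,s],s]=0$ for every odd $s$. If $l=1$, then $\mathfrak g\cong\mathfrak{osp}(1,2)$, and if $l=2$, then $\mathfrak g\cong\mathfrak{osp}(1,4)$, as Lie superalgebras. In the last two cases $\mathfrak g$ is a simple Lie superalgebra. -/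

import Mathlib

noncomputable section

namespace SpinLie

/-! ### Algebras given by a bilinear product -/

section Products

variable {k A A' : Type*} [CommRing k] [AddCommGroup A] [Module k A] [AddCommGroup A'] [Module k A']

/-- The product `μ` makes `A` a Lie algebra. -/
structure IsLieProduct (μ : A →ₗ[k] A →ₗ[k] A) : Prop where
  self_eq_zero : ∀ x, μ x x = 0
  jacobi : ∀ x y z, μ (μ x y) z + μ (μ y z) x + μ (μ z x) y = 0

/-- The product `μ` makes `A`, graded by `𝒢`, a Lie superalgebra: a `ℤ/2`-graded algebra with
`[x,y] = -(-1)^{|x||y|}[y,x]` and `[x,[y,z]] = [[x,y],z] + (-1)^{|x||y|}[y,[x,z]]` for homogeneous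
elements. -/
structure IsLieSuperProduct (𝒢 : ZMod 2 → Submodule k A) (μ : A →ₗ[k] A →ₗ[k] A) : Prop where
  isInternal : DirectSum.IsInternal 𝒢
  mul_mem : ∀ i j, ∀ x ∈ 𝒢 i, ∀ y ∈ 𝒢 j, μ x y ∈ 𝒢 (i + j)
  skew : ∀ i j, ∀ x ∈ 𝒢 i, ∀ y ∈ 𝒢 j, μ x y = -((-1 : k) ^ (i.val * j.val) • μ y x)
  jacobi : ∀ i j, ∀ x ∈ 𝒢 i, ∀ y ∈ 𝒢 j, ∀ z,
    μ x (μ y z) = μ (μ x y) z + (-1 : k) ^ (i.val * j.val) • μ y (μ x z)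

/-- Simplicity as a graded algebra: the product is not zero and there are no graded two-sided ideals
besides `0` and the whole algebra. -/
def IsGradedSimple (𝒢 : ZMod 2 → Submodule k A) (μ : A →ₗ[k] A →ₗ[k] A) : Prop :=
  μ ≠ 0 ∧ ∀ I : Submodule k A, (∀ x, ∀ y ∈ I, μ x y ∈ I ∧ μ y x ∈ I) →
    I = (I ⊓ 𝒢 0) ⊔ (I ⊓ 𝒢 1) → I = ⊥ ∨ I = ⊤

/-- The algebra `(A, μ)` is isomorphic to the Lie algebra `L`. -/
def IsoLie (μ : A →ₗ[k] A →ₗ[k] A) (L : Type*) [LieRing L] [LieAlgebra k L] : Prop :=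
  ∃ e : A ≃ₗ[k] L, ∀ x y, e (μ x y) = ⁅e x, e y⁆

/-- The graded algebras `(A, 𝒢, μ)` and `(A', 𝒢', μ')` are isomorphic. -/
def IsoSuper (𝒢 : ZMod 2 → Submodule k A) (μ : A →ₗ[k] A →ₗ[k] A)
    (𝒢' : ZMod 2 → Submodule k A') (μ' : A' →ₗ[k] A' →ₗ[k] A') : Prop :=
  ∃ e : A ≃ₗ[k] A', (∀ x y, e (μ x y) = μ' (e x) (e y)) ∧
    ∀ i, (𝒢 i).map (e : A →ₗ[k] A') = 𝒢' i

end Products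

/-! ### Contragredient Lie algebras -/

section Contragredient

open CartanMatrix (Generators)

variable (k : Type*) [CommRing k] {B : Type*} [DecidableEq B] (C : Matrix B B ℤ)

/-- The grading by the root lattice `ℤ^B` of the free Lie algebra on the symbols `Hᵢ, Eᵢ, Fᵢ`, where
`Hᵢ, Eᵢ, Fᵢ` have degrees `0, αᵢ, -αᵢ`: `HasDegree k d x` says that `x` is homogeneous of degree
`d`. -/
inductive HasDegree : (B → ℤ) → FreeLieAlgebra k (Generators B) → Prop
  | H (i : B) : HasDegree 0 (FreeLieAlgebra.of k (Generators.H i))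
  | E (i : B) : HasDegree (Pi.single i 1) (FreeLieAlgebra.of k (Generators.E i))
  | F (i : B) : HasDegree (-Pi.single i 1) (FreeLieAlgebra.of k (Generators.F i))
  | zero (d : B → ℤ) : HasDegree d 0
  | add {d : B → ℤ} {x y : FreeLieAlgebra k (Generators B)} :
      HasDegree d x → HasDegree d y → HasDegree d (x + y)
  | smul {d : B → ℤ} (c : k) {x : FreeLieAlgebra k (Generators B)} :
      HasDegree d x → HasDegree d (c • x)
  | lie {d e : B → ℤ} {x y : FreeLieAlgebra k (Generators B)} :
      HasDegree d x → HasDegree e y → HasDegree (d + e) ⁅x, y⁆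

/-- The relations `[Hᵢ,Hⱼ] = 0`, `[Eᵢ,Fⱼ] = δᵢⱼ Hᵢ`, `[Hᵢ,Eⱼ] = Cᵢⱼ Eⱼ`, `[Hᵢ,Fⱼ] = -Cᵢⱼ Fⱼ`. -/
def chevalleyRelations : Set (FreeLieAlgebra k (Generators B)) :=
  Set.range (CartanMatrix.Relations.HH k) ∪ Set.range (CartanMatrix.Relations.EF k) ∪
    Set.range (CartanMatrix.Relations.HE k C) ∪ Set.range (CartanMatrix.Relations.HF k C)

/-- The ideals of the free Lie algebra that contain the relations, are homogeneous for the grading by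
the root lattice, and meet the span of the `Hᵢ` trivially. -/
def admissibleIdeals : Set (LieIdeal k (FreeLieAlgebra k (Generators B))) :=
  {I | chevalleyRelations k C ⊆ I ∧
    (∀ x ∈ I, x ∈ Submodule.span k {y | y ∈ I ∧ ∃ d, HasDegree k d y}) ∧
    ∀ x ∈ I, x ∈ Submodule.span k
      (Set.range fun i : B => FreeLieAlgebra.of k (Generators.H i)) → x = 0}

/-- The contragredient Lie algebra of an integer matrix `C` that is invertible over the field `k`:
the Lie algebra given by the generators `Hᵢ, Eᵢ, Fᵢ` and the relations `[Hᵢ,Hⱼ] = 0`,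
`[Eᵢ,Fⱼ] = δᵢⱼ Hᵢ`, `[Hᵢ,Eⱼ] = Cᵢⱼ Eⱼ`, `[Hᵢ,Fⱼ] = -Cᵢⱼ Fⱼ`, modulo its largest homogeneous ideal
that meets the span of the `Hᵢ` trivially. (In small characteristic the Serre relations do not
suffice to generate that ideal: for type `F₄` they give an infinite dimensional algebra in
characteristic 3.) -/
abbrev Contragredient : Type _ :=
  FreeLieAlgebra k (Generators B) ⧸ sSup (admissibleIdeals k C)

/-- Brown's Lie algebra (used in characteristic 3): the contragredient Lie algebra of the matrix
`(2,-1,0; -1,2,-1; 0,-1,0)`. -/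
abbrev Brown : Type _ := Contragredient k !![2, -1, 0; -1, 2, -1; 0, -1, 0]

/-- The Lie algebra of type `F₄`. -/
abbrev TypeF4 : Type _ := Contragredient k CartanMatrix.F₄

end Contragredient

/-! ### Orthosymplectic Lie superalgebras -/

section Orthosymplectic

open Matrix

variable (k : Type*) [CommRing k] (m n : Type*) [Fintype m] [DecidableEq m] [Fintype n]
  [DecidableEq n]

/-- Square matrices of size `(m | 2n)`; block diagonal ones are even, block antidiagonal ones odd. -/
abbrev SuperMatrix : Type _ := Matrix (m ⊕ (n ⊕ n)) (m ⊕ (n ⊕ n)) k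

variable {k m n}

def evenPart (X : SuperMatrix k m n) : SuperMatrix k m n :=
  fromBlocks X.toBlocks₁₁ 0 0 X.toBlocks₂₂

def oddPart (X : SuperMatrix k m n) : SuperMatrix k m n :=
  fromBlocks 0 X.toBlocks₁₂ X.toBlocks₂₁ 0

/-- The bilinear extension of `[X,Y] = XY - (-1)^{|X||Y|} YX`. -/
def superComm (X Y : SuperMatrix k m n) : SuperMatrix k m n :=
  X * Y - (evenPart Y * evenPart X + evenPart Y * oddPart X + oddPart Y * evenPart X
    - oddPart Y * oddPart X)

/-- The matrix of the supersymmetric form: the identity on the even part and the standard symplectic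
form on the odd part. -/
def ospForm : SuperMatrix k m n := fromBlocks 1 0 0 (Matrix.J n k)

def superTranspose (X : SuperMatrix k m n) : SuperMatrix k m n :=
  fromBlocks X.toBlocks₁₁ᵀ X.toBlocks₂₁ᵀ (-X.toBlocks₁₂ᵀ) X.toBlocks₂₂ᵀ

theorem ospCondition_iff (X : SuperMatrix k m n) :
    superTranspose X * ospForm + ospForm * X = 0 ↔
      X.toBlocks₁₁ᵀ + X.toBlocks₁₁ = 0 ∧ X.toBlocks₂₁ᵀ * Matrix.J n k + X.toBlocks₁₂ = 0 ∧
      -X.toBlocks₁₂ᵀ + Matrix.J n k * X.toBlocks₂₁ = 0 ∧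
      X.toBlocks₂₂ᵀ * Matrix.J n k + Matrix.J n k * X.toBlocks₂₂ = 0 := by
  conv_lhs => rw [← fromBlocks_toBlocks X]
  simp only [superTranspose, ospForm, toBlocks_fromBlocks₁₁, toBlocks_fromBlocks₁₂,
    toBlocks_fromBlocks₂₁, toBlocks_fromBlocks₂₂, fromBlocks_multiply, fromBlocks_add]
  rw [← fromBlocks_zero, fromBlocks_inj]
  simp

variable (k m n)

/-- The orthosymplectic Lie superalgebra `osp(m, 2n)`, as a space of matrices. -/
def osp : Submodule k (SuperMatrix k m n) where
  carrier := {X | superTranspose X * ospForm + ospForm * X = 0}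
  zero_mem' := by
    simp only [Set.mem_ofPred_eq, ospCondition_iff]
    refine ⟨?_, ?_, ?_, ?_⟩ <;> ext <;> simp [toBlocks₁₁, toBlocks₁₂, toBlocks₂₁, toBlocks₂₂,
      Matrix.mul_apply]
  add_mem' := by
    intro X Y hX hY
    simp only [Set.mem_ofPred_eq] at *
    have h : superTranspose (X + Y) = superTranspose X + superTranspose Y := by
      ext (i | i) (j | j) <;>
        simp [superTranspose, toBlocks₁₁, toBlocks₁₂, toBlocks₂₁, toBlocks₂₂, add_comm]
    rw [h, add_mul, mul_add, add_add_add_comm, hX, hY, add_zero]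
  smul_mem' := by
    intro c X hX
    simp only [Set.mem_ofPred_eq] at *
    have h : superTranspose (c • X) = c • superTranspose X := by
      ext (i | i) (j | j) <;>
        simp [superTranspose, toBlocks₁₁, toBlocks₁₂, toBlocks₂₁, toBlocks₂₂]
    rw [h, smul_mul_assoc, mul_smul_comm, ← smul_add, hX, smul_zero]

variable {k m n}

theorem superComm_fromBlocks (A A' : Matrix m m k) (B B' : Matrix m (n ⊕ n) k)
    (C C' : Matrix (n ⊕ n) m k) (D D' : Matrix (n ⊕ n) (n ⊕ n) k) :
    superComm (fromBlocks A B C D) (fromBlocks A' B' C' D') =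
      fromBlocks (A * A' + B * C' - A' * A + B' * C) (A * B' + B * D' - A' * B - B' * D)
        (C * A' + D * C' - D' * C - C' * A) (C * B' + D * D' - D' * D + C' * B) := by
  simp only [superComm, evenPart, oddPart, toBlocks_fromBlocks₁₁, toBlocks_fromBlocks₁₂,
    toBlocks_fromBlocks₂₁, toBlocks_fromBlocks₂₂, fromBlocks_multiply, fromBlocks_add,
    sub_eq_add_neg, fromBlocks_neg, fromBlocks_inj, Matrix.mul_zero, Matrix.zero_mul, add_zero,
    zero_add]
  refine ⟨?_, ?_, ?_, ?_⟩ <;> abel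

theorem superComm_mem_osp {X Y : SuperMatrix k m n} (hX : X ∈ osp k m n) (hY : Y ∈ osp k m n) :
    superComm X Y ∈ osp k m n := by
  obtain ⟨A, B, C, D, rfl⟩ : ∃ A B C D, X = fromBlocks A B C D :=
    ⟨_, _, _, _, (fromBlocks_toBlocks X).symm⟩
  obtain ⟨A', B', C', D', rfl⟩ : ∃ A B C D, Y = fromBlocks A B C D :=
    ⟨_, _, _, _, (fromBlocks_toBlocks Y).symm⟩
  have hX := (ospCondition_iff _).1 hX
  have hY := (ospCondition_iff _).1 hY
  rw [superComm_fromBlocks]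
  refine (ospCondition_iff _).2 ?_
  simp only [toBlocks_fromBlocks₁₁, toBlocks_fromBlocks₁₂, toBlocks_fromBlocks₂₁,
    toBlocks_fromBlocks₂₂, transpose_add, transpose_sub, transpose_mul] at *
  obtain ⟨a1, a2, a3, a4⟩ := hX
  obtain ⟨b1, b2, b3, b4⟩ := hY
  rw [add_eq_zero_iff_eq_neg] at a1 b1 a4 b4
  rw [add_comm, add_eq_zero_iff_eq_neg] at a2 b2
  rw [neg_add_eq_zero] at a3 b3
  simp only [a1, b1, a3, b3]
  set J := Matrix.J n k
  have e1 : ∀ Z : Matrix (n ⊕ n) m k, Zᵀ * (Dᵀ * J) = -(Zᵀ * (J * D)) := fun Z => by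
    rw [a4, Matrix.mul_neg]
  have e2 : ∀ Z : Matrix (n ⊕ n) m k, Zᵀ * (D'ᵀ * J) = -(Zᵀ * (J * D')) := fun Z => by
    rw [b4, Matrix.mul_neg]
  have e3 : D'ᵀ * (Dᵀ * J) = J * (D' * D) := by
    rw [a4, Matrix.mul_neg, ← Matrix.mul_assoc, b4, Matrix.neg_mul, neg_neg, Matrix.mul_assoc]
  have e4 : Dᵀ * (D'ᵀ * J) = J * (D * D') := by
    rw [b4, Matrix.mul_neg, ← Matrix.mul_assoc, a4, Matrix.neg_mul, neg_neg, Matrix.mul_assoc]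
  have e5 : Dᵀ * (J * C') = -(J * (D * C')) := by
    rw [← Matrix.mul_assoc, a4, Matrix.neg_mul, Matrix.mul_assoc]
  have e6 : D'ᵀ * (J * C) = -(J * (D' * C)) := by
    rw [← Matrix.mul_assoc, b4, Matrix.neg_mul, Matrix.mul_assoc]
  simp only [a2, b2, Matrix.mul_add, Matrix.add_mul, Matrix.mul_sub, Matrix.sub_mul, Matrix.mul_neg,
    Matrix.neg_mul, Matrix.mul_assoc, e1, e2, e3, e4, e5, e6]
  refine ⟨?_, ?_, ?_, ?_⟩ <;> abel

theorem superComm_add_left (X X' Y : SuperMatrix k m n) :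
    superComm (X + X') Y = superComm X Y + superComm X' Y := by
  rw [← fromBlocks_toBlocks X, ← fromBlocks_toBlocks X', ← fromBlocks_toBlocks Y]
  simp only [superComm_fromBlocks, fromBlocks_add, fromBlocks_inj, Matrix.mul_add, Matrix.add_mul]
  refine ⟨?_, ?_, ?_, ?_⟩ <;> abel

theorem superComm_add_right (X Y Y' : SuperMatrix k m n) :
    superComm X (Y + Y') = superComm X Y + superComm X Y' := by
  rw [← fromBlocks_toBlocks X, ← fromBlocks_toBlocks Y, ← fromBlocks_toBlocks Y']
  simp only [superComm_fromBlocks, fromBlocks_add, fromBlocks_inj, Matrix.mul_add, Matrix.add_mul]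
  refine ⟨?_, ?_, ?_, ?_⟩ <;> abel

theorem superComm_smul_left (c : k) (X Y : SuperMatrix k m n) :
    superComm (c • X) Y = c • superComm X Y := by
  rw [← fromBlocks_toBlocks X, ← fromBlocks_toBlocks Y]
  simp only [superComm_fromBlocks, fromBlocks_smul, Matrix.smul_mul, Matrix.mul_smul, smul_add,
    smul_sub]

theorem superComm_smul_right (c : k) (X Y : SuperMatrix k m n) :
    superComm X (c • Y) = c • superComm X Y := by
  rw [← fromBlocks_toBlocks X, ← fromBlocks_toBlocks Y]
  simp only [superComm_fromBlocks, fromBlocks_smul, Matrix.smul_mul, Matrix.mul_smul, smul_add,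
    smul_sub]

variable (k m n)

/-- The product of `osp(m, 2n)`. -/
def ospMul : osp k m n →ₗ[k] osp k m n →ₗ[k] osp k m n :=
  LinearMap.mk₂ k (fun X Y => ⟨superComm X.1 Y.1, superComm_mem_osp X.2 Y.2⟩)
    (fun _ _ _ => Subtype.ext (superComm_add_left _ _ _))
    (fun _ _ _ => Subtype.ext (superComm_smul_left _ _ _))
    (fun _ _ _ => Subtype.ext (superComm_add_right _ _ _))
    (fun _ _ _ => Subtype.ext (superComm_smul_right _ _ _))

/-- The grading of `osp(m, 2n)` by even and odd matrices. -/
def ospGrading (i : ZMod 2) : Submodule k (osp k m n) where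
  carrier := {X | if i = 0 then X.1.toBlocks₁₂ = 0 ∧ X.1.toBlocks₂₁ = 0
    else X.1.toBlocks₁₁ = 0 ∧ X.1.toBlocks₂₂ = 0}
  zero_mem' := by
    simp only [Set.mem_ofPred_eq]
    split_ifs <;> exact ⟨rfl, rfl⟩
  add_mem' := by
    intro X Y hX hY
    simp only [Set.mem_ofPred_eq] at *
    split_ifs at * with h
    · exact ⟨(congrArg₂ (· + ·) hX.1 hY.1).trans (add_zero 0),
        (congrArg₂ (· + ·) hX.2 hY.2).trans (add_zero 0)⟩
    · exact ⟨(congrArg₂ (· + ·) hX.1 hY.1).trans (add_zero 0),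
        (congrArg₂ (· + ·) hX.2 hY.2).trans (add_zero 0)⟩
  smul_mem' := by
    intro c X hX
    simp only [Set.mem_ofPred_eq] at *
    split_ifs at * with h
    · exact ⟨(congrArg (c • ·) hX.1).trans (smul_zero c),
        (congrArg (c • ·) hX.2).trans (smul_zero c)⟩
    · exact ⟨(congrArg (c • ·) hX.1).trans (smul_zero c),
        (congrArg (c • ·) hX.2).trans (smul_zero c)⟩

end Orthosymplectic

/-! ### The spin module -/

section Spin

attribute [local instance] LieRing.ofAssociativeRing

variable (k V : Type*) [Field k] [AddCommGroup V] [Module k V]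

/-- The hyperbolic quadratic form `q(f, v) = f v` on `V* ⊕ V`. -/
abbrev hyp : QuadraticForm k (Module.Dual k V × V) := QuadraticForm.dualProd k V

/-- The space `W = (V* ⊕ V) ⊕ k u`, with `u = (0, 1)`. -/
abbrev W : Type _ := (Module.Dual k V × V) × k

/-- The quadratic form `q((f, v), α) = f v - α²` on `W`. -/
abbrev qW : QuadraticForm k (W k V) := CliffordAlgebra.EquivEven.Q' (hyp k V)

/-- The orthogonal Lie algebra `so(W, q)`. -/
abbrev so : LieSubalgebra k (Module.End k (W k V)) := skewAdjointLieSubalgebra (qW k V).polarBilin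

/-- The spin module `S = ⋀V`. -/
abbrev S : Type _ := ExteriorAlgebra k V

variable {k V}

theorem polar_qW (x y : W k V) : (qW k V).polarBilin x y =
    x.1.1 y.1.2 + y.1.1 x.1.2 - 2 * (x.2 * y.2) := by
  obtain ⟨⟨f, v⟩, a⟩ := x
  obtain ⟨⟨g, w⟩, b⟩ := y
  simp [QuadraticMap.polar]
  ring

theorem polar_comm (x y : W k V) : (qW k V).polarBilin x y = (qW k V).polarBilin y x := by
  rw [polar_qW, polar_qW]; ring

theorem mem_so {A : Module.End k (W k V)} : A ∈ so k V ↔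
    ∀ x y, (qW k V).polarBilin (A x) y = -(qW k V).polarBilin x (A y) := by
  change A ∈ (qW k V).polarBilin.skewAdjointSubmodule ↔ _
  rw [LinearMap.mem_skewAdjointSubmodule]
  refine forall₂_congr fun x y => ?_
  rw [show (-⇑A) y = -(A y) from rfl, map_neg]

/-- The maps `σ_{a,b} = q(a,·)b - q(b,·)a`. -/
def sigma (a b : W k V) : Module.End k (W k V) :=
  ((qW k V).polarBilin a).smulRight b - ((qW k V).polarBilin b).smulRight a

theorem sigma_mem (a b : W k V) : sigma a b ∈ so k V := by
  rw [mem_so]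
  intro x y
  simp only [sigma, LinearMap.sub_apply, LinearMap.smulRight_apply, map_sub, map_smul,
    LinearMap.smul_apply, smul_eq_mul]
  rw [polar_comm x a, polar_comm x b]
  ring

/-- The commutator `[a,b] = a·b - b·a` of two vectors of `W`, in the even Clifford algebra. -/
def evenComm : W k V →ₗ[k] W k V →ₗ[k] CliffordAlgebra.even (qW k V) :=
  (CliffordAlgebra.even.ι (qW k V)).bilin - (CliffordAlgebra.even.ι (qW k V)).bilin.flip

/-- The action of `V* ⊕ V` on `⋀V`: `v` acts by left multiplication, `f` by the odd superderivation
extending it. -/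
def fock : Module.Dual k V × V →ₗ[k] Module.End k (S k V) :=
  (CliffordAlgebra.contractLeft (Q := (0 : QuadraticForm k V))) ∘ₗ LinearMap.fst k _ _ +
    (LinearMap.mul k (S k V)) ∘ₗ (ExteriorAlgebra.ι k) ∘ₗ LinearMap.snd k _ _

theorem fock_sq (x : Module.Dual k V × V) :
    fock x * fock x = algebraMap k (Module.End k (S k V)) (hyp k V x) := by
  obtain ⟨f, v⟩ := x
  refine LinearMap.ext fun s => ?_
  have h1 := CliffordAlgebra.contractLeft_contractLeft (Q := (0 : QuadraticForm k V)) f s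
  have h2 := CliffordAlgebra.contractLeft_ι_mul (Q := (0 : QuadraticForm k V)) f v s
  have h3 : ExteriorAlgebra.ι k v * (ExteriorAlgebra.ι k v * s) = 0 := by
    rw [← mul_assoc, ExteriorAlgebra.ι_sq_zero, zero_mul]
  simp only [fock, Module.End.mul_apply, LinearMap.add_apply, LinearMap.comp_apply,
    LinearMap.fst_apply, LinearMap.snd_apply, LinearMap.mul_apply', mul_add, h1, h3,
    Module.algebraMap_end_apply, QuadraticForm.dualProd_apply]
  refine (congrArg (fun z => 0 + ExteriorAlgebra.ι k v *
    (CliffordAlgebra.contractLeft (Q := (0 : QuadraticForm k V)) f s) + (z + 0)) h2).trans ?_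
  simp [ExteriorAlgebra.ι]

/-- The representation `Λ` of the Clifford algebra of `V* ⊕ V` on `⋀V`. -/
def Lam : CliffordAlgebra (hyp k V) →ₐ[k] Module.End k (S k V) :=
  CliffordAlgebra.lift (hyp k V) ⟨fock, fock_sq⟩

variable {l : ℕ} (v : Module.Basis (Fin l) k V)

/-- The vectors `u`, `vᵢ` and `fᵢ` of `W`. -/
def uW : W k V := ((0, 0), 1)
def vW (i : Fin l) : W k V := ((0, v i), 0)
def fW (i : Fin l) : W k V := ((v.coord i, 0), 0)

/-- The embedding of `so(W,q)` into the even Clifford algebra that takes `σ_{a,b}` to `-½[a,b]`. It is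
given by `A ↦ -¼ ∑ [eᵢ, A eⁱ]` for any pair of `q`-dual bases, here `u, vᵢ, fᵢ` and `-½u, fᵢ, vᵢ`. -/
def soToEven : so k V →ₗ[k] CliffordAlgebra.even (qW k V) where
  toFun A := -(1 / 4 : k) • (-(1 / 2 : k) • evenComm uW (A.1 uW) +
    ∑ i, (evenComm (vW v i) (A.1 (fW v i)) + evenComm (fW v i) (A.1 (vW v i))))
  map_add' A B := by
    have h : ∀ x, (A + B).1 x = A.1 x + B.1 x := fun _ => rfl
    simp only [h, map_add, Finset.sum_add_distrib, smul_add]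
    abel
  map_smul' c A := by
    have h : ∀ x, (c • A).1 x = c • A.1 x := fun _ => rfl
    simp only [h, map_smul, RingHom.id_apply, ← smul_add, ← Finset.smul_sum]
    rw [smul_comm _ c, ← smul_add, smul_comm _ c]

theorem soToEven_sigma [NeZero (2 : k)] (a b : W k V) :
    soToEven v ⟨sigma a b, sigma_mem a b⟩ = -(1 / 2 : k) • evenComm a b := by
  have h2 : (2 : k) ≠ 0 := NeZero.ne _
  -- expansion of a vector of `W`, and skew-symmetry of the commutator
  have hx : ∀ x : W k V, x = (-(1 / 2) * (qW k V).polarBilin x uW) • uW +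
      ∑ i, ((qW k V).polarBilin x (fW v i) • vW v i +
        (qW k V).polarBilin x (vW v i) • fW v i) := by
    rintro ⟨⟨f, w⟩, a⟩
    simp only [polar_qW, uW, vW, fW]
    refine Prod.ext (Prod.ext ?_ ?_) ?_
    · simp [Prod.fst_sum]
    · simp [Prod.fst_sum, Prod.snd_sum]
    · simp [Prod.snd_sum, ← mul_assoc, h2]
  have hs : ∀ x y : W k V, evenComm x y = -evenComm y x := fun x y => by
    simp [evenComm]
  have key : ∀ x y : W k V, -(1 / 2 : k) • (qW k V).polarBilin x uW • evenComm uW y +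
      ∑ i, ((qW k V).polarBilin x (fW v i) • evenComm (vW v i) y +
        (qW k V).polarBilin x (vW v i) • evenComm (fW v i) y) = evenComm x y := fun x y => by
    conv_rhs => rw [hx x]
    simp only [map_add, map_smul, map_sum, LinearMap.add_apply, LinearMap.smul_apply,
      LinearMap.sum_apply, smul_smul]
  have hab : evenComm a b = (1 / 2 : k) • (evenComm a b - evenComm b a) := by
    rw [hs b a, sub_neg_eq_add, ← two_smul k, smul_smul, one_div, inv_mul_cancel₀ h2, one_smul]
  have hsig : ∀ x, sigma a b x = (qW k V).polarBilin a x • b - (qW k V).polarBilin b x • a :=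
    fun x => rfl
  change -(1 / 4 : k) • (-(1 / 2 : k) • evenComm uW (sigma a b uW) +
    ∑ i, (evenComm (vW v i) (sigma a b (fW v i)) + evenComm (fW v i) (sigma a b (vW v i)))) = _
  have : -(1 / 2 : k) • evenComm uW (sigma a b uW) +
      ∑ i, (evenComm (vW v i) (sigma a b (fW v i)) + evenComm (fW v i) (sigma a b (vW v i))) =
      evenComm a b - evenComm b a := by
    rw [← key a b, ← key b a, add_sub_add_comm, ← Finset.sum_sub_distrib]
    congr 1
    · simp only [hsig, map_sub, map_smul, smul_sub]
    · refine Finset.sum_congr rfl fun i _ => ?_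
      simp only [hsig, map_sub, map_smul]
      abel
  rw [this]
  conv_rhs => rw [hab]
  rw [smul_smul]
  congr 1
  have h4 : (4 : k) ≠ 0 := by
    rw [show (4 : k) = 2 * 2 by norm_num]
    exact mul_ne_zero h2 h2
  field_simp
  norm_num

/-- The spin representation `ρ` of `so(W,q)` on `⋀V`. -/
def rho : so k V →ₗ[k] Module.End k (S k V) :=
  Lam.toLinearMap ∘ₗ (CliffordAlgebra.equivEven (hyp k V)).symm.toLinearMap ∘ₗ soToEven v

/-- The linear form `Φ` on `⋀V`: the determinant in top degree, zero in the other degrees. -/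
def Phi : S k V →ₗ[k] k := ExteriorAlgebra.liftAlternating (Pi.single l v.det)

/-- The bilinear form `b(s,t) = Φ(s̄ t)`, with `s ↦ s̄` the involution such that `v̄ = -v` on `V`. -/
def b : LinearMap.BilinForm k (S k V) :=
  (LinearMap.mul k (S k V)).compr₂ (Phi v) ∘ₗ
    (CliffordAlgebra.reverse ∘ₗ CliffordAlgebra.involute.toLinearMap)

variable (k V) in
/-- The form `½ tr(σ τ)` on `so(W,q)`. -/
def halfTrace : LinearMap.BilinForm k (so k V) :=
  LinearMap.mk₂ k (fun A B : so k V => (1 / 2 : k) * LinearMap.trace k (W k V) (A.1 * B.1))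
    (fun A A' B => by simp [add_mul, mul_add])
    (fun c A B => by simp [mul_left_comm])
    (fun A B B' => by simp [mul_add])
    (fun c A B => by simp [mul_left_comm])

theorem halfTrace_nondegenerate [FiniteDimensional k V] [NeZero (2 : k)] :
    (halfTrace k V).Nondegenerate := by
  have h2 : (2 : k) ≠ 0 := NeZero.ne _
  have hsym : ∀ A B, halfTrace k V A B = halfTrace k V B A := fun A B => by
    exact congrArg ((1 / 2 : k) * ·) (LinearMap.trace_mul_comm k A.1 B.1)
  have hsep : ∀ A, (∀ B, halfTrace k V A B = 0) → A = 0 := fun A hA => by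
    have hnd : ∀ x : W k V, (∀ y, (qW k V).polarBilin y x = 0) → x = 0 := by
      rintro ⟨⟨f, w⟩, a⟩ h
      simp only [polar_qW] at h
      refine Prod.ext (Prod.ext ?_ ?_) ?_
      · ext x
        simpa using h ((0, x), 0)
      · exact (Module.forall_dual_apply_eq_zero_iff k w).1 fun g => by simpa using h ((g, 0), 0)
      · simpa [h2] using h ((0, 0), 1)
    refine Subtype.ext (LinearMap.ext fun x => hnd _ fun y => ?_)
    have h := hA ⟨sigma y x, sigma_mem y x⟩
    have e : A.1 * sigma y x = ((qW k V).polarBilin y).smulRight (A.1 x) -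
        ((qW k V).polarBilin x).smulRight (A.1 y) := by
      ext z <;> simp [sigma]
    change (1 / 2 : k) * LinearMap.trace k (W k V) (A.1 * sigma y x) = 0 at h
    have ts : ∀ P Q : W k V →ₗ[k] W k V,
        LinearMap.trace k (W k V) (P - Q) = LinearMap.trace k (W k V) P - LinearMap.trace k (W k V) Q :=
      fun P Q => (LinearMap.trace k (W k V)).map_sub P Q
    rw [e, ts, LinearMap.trace_smulRight, LinearMap.trace_smulRight,
      polar_comm x, mem_so.1 A.2 y x, sub_neg_eq_add, ← two_mul] at h
    simpa [h2] using h
  exact ⟨hsep, fun A hA => hsep A fun B => (hsym A B).trans (hA B)⟩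

/-- The product of two elements of the spin module: the element `[s,t]` of `so(W,q)` such that
`½ tr(σ[s,t]) = b(ρ(σ)s, t)` for all `σ`. -/
def oddMul [NeZero (2 : k)] : S k V →ₗ[k] S k V →ₗ[k] so k V :=
  haveI : FiniteDimensional k V := Module.Finite.of_basis v
  LinearMap.mk₂ k (fun s t : S k V =>
      ((halfTrace k V).toDual halfTrace_nondegenerate).symm
        ((b v).flip t ∘ₗ (rho v).flip s))
    (fun s s' t => by rw [← map_add]; congr 1; ext; simp)
    (fun c s t => by rw [← map_smul]; congr 1; ext; simp)
    (fun s t t' => by rw [← map_add]; congr 1; ext; simp)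
    (fun c s t => by rw [← map_smul]; congr 1; ext; simp)

theorem halfTrace_oddMul [NeZero (2 : k)] (A : so k V) (s t : S k V) :
    (1 / 2 : k) * LinearMap.trace k (W k V) (A.1 * (oddMul v s t).1) = b v (rho v A s) t := by
  have : FiniteDimensional k V := Module.Finite.of_basis v
  change halfTrace k V A (oddMul v s t) = _
  have hsym : halfTrace k V A (oddMul v s t) = halfTrace k V (oddMul v s t) A := by
    exact congrArg ((1 / 2 : k) * ·) (LinearMap.trace_mul_comm k A.1 (oddMul v s t).1)
  rw [hsym]
  exact LinearMap.BilinForm.apply_toDual_symm_apply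
    (hB := halfTrace_nondegenerate) _ _

/-- The product of `g = so(W,q) ⊕ S`. -/
def gMul [NeZero (2 : k)] :
    (so k V × S k V) →ₗ[k] (so k V × S k V) →ₗ[k] (so k V × S k V) :=
  LinearMap.mk₂ k
    (fun x y : so k V × S k V => (⁅x.1, y.1⁆ + oddMul v x.2 y.2, rho v x.1 y.2 - rho v y.1 x.2))
    (fun x x' y => by
      ext1
      · simp only [Prod.fst_add, Prod.snd_add, add_lie, map_add, LinearMap.add_apply]; abel
      · simp only [Prod.fst_add, Prod.snd_add, map_add, LinearMap.add_apply]; abel)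
    (fun c x y => by
      ext1
      · simp only [Prod.smul_fst, Prod.smul_snd, smul_lie, map_smul, LinearMap.smul_apply, smul_add]
      · simp only [Prod.smul_fst, Prod.smul_snd, map_smul, LinearMap.smul_apply, smul_sub])
    (fun x y y' => by
      ext1
      · simp only [Prod.fst_add, Prod.snd_add, lie_add, map_add]; abel
      · simp only [Prod.fst_add, Prod.snd_add, map_add, LinearMap.add_apply]; abel)
    (fun c x y => by
      ext1
      · simp only [Prod.smul_fst, Prod.smul_snd, lie_smul, map_smul, smul_add]
      · simp only [Prod.smul_fst, Prod.smul_snd, map_smul, LinearMap.smul_apply, smul_sub])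

variable (k V) in
/-- The grading of `g = so(W,q) ⊕ S`. -/
def gGrading (i : ZMod 2) : Submodule k (so k V × S k V) :=
  if i = 0 then Submodule.prod ⊤ ⊥ else Submodule.prod ⊥ ⊤

end Spin

end SpinLie

end

/-! The whole question is reduced to eigenvalues on one family of triples. The elements `σ_{u,vᵢ}`
and `σ_{u,fᵢ}` of `so(W,q)` act on `⋀V`, up to sign, as the creation operator `cr v i` and the
annihilation operator `an v i` (`R_sg_u`). The form `b` is invariant (`bb_R`) and has the symmetry
sign `eps k l`, so the odd product is equivariant (`lie_om`) and satisfies `[t,s] = -eps [s,t]`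
(`om_symm`). Since `[1, v₁⋯vₗ] ≠ 0`, this sign decides whether a Lie algebra or a Lie superalgebra
is possible, and beyond it only the Jacobi identity for three odd elements is a condition.

The cyclic sum `jac` of that identity is an equivariant trilinear map. Annihilation operators kill
`1` and generate everything from the top element `tp v`; creation operators generate everything from
`1`. Hence `jac` is zero as soon as it vanishes on all triples `(1, w, tp v)`
(`eq_zero_of_equivariant`). On a word `w` of length `m` its value there is `cf k l m / 2` times `w`
(`jac_one_wd_tp`), and `cf_eq_zero_iff` finds when all these scalars vanish. The vanishing of
`[[s,s],s]` needs an argument of its own, because the Jacobi identity only gives it three times: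
mixed terms cancel, so the cubic map is additive, and it vanishes on words (`R_om_self_wd`).

Simplicity for `l ≥ 3`: a root of `so(W,q)` involves at most two coordinates and a weight of `S`
involves all of them, so three commuting coroots separate the even from the odd part of any ideal.
The rest follows because `S` is irreducible and faithful and the odd products span `so(W,q)`
(`gMul_ideal`).

To recognise a contragredient Lie algebra, a map from the free Lie algebra onto a simple Lie algebra
with Chevalley generators is shown to have the largest admissible ideal as its kernel
(`sSup_admissibleIdeals_eq_ker`). The root lattice grading is seen through an action of the torus
`(kˣ)^B`, whose characters are independent over an infinite field; weights of the Cartan subalgebra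
would not do, being only defined modulo the characteristic. An admissible ideal with nonzero image
would contain a preimage of some `h j`, and the triangular decomposition rules out its degree zero
component. For `l = 4` and `l = 3` the generators are root vectors of `so(W,q)` together with one
pair of complementary words in `S`.

For `l = 1, 2` the elements `[s,t]` act on `S` as the symplectic maps `z ↦ b(s,z) t + b(t,z) s` up
to a factor (`R_om_of_le_two`), so `so(W,q)` is the symplectic Lie algebra of `S` and the sum is
`osp(1, 2l)`. -/

noncomputable section

namespace SpinLie

attribute [local instance] LieRing.ofAssociativeRing

variable {k V : Type*} [Field k] [AddCommGroup V] [Module k V]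

/-! ### The polar form, the maps `σ_{a,b}` and the Clifford operators. -/

section Operations

scoped instance : AddCommGroup (so k V) := inferInstance
scoped instance : @Module k (so k V) _ AddCommGroup.toAddCommMonoid := inferInstance
scoped instance : Add (so k V) := (inferInstance : AddCommGroup (so k V)).toAdd
scoped instance : Neg (so k V) := (inferInstance : AddCommGroup (so k V)).toNeg
scoped instance : Sub (so k V) := (inferInstance : AddCommGroup (so k V)).toSub
scoped instance : Zero (so k V) := AddMonoid.toZero
scoped instance : SMul k (so k V) := Module.toDistribMulAction.toSMul
scoped instance : AddCommGroup (W k V) := inferInstance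
scoped instance : @Module k (W k V) _ AddCommGroup.toAddCommMonoid := inferInstance
scoped instance : AddCommGroup (S k V) := inferInstance
scoped instance : @Module k (S k V) _ AddCommGroup.toAddCommMonoid := inferInstance
scoped instance : Ring (Module.End k (S k V)) := inferInstance
scoped instance : AddCommGroup (Module.End k (S k V)) := inferInstance

/-! Unbundled versions of the bilinear operations of the construction. -/

/-- The polar form of `W`. -/
def pol (x y : W k V) : k := (qW k V).polarBilin x y

theorem pol_def (x y : W k V) : pol x y = (qW k V).polarBilin x y := rfl
theorem pol_eq (x y : W k V) : pol x y = x.1.1 y.1.2 + y.1.1 x.1.2 - 2 * (x.2 * y.2) :=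
  polar_qW x y
theorem pol_comm (x y : W k V) : pol x y = pol y x := polar_comm x y
theorem pol_add_left (x y z : W k V) : pol (x + y) z = pol x z + pol y z :=
  congrFun (congrArg DFunLike.coe ((qW k V).polarBilin.map_add x y)) z
theorem pol_smul_left (c : k) (x z : W k V) : pol (c • x) z = c * pol x z :=
  congrFun (congrArg DFunLike.coe ((qW k V).polarBilin.map_smul c x)) z
theorem pol_sub_right (x y z : W k V) : pol z (x - y) = pol z x - pol z y :=
  ((qW k V).polarBilin z).map_sub x y
theorem pol_sub_left (x y z : W k V) : pol (x - y) z = pol x z - pol y z := by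
  rw [pol_comm, pol_sub_right, pol_comm z, pol_comm z]
theorem pol_smul_right (c : k) (x z : W k V) : pol z (c • x) = c * pol z x :=
  ((qW k V).polarBilin z).map_smul c x
theorem pol_zero_right (z : W k V) : pol z 0 = 0 := ((qW k V).polarBilin z).map_zero
theorem pol_zero_left (z : W k V) : pol 0 z = 0 := by rw [pol_comm, pol_zero_right]
theorem pol_sum_right {ι : Type*} (t : Finset ι) (f : ι → W k V) (z : W k V) :
    pol z (∑ i ∈ t, f i) = ∑ i ∈ t, pol z (f i) :=
  map_sum ((qW k V).polarBilin z) f t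

/-- The action of `so(W,q)` on `W`. -/
def ap (A : so k V) (x : W k V) : W k V := A.1 x

theorem ap_add (A : so k V) (x y : W k V) : ap A (x + y) = ap A x + ap A y := A.1.map_add x y
theorem ap_sub (A : so k V) (x y : W k V) : ap A (x - y) = ap A x - ap A y := A.1.map_sub x y
theorem ap_zero (A : so k V) : ap A (0 : W k V) = 0 := A.1.map_zero
theorem ap_smul (A : so k V) (c : k) (x : W k V) : ap A (c • x) = c • ap A x := A.1.map_smul c x
theorem ap_sum (A : so k V) {ι : Type*} (t : Finset ι) (f : ι → W k V) :
    ap A (∑ i ∈ t, f i) = ∑ i ∈ t, ap A (f i) := map_sum A.1 f t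
theorem add_ap (A B : so k V) (x : W k V) : ap (A + B) x = ap A x + ap B x := rfl
theorem neg_ap (A : so k V) (x : W k V) : ap (-A) x = -ap A x := rfl
theorem zero_ap (x : W k V) : ap 0 x = 0 := rfl
theorem smul_ap (c : k) (A : so k V) (x : W k V) : ap (c • A) x = c • ap A x := rfl
theorem lie_ap (A B : so k V) (x : W k V) : ap ⁅A, B⁆ x = ap A (ap B x) - ap B (ap A x) := rfl

theorem so_ext {A B : so k V} (h : ∀ x, ap A x = ap B x) : A = B :=
  Subtype.ext (LinearMap.ext h)

theorem pol_ap (A : so k V) (x y : W k V) : pol (ap A x) y = -pol x (ap A y) := mem_so.1 A.2 x y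

/-- Evaluation at a vector, as a linear map. -/
def soEval (x : W k V) : so k V →ₗ[k] W k V where
  toFun A := ap A x
  map_add' _ _ := rfl
  map_smul' _ _ := rfl

theorem sum_ap {ι : Type*} (t : Finset ι) (f : ι → so k V) (x : W k V) :
    ap (∑ i ∈ t, f i) x = ∑ i ∈ t, ap (f i) x :=
  map_sum (soEval x) f t

theorem so_add_lie (A B C : so k V) : ⁅A + B, C⁆ = ⁅A, C⁆ + ⁅B, C⁆ := add_lie A B C
theorem so_lie_add (A B C : so k V) : ⁅A, B + C⁆ = ⁅A, B⁆ + ⁅A, C⁆ := lie_add A B C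
theorem so_smul_lie (c : k) (A B : so k V) : ⁅c • A, B⁆ = c • ⁅A, B⁆ := smul_lie c A B
theorem so_lie_smul (c : k) (A B : so k V) : ⁅A, c • B⁆ = c • ⁅A, B⁆ := lie_smul c A B
theorem so_lie_zero (A : so k V) : ⁅A, (0 : so k V)⁆ = 0 := lie_zero A
theorem so_zero_lie (A : so k V) : ⁅(0 : so k V), A⁆ = 0 := zero_lie A

/-- `σ_{a,b}` as an element of `so(W,q)`. -/
def sg (a b : W k V) : so k V := ⟨sigma a b, sigma_mem a b⟩

theorem sg_ap (a b x : W k V) : ap (sg a b) x = pol a x • b - pol b x • a := rfl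

/-- The operators through which the two factors of an even product of vectors of `W` act. -/
def gp (a : W k V) : Module.End k (S k V) := fock a.1 + a.2 • 1

/-- An even product `a · b` of vectors of `W` acts as `gp a * gm b`: moving `u` past the vector part
of `a` reverses the sign of the `u`-coordinate of the second factor. -/
def gm (a : W k V) : Module.End k (S k V) := fock a.1 - a.2 • 1

theorem gp_eq (a : W k V) : gp a = fock a.1 + a.2 • 1 := rfl
theorem gm_eq (a : W k V) : gm a = fock a.1 - a.2 • 1 := rfl

attribute [irreducible] pol ap sg gp gm

theorem gp_add (a b : W k V) : gp (a + b) = gp a + gp b := by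
  simp only [gp_eq, Prod.fst_add, Prod.snd_add, map_add]; module
theorem gm_add (a b : W k V) : gm (a + b) = gm a + gm b := by
  simp only [gm_eq, Prod.fst_add, Prod.snd_add, map_add]; module
theorem gp_smul (c : k) (a : W k V) : gp (c • a) = c • gp a := by
  simp only [gp_eq, Prod.smul_fst, Prod.smul_snd, map_smul, smul_eq_mul]; module
theorem gm_smul (c : k) (a : W k V) : gm (c • a) = c • gm a := by
  simp only [gm_eq, Prod.smul_fst, Prod.smul_snd, map_smul, smul_eq_mul]; module
theorem gp_neg (a : W k V) : gp (-a) = -gp a := by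
  rw [← neg_one_smul k, gp_smul, neg_one_smul]
theorem gm_neg (a : W k V) : gm (-a) = -gm a := by
  rw [← neg_one_smul k, gm_smul, neg_one_smul]
theorem gp_sub (a b : W k V) : gp (a - b) = gp a - gp b := by
  rw [sub_eq_add_neg, gp_add, gp_neg, sub_eq_add_neg]
theorem gm_sub (a b : W k V) : gm (a - b) = gm a - gm b := by
  rw [sub_eq_add_neg, gm_add, gm_neg, sub_eq_add_neg]

theorem fock_mul_add (x y : Module.Dual k V × V) :
    fock x * fock y + fock y * fock x = (x.1 y.2 + y.1 x.2) • (1 : Module.End k (S k V)) := by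
  have h := fock_sq (x + y)
  have h1 := fock_sq x
  have h2 := fock_sq y
  rw [Algebra.algebraMap_eq_smul_one] at h h1 h2
  simp only [map_add, add_mul, mul_add, h1, h2, QuadraticForm.dualProd_apply, Prod.fst_add,
    Prod.snd_add, LinearMap.add_apply, add_smul] at h
  rw [add_smul, ← sub_eq_zero] at *
  rw [← h]
  abel

/-- With `gm_gp_add` this says that the off-diagonal block operator with blocks `gp a` and `gm a`
gives a Clifford action of `W` on `S ⊕ S`. The opposite signs of the scalar parts produce the term
`-2αβ` of the polar form. -/
theorem gp_gm_add (a b : W k V) :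
    gp a * gm b + gp b * gm a = pol a b • (1 : Module.End k (S k V)) := by
  rw [pol_eq]
  have h := fock_mul_add a.1 b.1
  simp only [gp_eq, gm_eq, add_mul, mul_sub, smul_mul_assoc, mul_smul_comm, one_mul, mul_one]
  rw [sub_smul, ← h]
  module

theorem gm_gp_add (a b : W k V) :
    gm a * gp b + gm b * gp a = pol a b • (1 : Module.End k (S k V)) := by
  rw [pol_eq]
  have h := fock_mul_add a.1 b.1
  simp only [gp_eq, gm_eq, sub_mul, mul_add, smul_mul_assoc, mul_smul_comm, one_mul, mul_one]
  rw [sub_smul, ← h]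
  module

theorem sg_add_left (a b c : W k V) : sg (a + b) c = sg a c + sg b c := so_ext fun x => by
  simp only [sg_ap, add_ap, pol_add_left]; module
theorem sg_add_right (a b c : W k V) : sg c (a + b) = sg c a + sg c b := so_ext fun x => by
  simp only [sg_ap, add_ap, pol_add_left]; module
theorem sg_smul_left (r : k) (a c : W k V) : sg (r • a) c = r • sg a c := so_ext fun x => by
  simp only [sg_ap, smul_ap, pol_smul_left]; module
theorem sg_smul_right (r : k) (a c : W k V) : sg c (r • a) = r • sg c a := so_ext fun x => by
  simp only [sg_ap, smul_ap, pol_smul_left]; module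
theorem sg_self (a : W k V) : sg a a = 0 := so_ext fun x => by
  rw [sg_ap, sub_self, zero_ap]
theorem sg_swap (a b : W k V) : sg a b = -sg b a := so_ext fun x => by
  rw [neg_ap, sg_ap, sg_ap, neg_sub]
theorem sg_zero_left (a : W k V) : sg 0 a = 0 := by
  rw [← zero_smul k (0 : W k V), sg_smul_left, zero_smul]
theorem sg_zero_right (a : W k V) : sg a 0 = 0 := by
  rw [← zero_smul k (0 : W k V), sg_smul_right, zero_smul]

/-- Skewness of `A` moves it from the argument onto the vectors that define the coefficients, so `σ`
is an equivariant map on pairs of vectors. -/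
theorem lie_sg (A : so k V) (a b : W k V) : ⁅A, sg a b⁆ = sg (ap A a) b + sg a (ap A b) :=
  so_ext fun x => by
    simp only [lie_ap, add_ap, sg_ap, ap_sub, ap_smul, pol_ap]
    module

end Operations

/-! ### The spin map is a representation of `so(W,q)`. -/

section SpinRepresentation

variable {l : ℕ} (v : Module.Basis (Fin l) k V)

/-- The spin representation. -/
def R (A : so k V) : Module.End k (S k V) := rho v A

theorem R_eq (A : so k V) : R v A =
    Lam ((CliffordAlgebra.equivEven (hyp k V)).symm (soToEven v A)) := rfl

theorem rho_eq_R (A : so k V) : rho v A = R v A := rfl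
theorem R_add (A B : so k V) : R v (A + B) = R v A + R v B := (rho v).map_add A B
theorem R_sub (A B : so k V) : R v (A - B) = R v A - R v B := (rho v).map_sub A B
theorem R_neg (A : so k V) : R v (-A) = -R v A := (rho v).map_neg A
theorem R_zero : R v (0 : so k V) = 0 := (rho v).map_zero
theorem R_smul (c : k) (A : so k V) : R v (c • A) = c • R v A := (rho v).map_smul c A
theorem R_sum {ι : Type*} (t : Finset ι) (f : ι → so k V) :
    R v (∑ i ∈ t, f i) = ∑ i ∈ t, R v (f i) := map_sum (rho v) f t

theorem Lam_symm_evenComm (a b : W k V) :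
    Lam ((CliffordAlgebra.equivEven (hyp k V)).symm (evenComm a b)) =
      gp a * gm b - gp b * gm a := by
  have key : ∀ a b : W k V, Lam ((CliffordAlgebra.equivEven (hyp k V)).symm
      ((CliffordAlgebra.even.ι (qW k V)).bilin a b)) = gp a * gm b := by
    intro a b
    have h : (CliffordAlgebra.equivEven (hyp k V)).symm
      ((CliffordAlgebra.even.ι (qW k V)).bilin a b) = _ := CliffordAlgebra.ofEven_ι (hyp k V) a b
    rw [h]
    simp [Lam, gp_eq, gm_eq, Algebra.algebraMap_eq_smul_one]
  rw [← key, ← key, ← map_sub, ← map_sub]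
  rfl

variable [NeZero (2 : k)]

theorem R_sg (a b : W k V) :
    R v (sg a b) = -(1 / 2 : k) • (gp a * gm b - gp b * gm a) := by
  rw [R_eq, sg, soToEven_sigma, map_smul, map_smul, Lam_symm_evenComm]

attribute [irreducible] R

/-- The vector `u` turns a Clifford generator into an even element, so creation and annihilation
operators lie in the image of `so(W,q)`. All later arguments on generation and irreducibility rest
on this. -/
theorem R_sg_u (x : Module.Dual k V × V) : R v (sg uW (x, 0)) = -fock x := by
  have h2 : (2 : k) ≠ 0 := NeZero.ne _
  rw [R_sg]
  have e : ((0, 0) : Module.Dual k V × V) = 0 := rfl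
  simp only [gp_eq, gm_eq, uW, e, map_zero, one_smul, zero_smul, zero_add,
    zero_sub, one_mul, sub_zero, add_zero, mul_neg, mul_one]
  match_scalars
  field_simp
  norm_num

-- Expansion in the dual bases `u, vᵢ, fᵢ` and `-½u, fᵢ, vᵢ`; the coefficient `-1/2` reflects `pol u
-- u = -2`.
omit [NeZero (2 : k)] in
theorem W_expand [NeZero (2 : k)] (x : W k V) : x = (-(1 / 2) * pol uW x) • uW +
      ∑ i, (pol (fW v i) x • vW v i + pol (vW v i) x • fW v i) := by
  have h2 : (2 : k) ≠ 0 := NeZero.ne _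
  obtain ⟨⟨f, w⟩, a⟩ := x
  simp only [pol_eq, uW, vW, fW]
  refine Prod.ext (Prod.ext ?_ ?_) ?_
  · simp [Prod.fst_sum]
  · simp [Prod.fst_sum, Prod.snd_sum]
  · simp [Prod.snd_sum, ← mul_assoc, h2]

/-- The two halves of the `σ`'s give `A x` twice: once by expanding the value `A x`, once by
expanding the argument `x`. Hence the factor `2` on the left. -/
theorem so_expand (A : so k V) : (2 : k) • A = -(1 / 2 : k) • sg uW (ap A uW) +
    ∑ i, (sg (fW v i) (ap A (vW v i)) + sg (vW v i) (ap A (fW v i))) := by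
  refine so_ext fun x => ?_
  have hA := W_expand v (ap A x)
  have hx := congrArg (ap A) (W_expand v x)
  have hz : ap A x + ap A x = ap A ((-(1 / 2) * pol uW x) • uW +
      ∑ i, (pol (fW v i) x • vW v i + pol (vW v i) x • fW v i)) +
      ((-(1 / 2) * pol uW (ap A x)) • uW +
      ∑ i, (pol (fW v i) (ap A x) • vW v i + pol (vW v i) (ap A x) • fW v i)) := by
    rw [← hA, ← hx]
  rw [add_ap, smul_ap, smul_ap, sum_ap, two_smul, hz]
  simp only [add_ap, ap_add, ap_sum, ap_smul, sg_ap, pol_ap]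
  rw [add_add_add_comm, ← Finset.sum_add_distrib]
  refine congrArg₂ _ ?_ (Finset.sum_congr rfl fun i _ => ?_)
  · module
  · module

-- As `2` is invertible, `so_expand` shows that the `σ_{a,b}` span `so(W,q)`, so linear statements
-- need only be checked on them.
include v in
theorem so_induction {P : so k V → Prop} (h0 : P 0) (hadd : ∀ A B, P A → P B → P (A + B))
    (hsmul : ∀ (c : k) A, P A → P (c • A)) (hsg : ∀ a b, P (sg a b)) (A : so k V) : P A := by
  have h2 : (2 : k) ≠ 0 := NeZero.ne _
  have : A = (1 / 2 : k) • ((2 : k) • A) := by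
    rw [smul_smul, one_div, inv_mul_cancel₀ h2, one_smul]
  rw [this, so_expand v]
  refine hsmul _ _ (hadd _ _ (hsmul _ _ (hsg _ _)) ?_)
  exact Finset.sum_induction _ P hadd h0 fun i _ => hadd _ _ (hsg _ _) (hsg _ _)

omit [NeZero (2 : k)] in
/-- The commutator of two even products, from the Clifford relations. -/
theorem clifford_comm {E : Type*} [Ring E] [Algebra k E] {pa ma pb mb px mx py my : E}
    {bx ax ay y' : k} (h1 : mb * px + mx * pb = bx • 1) (h2 : pa * mx + px * ma = ax • 1)
    (h3 : ma * py + my * pa = ay • 1) (h4 : pb * my + py * mb = y' • 1) :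
    pa * mb * (px * my) - px * my * (pa * mb) =
      bx • (pa * my) - ax • (pb * my) - ay • (px * mb) + y' • (px * ma) := by
  have e1 := eq_sub_of_add_eq h1
  have e2 := eq_sub_of_add_eq h2
  have e3 := eq_sub_of_add_eq' h3
  have e4 := eq_sub_of_add_eq' h4
  have f1 : pa * mb * (px * my) = pa * (mb * px) * my := by noncomm_ring
  have f2 : px * my * (pa * mb) = px * (my * pa) * mb := by noncomm_ring
  have f3 : pa * (mx * pb) * my = pa * mx * (pb * my) := by noncomm_ring
  have f4 : px * (ma * py) * mb = px * ma * (py * mb) := by noncomm_ring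
  rw [f1, f2, e1, e3, mul_sub, mul_sub, sub_mul, sub_mul, f3, f4, e2, e4, sub_mul, mul_sub]
  simp only [mul_smul_comm, smul_mul_assoc, mul_one, one_mul, mul_assoc]
  abel

-- The four terms of `clifford_comm` are the scalar products of `a`, `b` with `x`, `y`; grouped by
-- factor, they are the derivation `-σ_{a,b}` applied to `x` and to `y`.
omit [NeZero (2 : k)] in
theorem gp_gm_comm (a b x y : W k V) :
    gp a * gm b * (gp x * gm y) - gp x * gm y * (gp a * gm b) =
      -(gp (ap (sg a b) x) * gm y + gp x * gm (ap (sg a b) y)) := by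
  rw [clifford_comm (gm_gp_add b x) (gp_gm_add a x) (gm_gp_add a y) (gp_gm_add b y), sg_ap,
    sg_ap, gp_sub, gm_sub, gp_smul, gp_smul, gm_smul, gm_smul, sub_mul, mul_sub,
    smul_mul_assoc, smul_mul_assoc, mul_smul_comm, mul_smul_comm]
  abel

/-- The antisymmetrised form of `gp_gm_comm` in both pairs of vectors, as an identity in an
arbitrary algebra. The extra signs in `h3` and `h4` come from `σ_{b,a} = -σ_{a,b}`. -/
theorem commutator_identity {E : Type*} [Ring E] [Algebra k E]
    {A A' B B' X X' Y Y' C C' D D' : E}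
    (h1 : A * B' * (X * Y') - X * Y' * (A * B') = -(C * Y' + X * D'))
    (h2 : A * B' * (Y * X') - Y * X' * (A * B') = -(D * X' + Y * C'))
    (h3 : B * A' * (X * Y') - X * Y' * (B * A') = -(-(C * Y') + -(X * D')))
    (h4 : B * A' * (Y * X') - Y * X' * (B * A') = -(-(D * X') + -(Y * C'))) :
    -(1 / 2 : k) • (C * Y' - Y * C') + -(1 / 2 : k) • (X * D' - D * X') =
      -(1 / 2 : k) • (A * B' - B * A') * -(1 / 2 : k) • (X * Y' - Y * X') -
      -(1 / 2 : k) • (X * Y' - Y * X') * -(1 / 2 : k) • (A * B' - B * A') := by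
  have h0 : (2 : k) ≠ 0 := NeZero.ne _
  have h5 : (A * B' - B * A') * (X * Y' - Y * X') - (X * Y' - Y * X') * (A * B' - B * A') =
      (A * B' * (X * Y') - X * Y' * (A * B')) - (A * B' * (Y * X') - Y * X' * (A * B')) -
      (B * A' * (X * Y') - X * Y' * (B * A')) + (B * A' * (Y * X') - Y * X' * (B * A')) := by
    noncomm_ring
  rw [smul_mul_smul_comm, smul_mul_smul_comm, ← smul_sub, h5, h1, h2, h3, h4]
  match_scalars <;> field_simp <;> ring

theorem R_lie_sg (a b c d : W k V) : R v ⁅sg a b, sg c d⁆ =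
    R v (sg a b) * R v (sg c d) - R v (sg c d) * R v (sg a b) := by
  have h3 := gp_gm_comm b a c d
  have h4 := gp_gm_comm b a d c
  rw [sg_swap b a, neg_ap, neg_ap, gp_neg, gm_neg, neg_mul, mul_neg] at h3 h4
  rw [lie_sg, R_add, R_sg, R_sg, R_sg, R_sg]
  exact commutator_identity (gp_gm_comm a b c d) (gp_gm_comm a b d c) h3 h4

theorem R_lie (A B : so k V) : R v ⁅A, B⁆ = R v A * R v B - R v B * R v A := by
  induction B using so_induction v with
  | h0 => rw [so_lie_zero, R_zero, mul_zero, zero_mul, sub_zero]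
  | hadd B C hB hC => rw [so_lie_add, R_add, R_add, hB, hC, mul_add, add_mul]; abel
  | hsmul c B hB =>
    rw [so_lie_smul, R_smul, R_smul, hB, mul_smul_comm, smul_mul_assoc, smul_sub]
  | hsg c d =>
    induction A using so_induction v with
    | h0 => rw [so_zero_lie, R_zero, mul_zero, zero_mul, sub_zero]
    | hadd B C hB hC => rw [so_add_lie, R_add, R_add, hB, hC, mul_add, add_mul]; abel
    | hsmul c B hB =>
      rw [so_smul_lie, R_smul, R_smul, hB, mul_smul_comm, smul_mul_assoc, smul_sub]
    | hsg a b => exact R_lie_sg v a b c d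

end SpinRepresentation

/-! ### Monomials in the exterior algebra; creation and annihilation operators. -/

section Words

variable {l : ℕ} (v : Module.Basis (Fin l) k V)

/-- Left multiplication by `vᵢ`. -/
def cr (i : Fin l) : Module.End k (S k V) := fock (0, v i)

/-- The odd superderivation extending the coordinate form `fᵢ`. -/
def an (i : Fin l) : Module.End k (S k V) := fock (v.coord i, 0)

theorem fock_inl_apply (f : Module.Dual k V) (s : S k V) :
    fock (f, 0) s = CliffordAlgebra.contractLeft (Q := (0 : QuadraticForm k V)) f s := by
  simp [fock]

theorem fock_inr_apply (w : V) (s : S k V) : fock (0, w) s = ExteriorAlgebra.ι k w * s := by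
  simp [fock]

theorem cr_apply (i : Fin l) (s : S k V) : cr v i s = ExteriorAlgebra.ι k (v i) * s :=
  fock_inr_apply _ _

theorem an_one (i : Fin l) : an v i 1 = 0 := by
  rw [an, fock_inl_apply]
  exact CliffordAlgebra.contractLeft_one (Q := (0 : QuadraticForm k V)) _

theorem fock_expand (x : Module.Dual k V × V) :
    fock x = ∑ i, (x.1 (v i) • an v i + v.coord i x.2 • cr v i) := by
  have h1 : x.1 = ∑ i, x.1 (v i) • v.coord i := by
    refine v.ext fun j => ?_
    simp
  have h2 : x.2 = ∑ i, v.coord i x.2 • v i := by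
    simp
  have h3 : x = ∑ i, (x.1 (v i) • (v.coord i, (0 : V)) +
      v.coord i x.2 • ((0 : Module.Dual k V), v i)) := by
    refine Prod.ext ?_ ?_
    · simp only [Prod.fst_sum, Prod.fst_add, Prod.smul_fst, smul_zero, add_zero]
      exact h1
    · simp only [Prod.snd_sum, Prod.snd_add, Prod.smul_snd, smul_zero, zero_add]
      exact h2
  conv_lhs => rw [h3]
  simp only [map_sum, map_add, map_smul]
  rfl

theorem an_cr (i j : Fin l) (s : S k V) :
    an v i (cr v j s) = (if i = j then s else 0) - cr v j (an v i s) := by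
  have h := LinearMap.congr_fun (fock_mul_add (v.coord i, 0) ((0 : Module.Dual k V), v j)) s
  rw [LinearMap.add_apply, Module.End.mul_apply, Module.End.mul_apply] at h
  refine eq_sub_of_add_eq (h.trans ?_)
  rcases eq_or_ne i j with rfl | hij
  · simp
  · simp [hij]

theorem cr_cr (i j : Fin l) (s : S k V) : cr v i (cr v j s) = -cr v j (cr v i s) := by
  have h := LinearMap.congr_fun (fock_mul_add ((0 : Module.Dual k V), v i) (0, v j)) s
  rw [LinearMap.add_apply, Module.End.mul_apply, Module.End.mul_apply] at h
  refine eq_neg_of_add_eq_zero_left (h.trans ?_)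
  simp

theorem an_an (i j : Fin l) (s : S k V) : an v i (an v j s) = -an v j (an v i s) := by
  have h := LinearMap.congr_fun (fock_mul_add (v.coord i, (0 : V)) (v.coord j, 0)) s
  rw [LinearMap.add_apply, Module.End.mul_apply, Module.End.mul_apply] at h
  refine eq_neg_of_add_eq_zero_left (h.trans ?_)
  simp

theorem cr_self (i : Fin l) (s : S k V) : cr v i (cr v i s) = 0 := by
  rw [cr_apply, cr_apply, ← mul_assoc, ExteriorAlgebra.ι_sq_zero, zero_mul]

theorem an_self (i : Fin l) (s : S k V) : an v i (an v i s) = 0 := by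
  rw [an, fock_inl_apply, fock_inl_apply]
  exact CliffordAlgebra.contractLeft_contractLeft (Q := (0 : QuadraticForm k V)) _ _

/-- The product of the `vᵢ` for `i` running through a list. -/
def wd (L : List (Fin l)) : S k V := (L.map fun i => ExteriorAlgebra.ι k (v i)).prod

theorem wd_nil : wd v [] = 1 := rfl

theorem wd_cons (i : Fin l) (L : List (Fin l)) : wd v (i :: L) = cr v i (wd v L) := by
  rw [cr_apply, wd, List.map_cons, List.prod_cons, wd]

theorem wd_eq_ιMulti (L : List (Fin l)) :
    wd v L = ExteriorAlgebra.ιMulti k L.length (fun i => v (L.get i)) := by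
  rw [ExteriorAlgebra.ιMulti_apply, wd]
  congr 1
  conv_lhs => rw [← List.ofFn_get L, List.map_ofFn]
  rfl

theorem cr_wd_mem {L : List (Fin l)} {i : Fin l} (h : i ∈ L) : cr v i (wd v L) = 0 := by
  induction L with
  | nil => simp at h
  | cons j L ih =>
    rw [wd_cons]
    rcases eq_or_ne i j with rfl | hij
    · exact cr_self v i _
    · rw [cr_cr, ih (List.mem_of_ne_of_mem hij h), map_zero, neg_zero]

theorem wd_eq_zero {L : List (Fin l)} (h : ¬L.Nodup) : wd v L = 0 := by
  induction L with
  | nil => simp at h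
  | cons j L ih =>
    rw [wd_cons]
    by_cases hj : j ∈ L
    · exact cr_wd_mem v hj
    · rw [ih fun h' => h (List.nodup_cons.2 ⟨hj, h'⟩), map_zero]

theorem an_wd_notMem {L : List (Fin l)} {i : Fin l} (h : i ∉ L) : an v i (wd v L) = 0 := by
  induction L with
  | nil => exact an_one v i
  | cons j L ih =>
    rw [List.mem_cons, not_or] at h
    rw [wd_cons, an_cr, if_neg h.1, ih h.2, map_zero, sub_zero]

theorem cr_an_wd {L : List (Fin l)} {i : Fin l} (h : i ∈ L) :
    cr v i (an v i (wd v L)) = wd v L := by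
  have := an_cr v i i (wd v L)
  rw [cr_wd_mem v h, map_zero, if_pos rfl] at this
  exact (sub_eq_zero.1 this.symm).symm

theorem an_cr_wd {L : List (Fin l)} {i : Fin l} (h : i ∉ L) :
    an v i (cr v i (wd v L)) = wd v L := by
  rw [an_cr, if_pos rfl, an_wd_notMem v h, map_zero, sub_zero]

theorem wd_mul_ι (L : List (Fin l)) (w : V) :
    wd v L * ExteriorAlgebra.ι k w = (-1 : k) ^ L.length • (ExteriorAlgebra.ι k w * wd v L) := by
  induction L with
  | nil => simp [wd_nil]
  | cons j L ih =>
    have h := eq_neg_of_add_eq_zero_left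
      (ExteriorAlgebra.ι_add_mul_swap (R := k) (v j) w)
    rw [wd_cons, cr_apply, mul_assoc, ih, mul_smul_comm, ← mul_assoc, h, neg_mul, mul_assoc,
      List.length_cons, pow_succ, mul_neg_one, neg_smul, smul_neg]

/-- A subspace stable under left multiplication that contains `1` is everything. -/
theorem eq_top_of_cr {N : Submodule k (S k V)} (h1 : 1 ∈ N)
    (h : ∀ i, ∀ s ∈ N, cr v i s ∈ N) : N = ⊤ := by
  refine eq_top_iff.2 fun s _ => ?_
  induction s using CliffordAlgebra.left_induction with
  | algebraMap r =>
    rw [Algebra.algebraMap_eq_smul_one]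
    exact N.smul_mem r h1
  | add x y hx hy => exact N.add_mem (hx trivial) (hy trivial)
  | ι_mul x m hx =>
    have : CliffordAlgebra.ι (0 : QuadraticForm k V) m * x = fock (0, m) x :=
      (fock_inr_apply m x).symm
    rw [this, fock_expand v, LinearMap.sum_apply]
    refine N.sum_mem fun i _ => ?_
    rw [LinearMap.add_apply, LinearMap.smul_apply, LinearMap.smul_apply]
    simp only [LinearMap.zero_apply, zero_smul, zero_add]
    exact N.smul_mem _ (h i x (hx trivial))

theorem span_wd : Submodule.span k (Set.range (wd v)) = ⊤ := by
  refine eq_top_of_cr v (Submodule.subset_span ⟨[], rfl⟩) fun i s hs => ?_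
  induction hs using Submodule.span_induction with
  | mem x hx =>
    obtain ⟨L, rfl⟩ := hx
    exact Submodule.subset_span ⟨i :: L, wd_cons v i L⟩
  | zero => rw [map_zero]; exact Submodule.zero_mem _
  | add x y _ _ hx hy => rw [map_add]; exact Submodule.add_mem _ hx hy
  | smul c x _ hx => rw [map_smul]; exact Submodule.smul_mem _ c hx

theorem wd_induction {P : S k V → Prop} (h0 : P 0) (hadd : ∀ s t, P s → P t → P (s + t))
    (hsmul : ∀ (c : k) s, P s → P (c • s)) (hwd : ∀ L : List (Fin l), L.Nodup → P (wd v L))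
    (s : S k V) : P s := by
  have hs : s ∈ Submodule.span k (Set.range (wd v)) := by rw [span_wd]; trivial
  induction hs using Submodule.span_induction with
  | mem x hx =>
    obtain ⟨L, rfl⟩ := hx
    by_cases hL : L.Nodup
    · exact hwd L hL
    · rw [wd_eq_zero v hL]; exact h0
  | zero => exact h0
  | add x y _ _ hx hy => exact hadd _ _ hx hy
  | smul c x _ hx => exact hsmul _ _ hx

/-- The top element `v₁⋯vₗ`. -/
def tp : S k V := wd v (List.finRange l)

theorem Phi_wd_of_length_ne {L : List (Fin l)} (h : L.length ≠ l) : Phi v (wd v L) = 0 := by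
  rw [wd_eq_ιMulti, Phi, ExteriorAlgebra.liftAlternating_apply_ιMulti, Pi.single_eq_of_ne h]
  rfl

theorem tp_eq : tp v = ExteriorAlgebra.ιMulti k l v := by
  rw [ExteriorAlgebra.ιMulti_apply, tp, wd, List.ofFn_eq_map]

theorem Phi_ιMulti (x : Fin l → V) : Phi v (ExteriorAlgebra.ιMulti k l x) = v.det x := by
  rw [Phi, ExteriorAlgebra.liftAlternating_apply_ιMulti, Pi.single_eq_same]

theorem Phi_tp : Phi v (tp v) = 1 := by
  rw [tp_eq, Phi_ιMulti, v.det_self]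

/-- Both sides are alternating in `x`, so it suffices to compare them on injective families of basis
vectors, that is, on permutations of the basis, where both give the sign. -/
theorem ιMulti_eq (x : Fin l → V) : ExteriorAlgebra.ιMulti k l x = v.det x • tp v := by
  have h : ExteriorAlgebra.ιMulti k l =
      (LinearMap.toSpanSingleton k (S k V) (tp v)).compAlternatingMap v.det := by
    refine v.ext_alternating fun σ hσ => ?_
    have hb := Finite.injective_iff_bijective.1 hσ
    have e := (ExteriorAlgebra.ιMulti k l).map_perm (v : Fin l → V) (Equiv.ofBijective σ hb)
    have e' := (v.det).map_perm (v : Fin l → V) (Equiv.ofBijective σ hb)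
    rw [v.det_self] at e'
    change ExteriorAlgebra.ιMulti k l (v ∘ Equiv.ofBijective σ hb) =
      (v.det (v ∘ Equiv.ofBijective σ hb)) • tp v
    rw [e, e', tp_eq]
    rcases Int.units_eq_one_or (Equiv.Perm.sign (Equiv.ofBijective σ hb)) with h | h <;>
      simp [h]
  rw [h]
  rfl

theorem wd_eq_smul_tp {L : List (Fin l)} (h : L.length = l) :
    wd v L = Phi v (wd v L) • tp v := by
  have : ∃ x : Fin l → V, wd v L = ExteriorAlgebra.ιMulti k l x := by
    rw [wd_eq_ιMulti]
    revert h
    generalize (fun i => v (L.get i)) = y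
    revert y
    generalize L.length = m
    rintro y rfl
    exact ⟨y, rfl⟩
  obtain ⟨x, hx⟩ := this
  rw [hx, Phi_ιMulti, ← ιMulti_eq]

/-- A subspace stable under the derivations that contains the top element is everything. -/
theorem eq_top_of_an {N : Submodule k (S k V)} (h1 : tp v ∈ N)
    (h : ∀ i, ∀ s ∈ N, an v i s ∈ N) : N = ⊤ := by
  -- Induction on the number `m` of letters missing from `L`: a word is recovered by annihilating a
  -- missing letter from the word lengthened by that letter.
  have key : ∀ m (L : List (Fin l)), L.Nodup → L.length + m = l → wd v L ∈ N := by
    intro m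
    induction m with
    | zero => intro L _ hl; rw [wd_eq_smul_tp v hl]; exact N.smul_mem _ h1
    | succ m ih =>
      intro L hL hl
      obtain ⟨i, hi⟩ : ∃ i, i ∉ L := by
        by_contra! hc
        have : Fintype.card (Fin l) ≤ L.length := by
          rw [← List.toFinset_card_of_nodup hL, ← Finset.card_univ]
          exact Finset.card_le_card fun i _ => List.mem_toFinset.2 (hc i)
        rw [Fintype.card_fin] at this
        omega
      rw [← an_cr_wd v hi, ← wd_cons]
      exact h i _ (ih _ (List.nodup_cons.2 ⟨hi, hL⟩) (by simp; omega))
  refine eq_top_iff.2 fun s _ => ?_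
  induction s using wd_induction v with
  | h0 => exact N.zero_mem
  | hadd s t hs ht => exact N.add_mem (hs trivial) (ht trivial)
  | hsmul c s hs => exact N.smul_mem c (hs trivial)
  | hwd L hL =>
    have : L.length ≤ l := by simpa using hL.length_le_card
    exact key (l - L.length) L hL (by omega)

/-- The constant term. -/
def cst : S k V →ₗ[k] k := (ExteriorAlgebra.algebraMapInv (R := k) (M := V)).toLinearMap

theorem cst_one : cst (1 : S k V) = 1 := map_one (ExteriorAlgebra.algebraMapInv (R := k) (M := V))

theorem cst_cr (i : Fin l) (s : S k V) : cst (cr v i s) = 0 := by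
  change ExteriorAlgebra.algebraMapInv (cr v i s) = 0
  rw [cr_apply, map_mul]
  simp [ExteriorAlgebra.algebraMapInv]

/-- Every `vᵢ` annihilates the top element from the right, since it already occurs in it; only the
constant term of `s` survives. -/
theorem tp_mul (s : S k V) : tp v * s = cst s • tp v := by
  induction s using wd_induction v with
  | h0 => simp
  | hadd s t hs ht => rw [mul_add, hs, ht, map_add, add_smul]
  | hsmul c s hs => rw [mul_smul_comm, hs, map_smul, smul_smul, smul_eq_mul]
  | hwd L hL =>
    cases L with
    | nil => rw [wd_nil, mul_one, cst_one, one_smul]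
    | cons i L =>
      rw [wd_cons, cst_cr, zero_smul, cr_apply, ← mul_assoc, tp, wd_mul_ι, ← cr_apply,
        cr_wd_mem v (List.mem_finRange i), smul_zero, zero_mul]

/-- Uniqueness of the vacuum. On vectors killed by all annihilation operators, one fixed product `X`
of such operators undoes left multiplication by `tp v`. As `tp v * s` is `cst s • tp v`, comparison
with the case `s = 1` gives the claim. -/
theorem eq_cst_of_an_eq_zero {s : S k V} (hs : ∀ i, an v i s = 0) : s = cst s • 1 := by
  have key : ∀ L : List (Fin l), L.Nodup → ∃ X : Module.End k (S k V),
      ∀ s, (∀ i, an v i s = 0) → X (wd v L * s) = s := by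
    intro L hL
    induction L with
    | nil => exact ⟨1, fun s _ => by rw [wd_nil, one_mul, Module.End.one_apply]⟩
    | cons i L ih =>
      rw [List.nodup_cons] at hL
      obtain ⟨X, hX⟩ := ih hL.2
      refine ⟨X * an v i, fun s hs => ?_⟩
      have h0 : ∀ L' : List (Fin l), i ∉ L' → an v i (wd v L' * s) = 0 := by
        intro L' hL'
        induction L' with
        | nil => rw [wd_nil, one_mul, hs]
        | cons j L' ih' =>
          rw [List.mem_cons, not_or] at hL'
          rw [wd_cons, cr_apply, mul_assoc, ← cr_apply, an_cr, if_neg hL'.1, ih' hL'.2, map_zero,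
            sub_zero]
      rw [Module.End.mul_apply, wd_cons, cr_apply, mul_assoc, ← cr_apply, an_cr, if_pos rfl,
        h0 L hL.1, map_zero, sub_zero, hX s hs]
  obtain ⟨X, hX⟩ := key _ (List.nodup_finRange l)
  have h1 := hX 1 (an_one v)
  have h2 := hX s hs
  have e : wd v (List.finRange l) = tp v := rfl
  rw [e, tp_mul, cst_one, one_smul] at h1
  rw [e, tp_mul, map_smul, h1] at h2
  exact h2.symm

/-- A nonzero subspace stable under the derivations contains `1`. -/
theorem one_mem_of_an {N : Submodule k (S k V)} (h : ∀ i, ∀ s ∈ N, an v i s ∈ N) (hN : N ≠ ⊥) :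
    1 ∈ N := by
  -- A nonzero vector is replaced by its image under `an v j` whenever that image is nonzero. The
  -- operators anticommute and square to zero, so vanishing already achieved is not lost.
  have key : ∀ t : Finset (Fin l), ∃ s ∈ N, s ≠ 0 ∧ ∀ i ∈ t, an v i s = 0 := by
    intro t
    induction t using Finset.induction_on with
    | empty =>
      obtain ⟨s, hs, h0⟩ := N.ne_bot_iff.1 hN
      exact ⟨s, hs, h0, by simp⟩
    | insert j t _ ih =>
      obtain ⟨s, hs, h0, hi⟩ := ih
      by_cases hj : an v j s = 0
      · refine ⟨s, hs, h0, fun i hit => ?_⟩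
        rcases Finset.mem_insert.1 hit with rfl | hit
        · exact hj
        · exact hi i hit
      · refine ⟨an v j s, h j s hs, hj, fun i hit => ?_⟩
        rcases Finset.mem_insert.1 hit with rfl | hit
        · exact an_self v i s
        · rw [an_an, hi i hit, map_zero, neg_zero]
  obtain ⟨s, hs, h0, hi⟩ := key Finset.univ
  have e := eq_cst_of_an_eq_zero v fun i => hi i (Finset.mem_univ i)
  have hc : cst s ≠ 0 := by
    intro hc
    rw [hc, zero_smul] at e
    exact h0 e
  have := N.smul_mem (cst s)⁻¹ hs
  rw [e, smul_smul, map_smul, cst_one, smul_eq_mul, mul_one, inv_mul_cancel₀ hc, one_smul] at this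
  exact this

end Words

/-! ### The invariant bilinear form on the spin module and its symmetry. -/

section Form

variable {l : ℕ} (v : Module.Basis (Fin l) k V)

/-- The form `b` of the spin module. -/
def bb (s t : S k V) : k := b v s t

/-- The involution `s ↦ s̄`. -/
def br : S k V →ₗ[k] S k V :=
  CliffordAlgebra.reverse ∘ₗ CliffordAlgebra.involute.toLinearMap

theorem bb_eq (s t : S k V) : bb v s t = Phi v (br s * t) := rfl
theorem bb_add_left (s s' t : S k V) : bb v (s + s') t = bb v s t + bb v s' t :=
  congrFun (congrArg DFunLike.coe ((b v).map_add s s')) t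
theorem bb_smul_left (c : k) (s t : S k V) : bb v (c • s) t = c * bb v s t :=
  congrFun (congrArg DFunLike.coe ((b v).map_smul c s)) t
theorem bb_add_right (s t t' : S k V) : bb v s (t + t') = bb v s t + bb v s t' :=
  (b v s).map_add t t'
theorem bb_smul_right (c : k) (s t : S k V) : bb v s (c • t) = c * bb v s t :=
  (b v s).map_smul c t
theorem bb_neg_right (s t : S k V) : bb v s (-t) = -bb v s t := (b v s).map_neg t
theorem bb_sub_right (s t t' : S k V) : bb v s (t - t') = bb v s t - bb v s t' :=
  (b v s).map_sub t t'
theorem bb_zero_right (s : S k V) : bb v s 0 = 0 := (b v s).map_zero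
theorem bb_neg_left (s t : S k V) : bb v (-s) t = -bb v s t := by
  rw [← neg_one_smul k, bb_smul_left, neg_one_mul]
theorem bb_sub_left (s s' t : S k V) : bb v (s - s') t = bb v s t - bb v s' t := by
  rw [sub_eq_add_neg, bb_add_left, bb_neg_left, sub_eq_add_neg]
theorem bb_zero_left (t : S k V) : bb v 0 t = 0 := by
  rw [← zero_smul k (0 : S k V), bb_smul_left, zero_mul]

theorem br_one : br (1 : S k V) = 1 := by
  change CliffordAlgebra.reverse (CliffordAlgebra.involute (1 : CliffordAlgebra _)) = 1
  rw [map_one, CliffordAlgebra.reverse.map_one]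

theorem br_ι (w : V) : br (ExteriorAlgebra.ι k w) = -ExteriorAlgebra.ι k w := by
  change CliffordAlgebra.reverse (CliffordAlgebra.involute (CliffordAlgebra.ι _ w)) = _
  rw [CliffordAlgebra.involute_ι, map_neg, CliffordAlgebra.reverse_ι]

theorem br_mul (s t : S k V) : br (s * t) = br t * br s := by
  change CliffordAlgebra.reverse (CliffordAlgebra.involute (_ * _ : CliffordAlgebra _)) = _
  rw [map_mul, CliffordAlgebra.reverse.map_mul]
  rfl

theorem br_br (s : S k V) : br (br s) = s := by
  change CliffordAlgebra.reverse (CliffordAlgebra.involute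
    (CliffordAlgebra.reverse (CliffordAlgebra.involute s))) = s
  rw [CliffordAlgebra.reverse_involute_commute.eq, CliffordAlgebra.reverse_reverse,
    CliffordAlgebra.involute_involute]

theorem br_cr (i : Fin l) (s : S k V) : br (cr v i s) = -(br s * ExteriorAlgebra.ι k (v i)) := by
  rw [cr_apply, br_mul, br_ι, mul_neg]

attribute [irreducible] bb br

/-- The span of the products of length `n`. -/
def dg (n : ℕ) : Submodule k (S k V) :=
  Submodule.span k (wd v '' {L | L.length = n})

theorem wd_mem_dg (L : List (Fin l)) : wd v L ∈ dg v L.length :=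
  Submodule.subset_span ⟨L, rfl, rfl⟩

theorem cr_mem_dg {n : ℕ} {s : S k V} (hs : s ∈ dg v n) (i : Fin l) : cr v i s ∈ dg v (n + 1) := by
  induction hs using Submodule.span_induction with
  | mem x hx =>
    obtain ⟨L, hL, rfl⟩ := hx
    rw [← wd_cons, ← hL]
    exact wd_mem_dg v (i :: L)
  | zero => rw [map_zero]; exact Submodule.zero_mem _
  | add x y _ _ hx hy => rw [map_add]; exact Submodule.add_mem _ hx hy
  | smul c x _ hx => rw [map_smul]; exact Submodule.smul_mem _ c hx

theorem an_wd_mem_dg (L : List (Fin l)) (i : Fin l) :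
    L = [] ∨ an v i (wd v L) ∈ dg v (L.length - 1) := by
  induction L with
  | nil => exact Or.inl rfl
  | cons j L ih =>
    right
    rw [wd_cons, an_cr, List.length_cons, Nat.add_sub_cancel]
    refine Submodule.sub_mem _ ?_ ?_
    · split_ifs
      · exact wd_mem_dg v L
      · exact Submodule.zero_mem _
    · rcases ih with rfl | h
      · rw [wd_nil, an_one, map_zero]; exact Submodule.zero_mem _
      · rcases Nat.eq_zero_or_pos L.length with h0 | h0
        · rw [List.length_eq_zero_iff.1 h0, wd_nil, an_one, map_zero]; exact Submodule.zero_mem _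
        · have := cr_mem_dg v h j
          rwa [Nat.sub_add_cancel h0] at this

theorem Phi_dg {n : ℕ} (hn : n ≠ l) {s : S k V} (hs : s ∈ dg v n) : Phi v s = 0 := by
  induction hs using Submodule.span_induction with
  | mem x hx =>
    obtain ⟨L, hL, rfl⟩ := hx
    have hL : L.length = n := hL
    exact Phi_wd_of_length_ne v (hL ▸ hn)
  | zero => rw [map_zero]
  | add x y _ _ hx hy => rw [map_add, hx, hy, add_zero]
  | smul c x _ hx => rw [map_smul, hx, smul_zero]

/-- A derivation lowers the degree and no degree exceeds `l`, so its values have no component in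
degree `l`. -/
theorem Phi_an (i : Fin l) (s : S k V) : Phi v (an v i s) = 0 := by
  induction s using wd_induction v with
  | h0 => rw [map_zero, map_zero]
  | hadd s t hs ht => rw [map_add, map_add, hs, ht, add_zero]
  | hsmul c s hs => rw [map_smul, map_smul, hs, smul_zero]
  | hwd L hL =>
    rcases an_wd_mem_dg v L i with rfl | h
    · rw [wd_nil, an_one, map_zero]
    · refine Phi_dg v ?_ h
      have h1 : L.length ≤ l := by simpa using hL.length_le_card
      have h2 := i.pos
      omega

theorem bb_cr (i : Fin l) (s t : S k V) : bb v (cr v i s) t = -bb v s (cr v i t) := by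
  rw [bb_eq, bb_eq, br_cr, neg_mul, map_neg, mul_assoc, ← cr_apply]

/-- By induction on the word `s`, creation operators are moved across with `bb_cr` and the
anticommutation relations; the base case is that `Phi` kills the values of a derivation. -/
theorem bb_an (i : Fin l) (s t : S k V) : bb v (an v i s) t = -bb v s (an v i t) := by
  induction s using wd_induction v generalizing t with
  | h0 => rw [map_zero, bb_zero_left, bb_zero_left, neg_zero]
  | hadd s s' hs hs' => rw [map_add, bb_add_left, bb_add_left, hs, hs', neg_add]
  | hsmul c s hs => rw [map_smul, bb_smul_left, bb_smul_left, hs, mul_neg]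
  | hwd L hL =>
    clear hL
    induction L generalizing t with
    | nil => rw [wd_nil, an_one, bb_zero_left, bb_eq, br_one, one_mul, Phi_an, neg_zero]
    | cons j L ih =>
      rw [wd_cons, an_cr, bb_sub_left, bb_cr, bb_cr, ih, neg_neg, neg_neg, an_cr, bb_sub_right]
      split_ifs with h
      · abel
      · rw [bb_zero_left, bb_zero_right]; abel

theorem bb_sum_left {ι : Type*} (u : Finset ι) (f : ι → S k V) (t : S k V) :
    bb v (∑ i ∈ u, f i) t = ∑ i ∈ u, bb v (f i) t := by
  classical
  induction u using Finset.induction_on with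
  | empty => rw [Finset.sum_empty, Finset.sum_empty, bb_zero_left]
  | insert i u hi ih => rw [Finset.sum_insert hi, Finset.sum_insert hi, bb_add_left, ih]

theorem bb_sum_right {ι : Type*} (u : Finset ι) (f : ι → S k V) (t : S k V) :
    bb v t (∑ i ∈ u, f i) = ∑ i ∈ u, bb v t (f i) := by
  classical
  induction u using Finset.induction_on with
  | empty => rw [Finset.sum_empty, Finset.sum_empty, bb_zero_right]
  | insert i u hi ih => rw [Finset.sum_insert hi, Finset.sum_insert hi, bb_add_right, ih]

theorem bb_fock (x : Module.Dual k V × V) (s t : S k V) :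
    bb v (fock x s) t = -bb v s (fock x t) := by
  rw [fock_expand v]
  simp only [LinearMap.sum_apply, LinearMap.add_apply, LinearMap.smul_apply, bb_sum_left,
    bb_sum_right, bb_add_left, bb_add_right, bb_smul_left, bb_smul_right, bb_an, bb_cr,
    ← Finset.sum_neg_distrib]
  refine Finset.sum_congr rfl fun i _ => ?_
  ring

/-- Passing to the adjoint negates the Clifford operator and fixes scalars; this exchanges `gp` and
`gm` up to sign. -/
theorem bb_gp (a : W k V) (s t : S k V) : bb v (gp a s) t = -bb v s (gm a t) := by
  rw [gp_eq, gm_eq, LinearMap.add_apply, LinearMap.sub_apply, bb_add_left, bb_fock, bb_sub_right,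
    LinearMap.smul_apply, LinearMap.smul_apply, bb_smul_left, bb_smul_right, Module.End.one_apply,
    Module.End.one_apply]
  ring

theorem bb_gm (a : W k V) (s t : S k V) : bb v (gm a s) t = -bb v s (gp a t) := by
  rw [gp_eq, gm_eq, LinearMap.add_apply, LinearMap.sub_apply, bb_sub_left, bb_fock, bb_add_right,
    LinearMap.smul_apply, LinearMap.smul_apply, bb_smul_left, bb_smul_right, Module.End.one_apply,
    Module.End.one_apply]
  ring

/-- The adjoint of `gp x * gm y` is `gp y * gm x`, by `bb_gp` and `bb_gm`, so the antisymmetrised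
product is skew. -/
theorem bb_R [NeZero (2 : k)] (A : so k V) (s t : S k V) :
    bb v (R v A s) t = -bb v s (R v A t) := by
  induction A using so_induction v with
  | h0 => rw [R_zero, LinearMap.zero_apply, LinearMap.zero_apply, bb_zero_left, bb_zero_right,
      neg_zero]
  | hadd A B hA hB => rw [R_add, LinearMap.add_apply, LinearMap.add_apply, bb_add_left,
      bb_add_right, hA, hB, neg_add]
  | hsmul c A hA => rw [R_smul, LinearMap.smul_apply, LinearMap.smul_apply, bb_smul_left,
      bb_smul_right, hA, mul_neg]
  | hsg x y =>
    rw [R_sg, LinearMap.smul_apply, LinearMap.smul_apply, bb_smul_left, bb_smul_right,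
      LinearMap.sub_apply, LinearMap.sub_apply, bb_sub_left, bb_sub_right]
    simp only [Module.End.mul_apply, bb_gp, bb_gm]
    ring

/-- The sign of the form `b`. -/
def eps (k : Type*) [Field k] (l : ℕ) : k := (-1) ^ (l + 1).choose 2

/-- Reversing a word of length `n` costs `n.choose 2` transpositions and each of its letters changes
sign; the exponents add up to `(n + 1).choose 2`. -/
theorem br_wd (L : List (Fin l)) : br (wd v L) = (-1 : k) ^ (L.length + 1).choose 2 • wd v L := by
  induction L with
  | nil => rw [wd_nil, br_one]; simp
  | cons i L ih =>
    have h : (L.length + 1 + 1).choose 2 = (L.length + 1) + (L.length + 1).choose 2 := by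
      rw [Nat.choose_succ_succ' (L.length + 1) 1, Nat.choose_one_right]
    rw [wd_cons, br_cr, ih, smul_mul_assoc, wd_mul_ι, ← cr_apply, List.length_cons, h, pow_add,
      pow_succ, smul_smul, ← neg_smul]
    congr 1
    ring

theorem Phi_br (s : S k V) : Phi v (br s) = eps k l * Phi v s := by
  induction s using wd_induction v with
  | h0 => rw [map_zero, map_zero, mul_zero]
  | hadd s t hs ht => rw [map_add, map_add, map_add, hs, ht, mul_add]
  | hsmul c s hs => rw [map_smul, map_smul, map_smul, hs, smul_eq_mul, smul_eq_mul, mul_left_comm]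
  | hwd L hL =>
    rw [br_wd, map_smul, smul_eq_mul]
    by_cases h : L.length = l
    · rw [h, eps]
    · rw [Phi_wd_of_length_ne v h, mul_zero, mul_zero]

theorem bb_symm (s t : S k V) : bb v t s = eps k l * bb v s t := by
  rw [bb_eq, bb_eq, ← Phi_br, br_mul, br_br]

theorem bb_one_tp : bb v 1 (tp v) = 1 := by rw [bb_eq, br_one, one_mul, Phi_tp]

/-- The radical is stable under annihilation operators. If it were nonzero it would contain `1`,
whose pairing with the top element is `1`. -/
theorem eq_zero_of_bb {s : S k V} (hs : ∀ t, bb v s t = 0) : s = 0 := by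
  let N : Submodule k (S k V) :=
    { carrier := {s | ∀ t, bb v s t = 0}
      zero_mem' := fun t => bb_zero_left v t
      add_mem' := fun {x y} hx hy t => by rw [bb_add_left, hx t, hy t, add_zero]
      smul_mem' := fun c x hx t => by rw [bb_smul_left, hx t, mul_zero] }
  by_contra h0
  have h1 : (1 : S k V) ∈ N := one_mem_of_an v
    (fun i s hs t => by rw [bb_an, hs, neg_zero]) (N.ne_bot_iff.2 ⟨s, hs, h0⟩)
  have := h1 (tp v)
  rw [bb_one_tp] at this
  exact one_ne_zero this

end Form

/-! ### The product of odd elements: equivariance, symmetry and an explicit formula. -/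

section OddProduct

variable {l : ℕ} (v : Module.Basis (Fin l) k V)

/-- The form `½ tr(σ τ)`. -/
def ht (A B : so k V) : k := halfTrace k V A B

theorem ht_add_right (A B B' : so k V) : ht A (B + B') = ht A B + ht A B' :=
  (halfTrace k V A).map_add B B'
theorem ht_neg_right (A B : so k V) : ht A (-B) = -ht A B := (halfTrace k V A).map_neg B
theorem ht_smul_right (c : k) (A B : so k V) : ht A (c • B) = c * ht A B :=
  (halfTrace k V A).map_smul c B

theorem ht_comm (A B : so k V) : ht A B = ht B A :=
  congrArg ((1 / 2 : k) * ·) (LinearMap.trace_mul_comm k A.1 B.1)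

theorem ht_lie (A B C : so k V) : ht ⁅A, B⁆ C = ht A ⁅B, C⁆ := by
  change (1 / 2 : k) * LinearMap.trace k (W k V) ((A.1 * B.1 - B.1 * A.1) * C.1) =
    (1 / 2 : k) * LinearMap.trace k (W k V) (A.1 * (B.1 * C.1 - C.1 * B.1))
  rw [sub_mul, mul_sub, map_sub, map_sub, mul_assoc A.1, mul_assoc B.1,
    LinearMap.trace_mul_comm k B.1, mul_assoc]

variable [NeZero (2 : k)]

-- The map `A ∘ σ_{y,x}` has trace `pol y (A x) - pol x (A y)`. By skewness both terms contribute
-- equally, which cancels the factor `½`.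
include v in
theorem ht_sg (A : so k V) (x y : W k V) : ht A (sg y x) = pol y (ap A x) := by
  have : FiniteDimensional k V := Module.Finite.of_basis v
  have h2 : (2 : k) ≠ 0 := NeZero.ne _
  have e : A.1 * (sg y x).1 = ((qW k V).polarBilin y).smulRight (A.1 x) -
      ((qW k V).polarBilin x).smulRight (A.1 y) := by
    unfold sg
    ext z <;> simp [sigma]
  have ts : ∀ P Q : W k V →ₗ[k] W k V,
      LinearMap.trace k (W k V) (P - Q) = LinearMap.trace k (W k V) P - LinearMap.trace k (W k V) Q :=
    fun P Q => (LinearMap.trace k (W k V)).map_sub P Q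
  change (1 / 2 : k) * LinearMap.trace k (W k V) (A.1 * (sg y x).1) = _
  rw [e, ts, LinearMap.trace_smulRight, LinearMap.trace_smulRight, polar_comm x,
    mem_so.1 A.2 y x, sub_neg_eq_add, ← two_mul, ← mul_assoc, one_div, inv_mul_cancel₀ h2, one_mul]
  unfold pol ap
  rfl

include v in
theorem eq_zero_of_ht {A : so k V} (h : ∀ B, ht B A = 0) : A = 0 := by
  have : FiniteDimensional k V := Module.Finite.of_basis v
  exact (halfTrace_nondegenerate (k := k) (V := V)).2 A h

include v in
theorem ext_ht {A B : so k V} (h : ∀ C, ht C A = ht C B) : A = B := by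
  rw [← sub_eq_zero]
  refine eq_zero_of_ht v fun C => ?_
  rw [sub_eq_add_neg, ht_add_right, h, ht_neg_right, add_neg_cancel]

/-- The product of two odd elements. -/
def om (s t : S k V) : so k V := oddMul v s t

theorem ht_om (A : so k V) (s t : S k V) : ht A (om v s t) = bb v (R v A s) t := by
  have := halfTrace_oddMul v A s t
  unfold bb R
  exact this

theorem om_add_left (s s' t : S k V) : om v (s + s') t = om v s t + om v s' t :=
  congrFun (congrArg DFunLike.coe ((oddMul v).map_add s s')) t
theorem om_smul_left (c : k) (s t : S k V) : om v (c • s) t = c • om v s t :=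
  congrFun (congrArg DFunLike.coe ((oddMul v).map_smul c s)) t
theorem om_add_right (s t t' : S k V) : om v s (t + t') = om v s t + om v s t' :=
  (oddMul v s).map_add t t'
theorem om_smul_right (c : k) (s t : S k V) : om v s (c • t) = c • om v s t :=
  (oddMul v s).map_smul c t
theorem om_zero_left (t : S k V) : om v 0 t = 0 := by
  rw [← zero_smul k (0 : S k V), om_smul_left, zero_smul]
theorem om_zero_right (t : S k V) : om v t 0 = 0 := by
  rw [← zero_smul k (0 : S k V), om_smul_right, zero_smul]

theorem om_eq (s t : S k V) : oddMul v s t = om v s t := rfl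

attribute [irreducible] ht om

/-- Moving `A` across the invariant form gives a minus sign, and exchanging the arguments of the
form gives `eps`. -/
theorem om_symm (s t : S k V) : om v t s = -(eps k l • om v s t) := ext_ht v fun A => by
  rw [ht_om, ht_neg_right, ht_smul_right, ht_om, bb_R, bb_symm]

/-- Invariance of the trace form and of `b`, tested against an arbitrary `B`. -/
theorem lie_om (A : so k V) (s t : S k V) :
    ⁅A, om v s t⁆ = om v (R v A s) t + om v s (R v A t) := ext_ht v fun B => by
  rw [← ht_lie, ht_om, ht_add_right, ht_om, ht_om, R_lie, LinearMap.sub_apply, bb_sub_left,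
    Module.End.mul_apply, Module.End.mul_apply, bb_R v A]
  ring

theorem pol_om (s t : S k V) (x y : W k V) :
    pol y (ap (om v s t) x) = bb v (R v (sg y x) s) t := by
  rw [← ht_sg v, ht_comm, ht_om]

omit [NeZero (2 : k)] in
theorem gp_vW (i : Fin l) : gp (vW v i) = cr v i := by
  rw [gp_eq]; simp [vW, cr]
omit [NeZero (2 : k)] in
theorem gm_vW (i : Fin l) : gm (vW v i) = cr v i := by
  rw [gm_eq]; simp [vW, cr]
omit [NeZero (2 : k)] in
theorem gp_fW (i : Fin l) : gp (fW v i) = an v i := by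
  rw [gp_eq]; simp [fW, an]
omit [NeZero (2 : k)] in
theorem gm_fW (i : Fin l) : gm (fW v i) = an v i := by
  rw [gm_eq]; simp [fW, an]

theorem R_uv (i : Fin l) : R v (sg uW (vW v i)) = -cr v i := R_sg_u v _
theorem R_uf (i : Fin l) : R v (sg uW (fW v i)) = -an v i := R_sg_u v _

theorem R_vv (i j : Fin l) (s : S k V) :
    R v (sg (vW v i) (vW v j)) s = -cr v i (cr v j s) := by
  have h2 : (2 : k) ≠ 0 := NeZero.ne _
  rw [R_sg, gp_vW, gm_vW, gp_vW, gm_vW, LinearMap.smul_apply, LinearMap.sub_apply,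
    Module.End.mul_apply, Module.End.mul_apply, cr_cr v j]
  match_scalars
  field_simp
  norm_num

theorem R_ff (i j : Fin l) (s : S k V) :
    R v (sg (fW v i) (fW v j)) s = -an v i (an v j s) := by
  have h2 : (2 : k) ≠ 0 := NeZero.ne _
  rw [R_sg, gp_fW, gm_fW, gp_fW, gm_fW, LinearMap.smul_apply, LinearMap.sub_apply,
    Module.End.mul_apply, Module.End.mul_apply, an_an v j]
  match_scalars
  field_simp
  norm_num

theorem R_vf (i j : Fin l) (s : S k V) :
    R v (sg (vW v i) (fW v j)) s = -(1 / 2 : k) • (cr v i (an v j s) - an v j (cr v i s)) := by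
  rw [R_sg, gp_vW, gm_vW, gp_fW, gm_fW, LinearMap.smul_apply, LinearMap.sub_apply,
    Module.End.mul_apply, Module.End.mul_apply]

-- Bookkeeping for `om_expand`. The mixed terms occur once in each order of the indices with weight
-- `½`; replacing the double sum by the average of itself and its transpose matches them.
omit [NeZero (2 : k)] in
theorem sum_rearrange [NeZero (2 : k)] {M : Type*} [AddCommGroup M] [Module k M]
    (x y : Fin l → k) (p q r : Fin l → Fin l → k) (uf uv : Fin l → M)
    (fv ff vv vf : Fin l → Fin l → M) (hff : ∀ i j, ff i j = -ff j i)
    (hvv : ∀ i j, vv i j = -vv j i) (hfv : ∀ i j, fv i j = -vf j i) :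
    -(1 / 2 : k) • ∑ j, (y j • uv j + x j • uf j) +
      ∑ i, ((1 / 2 * x i) • -uf i + ∑ j, ((1 / 2 * r i j) • fv i j + p i j • ff i j) +
        ((1 / 2 * y i) • -uv i + ∑ j, (q i j • vv i j + (-(1 / 2) * r j i) • vf i j))) =
    -(∑ i, (x i • uf i + y i • uv i)) - ∑ i, ∑ j, (p i j • ff j i + q i j • vv j i) -
      ∑ i, ∑ j, r i j • vf j i := by
  have h2 : (2 : k) ≠ 0 := NeZero.ne _
  have hc : ∑ i, ∑ j, r i j • vf j i =
      (1 / 2 : k) • (∑ i, ∑ j, r i j • vf j i + ∑ i, ∑ j, r j i • vf i j) := by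
    rw [Finset.sum_comm (f := fun i j => r j i • vf i j), ← two_smul k, smul_smul, one_div,
      inv_mul_cancel₀ h2, one_smul]
  rw [hc]
  simp only [Finset.smul_sum, ← Finset.sum_add_distrib, ← Finset.sum_sub_distrib,
    ← Finset.sum_neg_distrib]
  refine Finset.sum_congr rfl fun i _ => ?_
  have e : ∀ p q x y z : M, p + (q + x + (y + z)) = (p + q + y) + (x + z) :=
    fun p q x y z => by abel
  have e' : ∀ p q x : M, p - q - x = p + -(q + x) := fun p q x => by abel
  rw [e, e']
  simp only [← Finset.sum_add_distrib, ← Finset.sum_neg_distrib]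
  refine congrArg₂ _ ?_ (Finset.sum_congr rfl fun j _ => ?_)
  · match_scalars <;> field_simp <;> ring
  · rw [hff i j, hvv i j, hfv]
    match_scalars <;> field_simp

/-- The product of two odd elements in terms of the bases `u, vᵢ, fᵢ`. -/
theorem om_expand (s t : S k V) : (2 : k) • om v s t =
    -(∑ i, (bb v (cr v i s) t • sg uW (fW v i) + bb v (an v i s) t • sg uW (vW v i))) -
    ∑ i, ∑ j, (bb v (cr v i (cr v j s)) t • sg (fW v j) (fW v i) +
      bb v (an v i (an v j s)) t • sg (vW v j) (vW v i)) -
    ∑ i, ∑ j, bb v (cr v i (an v j s) - an v j (cr v i s)) t • sg (vW v j) (fW v i) := by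
  have h2 : (2 : k) ≠ 0 := NeZero.ne _
  have hu : ap (om v s t) uW =
      ∑ j, (bb v (an v j s) t • vW v j + bb v (cr v j s) t • fW v j) := by
    rw [W_expand v (ap (om v s t) uW), pol_om, sg_self, R_zero, LinearMap.zero_apply,
      bb_zero_left, mul_zero, zero_smul, zero_add]
    refine Finset.sum_congr rfl fun j _ => ?_
    rw [pol_om, pol_om, sg_swap, R_neg, R_uf, sg_swap, R_neg, R_uv, neg_neg, neg_neg]
  have hv : ∀ i, ap (om v s t) (vW v i) = (1 / 2 * bb v (cr v i s) t) • uW +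
      ∑ j, ((1 / 2 * bb v (cr v i (an v j s) - an v j (cr v i s)) t) • vW v j +
        bb v (cr v i (cr v j s)) t • fW v j) := by
    intro i
    rw [W_expand v (ap (om v s t) (vW v i)), pol_om, R_uv, LinearMap.neg_apply, bb_neg_left,
      neg_mul_neg]
    refine congrArg _ (Finset.sum_congr rfl fun j _ => ?_)
    rw [pol_om, pol_om, sg_swap, R_neg, LinearMap.neg_apply, R_vf, R_vv, cr_cr v j, neg_neg,
      ← neg_smul, neg_neg, bb_smul_left]
  have hf : ∀ i, ap (om v s t) (fW v i) = (1 / 2 * bb v (an v i s) t) • uW +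
      ∑ j, (bb v (an v i (an v j s)) t • vW v j +
        (-(1 / 2) * bb v (cr v j (an v i s) - an v i (cr v j s)) t) • fW v j) := by
    intro i
    rw [W_expand v (ap (om v s t) (fW v i)), pol_om, R_uf, LinearMap.neg_apply, bb_neg_left,
      neg_mul_neg]
    refine congrArg _ (Finset.sum_congr rfl fun j _ => ?_)
    rw [pol_om, pol_om, R_vf, R_ff, an_an v j, neg_neg, bb_smul_left]
  have hL : ∀ {ι : Type} (u : Finset ι) (f : ι → W k V) (x : W k V),
      sg x (∑ i ∈ u, f i) = ∑ i ∈ u, sg x (f i) := by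
    intro ι u f x
    classical
    induction u using Finset.induction_on with
    | empty => rw [Finset.sum_empty, Finset.sum_empty, sg_zero_right]
    | insert i u hi ih => rw [Finset.sum_insert hi, Finset.sum_insert hi, sg_add_right, ih]
  rw [so_expand v (om v s t), hu]
  simp only [hv, hf, sg_add_right, hL, sg_smul_right]
  rw [← sum_rearrange _ _ _ _ _ _ _ (fun i j => sg (fW v i) (vW v j)) _ _ _
    (fun i j => sg_swap _ _) (fun i j => sg_swap _ _) (fun i j => sg_swap _ _)]
  simp only [sg_swap _ uW]

/-- The master formula for triple products: each eigenvalue below is found by inserting words here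
and seeing which of the three kinds of terms survive. -/
theorem R_om (s t r : S k V) : (2 : k) • R v (om v s t) r =
    ∑ i, (bb v (cr v i s) t • an v i r + bb v (an v i s) t • cr v i r) +
    ∑ i, ∑ j, (bb v (cr v i (cr v j s)) t • an v j (an v i r) +
      bb v (an v i (an v j s)) t • cr v j (cr v i r)) +
    (1 / 2 : k) • ∑ i, ∑ j, bb v (cr v i (an v j s) - an v j (cr v i s)) t •
      (cr v j (an v i r) - an v i (cr v j r)) := by
  rw [← LinearMap.smul_apply, ← R_smul, om_expand]
  simp only [R_sub, R_neg, R_sum, R_add, R_smul, R_uv, R_uf, LinearMap.sub_apply,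
    LinearMap.neg_apply, LinearMap.sum_apply, LinearMap.add_apply, LinearMap.smul_apply, R_vv,
    R_ff, R_vf, smul_neg, Finset.smul_sum]
  simp only [← Finset.sum_add_distrib, ← Finset.sum_sub_distrib, ← Finset.sum_neg_distrib]
  refine Finset.sum_congr rfl fun i _ => ?_
  rw [sub_eq_add_neg, sub_eq_add_neg, ← Finset.sum_neg_distrib, ← Finset.sum_neg_distrib]
  refine congrArg₂ _ (congrArg₂ _ ?_ (Finset.sum_congr rfl fun j _ => ?_))
    (Finset.sum_congr rfl fun j _ => ?_)
  · module
  · module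
  · module

/-- A trilinear map that is equivariant under the action of `so(W,q)` vanishes if it does so on the
lowest and the highest weight vector. -/
theorem eq_zero_of_equivariant (D : S k V → S k V → S k V → S k V)
    (add₁ : ∀ r r' s t, D (r + r') s t = D r s t + D r' s t)
    (smul₁ : ∀ (c : k) r s t, D (c • r) s t = c • D r s t)
    (add₃ : ∀ r s t t', D r s (t + t') = D r s t + D r s t')
    (smul₃ : ∀ (c : k) r s t, D r s (c • t) = c • D r s t)
    (equiv : ∀ A r s t, R v A (D r s t) = D (R v A r) s t + D r (R v A s) t + D r s (R v A t))
    (h : ∀ s, D 1 s (tp v) = 0) (r s t : S k V) : D r s t = 0 := by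
  have zero₁ : ∀ s t, D 0 s t = 0 := fun s t => by
    have := smul₁ 0 0 s t
    rwa [zero_smul, zero_smul] at this
  have zero₃ : ∀ r s, D r s 0 = 0 := fun s t => by
    have := smul₃ 0 s t 0
    rwa [zero_smul, zero_smul] at this
  let N₃ : Submodule k (S k V) :=
    { carrier := {t | ∀ s, D 1 s t = 0}
      zero_mem' := fun s => zero₃ 1 s
      add_mem' := fun {x y} hx hy s => by rw [add₃, hx, hy, add_zero]
      smul_mem' := fun c x hx s => by rw [smul₃, hx, smul_zero] }
  let N₁ : Submodule k (S k V) :=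
    { carrier := {r | ∀ s t, D r s t = 0}
      zero_mem' := fun s t => zero₁ s t
      add_mem' := fun {x y} hx hy s t => by rw [add₁, hx, hy, add_zero]
      smul_mem' := fun c x hx s t => by rw [smul₁, hx, smul_zero] }
  -- The operator `an v i` kills `1`, and the vanishing is assumed for every `s`. Applying it to `D
  -- 1 s t = 0` thus leaves only the term with `an v i t`.
  have e₃ : N₃ = ⊤ := by
    refine eq_top_of_an v h fun i t ht s => ?_
    have := equiv (-sg uW (fW v i)) 1 s t
    rw [ht, R_neg, R_uf, neg_neg, map_zero, an_one, zero₁, ht, zero_add, zero_add] at this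
    exact this.symm
  -- Now the last two arguments are arbitrary, so applying `cr v i` leaves only the term in which it
  -- hits the first one.
  have e₁ : N₁ = ⊤ := by
    refine eq_top_of_cr v (fun s t => ?_) fun i r hr s t => ?_
    · have : t ∈ N₃ := e₃ ▸ Submodule.mem_top
      exact this s
    · have := equiv (-sg uW (vW v i)) r s t
      rw [hr, R_neg, R_uv, neg_neg, map_zero, hr, hr, add_zero, add_zero] at this
      exact this.symm
  have : r ∈ N₁ := e₁ ▸ Submodule.mem_top
  exact this s t

end OddProduct

/-! ### The odd Jacobi identity as a list of eigenvalues. -/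

section Jacobi

variable {l : ℕ} (v : Module.Basis (Fin l) k V)

theorem sum_ite_notMem {L : List (Fin l)} (hL : L.Nodup) (s : S k V) :
    ∑ i, (if i ∈ L then 0 else s) = ((l : k) - L.length) • s := by
  have h : ∀ i : Fin l, (if i ∈ L then (0 : S k V) else s) = s - if i ∈ L.toFinset then s else 0 :=
    fun i => by simp only [List.mem_toFinset]; split_ifs <;> simp
  rw [Finset.sum_congr rfl fun i _ => h i, Finset.sum_sub_distrib, Finset.sum_ite_mem,
    Finset.univ_inter, Finset.sum_const, Finset.sum_const, Finset.card_univ, Fintype.card_fin,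
    List.toFinset_card_of_nodup hL, ← Nat.cast_smul_eq_nsmul k, ← Nat.cast_smul_eq_nsmul k,
    sub_smul]

theorem an_cr_wd_ite (i : Fin l) (L : List (Fin l)) :
    an v i (cr v i (wd v L)) = if i ∈ L then 0 else wd v L := by
  split_ifs with h
  · rw [cr_wd_mem v h, map_zero]
  · rw [an_cr_wd v h]

theorem Phi_smul_tp (L : List (Fin l)) :
    Phi v (wd v L) • tp v = if L.length = l then wd v L else 0 := by
  split_ifs with h
  · exact (wd_eq_smul_tp v h).symm
  · rw [Phi_wd_of_length_ne v h, zero_smul]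

theorem cr_tp (i : Fin l) : cr v i (tp v) = 0 := cr_wd_mem v (List.mem_finRange i)

theorem bb_one (s : S k V) : bb v 1 s = Phi v s := by rw [bb_eq, br_one, one_mul]

theorem bb_tp (s : S k V) : bb v (tp v) s = eps k l * cst s := by
  rw [bb_eq, tp, br_wd, List.length_finRange, smul_mul_assoc, map_smul]
  change _ * Phi v (tp v * s) = _
  rw [tp_mul, map_smul, Phi_tp, smul_eq_mul, mul_one, eps]

theorem eps_mul_self : eps k l * eps k l = 1 := by
  rw [eps, ← mul_pow, neg_one_mul, neg_neg, one_pow]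

/-- Twice the eigenvalue of `[1, w]` on the top element, in terms of the codegree of `w`. -/
def gg (k : Type*) [Field k] (l n : ℕ) : k :=
  if n = 0 then (l : k) / 2 else if n = 1 then 1 else if n = 2 then 2 else 0

variable [NeZero (2 : k)]

/-- Creation operators kill the top element and annihilation operators kill `1`, so each sum of
`R_om` sees one codegree of the word. Codegree one has a single missing letter and gives `1`;
codegree two has two ordered pairs of missing letters and gives `2`; codegree zero gives half of `l`
diagonal terms. -/
theorem R_om_one_wd {L : List (Fin l)} (hL : L.Nodup) :
    (2 : k) • R v (om v 1 (wd v L)) (tp v) = -(gg k l (l - L.length) • wd v L) := by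
  have hl : L.length ≤ l := by simpa using hL.length_le_card
  rw [R_om]
  -- The scalar `Phi` of a word times the top element is the word itself in full length.
  -- Annihilating `i` from `i :: L` then returns `wd v L`, with no sign to determine.
  have t1 : ∀ i, bb v (cr v i 1) (wd v L) • an v i (tp v) +
      bb v (an v i 1) (wd v L) • cr v i (tp v) =
      if L.length + 1 = l then -(if i ∈ L then 0 else wd v L) else 0 := fun i => by
    rw [cr_tp, smul_zero, add_zero, bb_cr, bb_one, neg_smul, ← map_smul, ← wd_cons, Phi_smul_tp,
      List.length_cons]
    split_ifs with h1 h2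
    · rw [wd_cons, an_cr_wd_ite, if_pos h2]
    · rw [wd_cons, an_cr_wd_ite, if_neg h2]
    · rw [map_zero, neg_zero]
  have t2 : ∀ i j, bb v (cr v i (cr v j 1)) (wd v L) • an v j (an v i (tp v)) +
      bb v (an v i (an v j 1)) (wd v L) • cr v j (cr v i (tp v)) =
      if L.length + 2 = l then
        -(if i ∈ L then 0 else if j ∈ i :: L then 0 else wd v L) else 0 := fun i j => by
    rw [cr_tp, map_zero, smul_zero, add_zero, bb_cr, bb_cr, neg_neg, bb_one, ← map_smul,
      ← map_smul, ← wd_cons, ← wd_cons, Phi_smul_tp, List.length_cons, List.length_cons]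
    split_ifs with h1 h2 h3
    · have hz : wd v (i :: L) = 0 := by rw [wd_cons, cr_wd_mem v h2]
      rw [wd_cons v j, hz, map_zero, map_zero, map_zero, neg_zero]
    · have hz : wd v (j :: i :: L) = 0 := by rw [wd_cons, cr_wd_mem v h3]
      rw [hz, map_zero, map_zero, neg_zero]
    · rw [an_an, wd_cons, an_cr_wd v h3, wd_cons, an_cr_wd v h2]
    · rw [map_zero, map_zero]
  have t3 : ∀ i j, bb v (cr v i (an v j 1) - an v j (cr v i 1)) (wd v L) •
      (cr v j (an v i (tp v)) - an v i (cr v j (tp v))) =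
      if i = j then -(if L.length = l then wd v L else 0) else 0 := fun i j => by
    rw [cr_tp, map_zero, sub_zero, an_one, map_zero, zero_sub, an_cr, an_one, map_zero, sub_zero]
    rcases eq_or_ne i j with rfl | h1
    · rw [if_pos rfl, if_pos rfl, bb_neg_left, bb_one, neg_smul, tp,
        cr_an_wd v (List.mem_finRange i)]
      change -(_ • tp v) = _
      rw [Phi_smul_tp]
    · rw [if_neg h1.symm, if_neg h1, neg_zero, bb_zero_left, zero_smul]
  simp only [t1, t2, t3]
  simp only [Finset.sum_ite_eq, Finset.mem_univ, if_true, Finset.sum_const, Finset.card_univ,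
    Fintype.card_fin]
  rcases Nat.lt_or_ge (L.length + 2) l with h | h
  · have g0 : gg k l (l - L.length) = 0 := by
      unfold gg
      rw [if_neg (by omega), if_neg (by omega), if_neg (by omega)]
    rw [g0]
    simp only [show ¬(L.length + 1 = l) by omega, show ¬(L.length + 2 = l) by omega,
      show ¬(L.length = l) by omega, if_false, Finset.sum_const_zero]
    simp
  · obtain h | h | h : L.length + 2 = l ∨ L.length + 1 = l ∨ L.length = l := by omega
    · have g0 : gg k l (l - L.length) = 2 := by
        unfold gg
        rw [if_neg (by omega), if_neg (by omega), if_pos (by omega)]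
      have hc : (l : k) = L.length + 2 := by exact_mod_cast congrArg (Nat.cast (R := k)) h.symm
      rw [g0]
      simp only [show ¬(L.length + 1 = l) by omega, h,
        show ¬(L.length = l) by omega, if_false, if_true, Finset.sum_const_zero]
      have e : ∀ i, ∑ j, -(if i ∈ L then 0 else if j ∈ i :: L then 0 else wd v L) =
          -(if i ∈ L then 0 else wd v L) := fun i => by
        rw [Finset.sum_neg_distrib]
        split_ifs with hi
        · rw [Finset.sum_const_zero]
        · rw [sum_ite_notMem (List.nodup_cons.2 ⟨hi, hL⟩), List.length_cons]
          rw [show (l : k) - ((L.length + 1 : ℕ) : k) = 1 by push_cast; linear_combination hc, one_smul]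
      simp only [e]
      rw [Finset.sum_neg_distrib, sum_ite_notMem hL,
        show (l : k) - (L.length : k) = 2 by linear_combination hc]
      simp
    · have g0 : gg k l (l - L.length) = 1 := by
        unfold gg
        rw [if_neg (by omega), if_pos (by omega)]
      have hc : (l : k) = L.length + 1 := by exact_mod_cast congrArg (Nat.cast (R := k)) h.symm
      rw [g0]
      simp only [show ¬(L.length + 2 = l) by omega, h,
        show ¬(L.length = l) by omega, if_false, if_true, Finset.sum_const_zero]
      rw [Finset.sum_neg_distrib, sum_ite_notMem hL,
        show (l : k) - (L.length : k) = 1 by linear_combination hc]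
      simp
    · have g0 : gg k l (l - L.length) = l / 2 := by
        unfold gg
        rw [if_pos (by omega)]
      rw [g0]
      simp only [show ¬(L.length + 2 = l) by omega, show ¬(L.length + 1 = l) by omega,
        if_false, Finset.sum_const_zero]
      simp only [h, if_true]
      rw [← Nat.cast_smul_eq_nsmul k]
      module

/-- The mirror image of `R_om_one_wd`: pairing with the top element reads off constant terms, so now
the degree of the word counts instead of its codegree, and `bb_tp` contributes `eps`. -/
theorem R_om_tp_wd {L : List (Fin l)} (hL : L.Nodup) :
    (2 : k) • R v (om v (tp v) (wd v L)) 1 = -((eps k l * gg k l L.length) • wd v L) := by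
  rw [R_om]
  have t1 : ∀ i, bb v (cr v i (tp v)) (wd v L) • an v i 1 + bb v (an v i (tp v)) (wd v L) • cr v i 1 =
      -(eps k l) • cst (an v i (wd v L)) • cr v i 1 := fun i => by
    rw [cr_tp, bb_zero_left, zero_smul, zero_add, bb_an, bb_tp, ← neg_mul, mul_smul]
  have t2 : ∀ i j, bb v (cr v i (cr v j (tp v))) (wd v L) • an v j (an v i 1) +
      bb v (an v i (an v j (tp v))) (wd v L) • cr v j (cr v i 1) =
      eps k l • cst (an v j (an v i (wd v L))) • cr v j (cr v i 1) := fun i j => by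
    rw [cr_tp, map_zero, bb_zero_left, zero_smul, zero_add, bb_an, bb_an, neg_neg, bb_tp, mul_smul]
  have t3 : ∀ i j, bb v (cr v i (an v j (tp v)) - an v j (cr v i (tp v))) (wd v L) •
      (cr v j (an v i 1) - an v i (cr v j 1)) =
      if i = j then -(eps k l) • cst (wd v L) • 1 else 0 := fun i j => by
    have := an_cr v j i (tp v)
    rw [cr_tp, map_zero, eq_comm, sub_eq_zero] at this
    rw [cr_tp, map_zero, sub_zero, ← this, an_one, map_zero, zero_sub, an_cr, an_one, map_zero,
      sub_zero]
    rcases eq_or_ne i j with rfl | h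
    · rw [if_pos rfl, if_pos rfl, if_pos rfl, bb_tp, mul_smul]; module
    · rw [if_neg (Ne.symm h), if_neg h, if_neg h, bb_zero_left, zero_smul]
  simp only [t1, t2, t3]
  simp only [Finset.sum_ite_eq, Finset.mem_univ, if_true, Finset.sum_const, Finset.card_univ,
    Fintype.card_fin, ← Finset.smul_sum]
  -- At most two annihilations are applied before the constant term is taken, so words of length
  -- three or more contribute nothing.
  match L, hL with
  | [], _ =>
    simp only [wd_nil, an_one, map_zero, zero_smul, Finset.sum_const_zero, cst_one, List.length_nil,
      gg, if_true]
    rw [← Nat.cast_smul_eq_nsmul k]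
    module
  | [a], _ =>
    have e : ∀ i, cst (an v i (wd v [a])) • cr v i 1 = if i = a then cr v a 1 else 0 := fun i => by
      rw [wd_cons, wd_nil, an_cr, an_one, map_zero, sub_zero]
      split_ifs with h
      · rw [cst_one, one_smul, h]
      · rw [map_zero, zero_smul]
    have e2 : ∀ i j, cst (an v j (an v i (wd v [a]))) = 0 := fun i j => by
      rw [wd_cons, wd_nil, an_cr, an_one, map_zero, sub_zero]
      split_ifs <;> simp [an_one]
    simp only [e, e2, zero_smul, Finset.sum_const_zero, Finset.sum_ite_eq', Finset.mem_univ, if_true]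
    simp only [List.length_singleton, gg, wd_cons, wd_nil, cst_cr]
    simp
  | [a, c], _ =>
    have e : ∀ i, cst (an v i (wd v [a, c])) = 0 := fun i => by
      rw [wd_cons, wd_cons, wd_nil, an_cr, map_sub, cst_cr, sub_zero]
      split_ifs <;> simp [cst_cr]
    have e2 : ∀ i j, cst (an v j (an v i (wd v [a, c]))) • cr v j (cr v i 1) =
        (if i = a then if j = c then cr v c (cr v a 1) else 0 else 0) -
          if i = c then if j = a then cr v a (cr v c 1) else 0 else 0 := fun i j => by
      rw [wd_cons, wd_cons, wd_nil, an_cr, an_cr, an_one, map_zero, sub_zero, map_sub, map_sub,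
        sub_smul]
      refine congrArg₂ _ ?_ ?_
      · split_ifs with h1 h2
        · rw [an_cr, if_pos h2, an_one, map_zero, sub_zero, cst_one, one_smul, h1, h2]
        · rw [an_cr, if_neg h2, an_one, map_zero, sub_zero, map_zero, zero_smul]
        · rw [map_zero, map_zero, zero_smul]
      · split_ifs with h1 h2
        · rw [an_cr, if_pos h2, an_one, map_zero, sub_zero, cst_one, one_smul, h1, h2]
        · rw [an_cr, if_neg h2, an_one, map_zero, sub_zero, map_zero, zero_smul]
        · rw [map_zero, map_zero, map_zero, zero_smul]
    simp only [e, e2, zero_smul, Finset.sum_const_zero, Finset.sum_sub_distrib, Finset.sum_ite_eq',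
      Finset.mem_univ, if_true, Finset.sum_ite_irrel]
    simp only [List.length_cons, List.length_nil, gg, wd_cons, wd_nil, cst_cr]
    rw [cr_cr v c a]
    simp only [smul_zero, zero_add]
    norm_num
    module
  | a :: c :: d :: L, _ =>
    have e : ∀ i, cst (an v i (wd v (a :: c :: d :: L))) = 0 := fun i => by
      rw [wd_cons, wd_cons, an_cr, map_sub, cst_cr, sub_zero]
      split_ifs <;> simp [cst_cr]
    have e2 : ∀ i j, cst (an v j (an v i (wd v (a :: c :: d :: L)))) = 0 := fun i j => by
      have h3 : ∀ i x, cst (an v i (cr v c (cr v d x))) = 0 := fun i x => by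
        rw [an_cr v i c, map_sub, cst_cr, sub_zero]
        split_ifs <;> simp [cst_cr]
      rw [wd_cons, wd_cons, wd_cons, an_cr v i a, map_sub, an_cr v j a, map_sub, map_sub, cst_cr,
        sub_zero]
      split_ifs <;> simp [h3]
    simp only [e, e2, zero_smul, Finset.sum_const_zero, gg, List.length_cons]
    rw [wd_cons, cst_cr]
    simp

/-- Only the diagonal of the third sum of `R_om` survives. It counts absent letters positively and
present letters negatively. -/
theorem R_om_one_tp {L : List (Fin l)} (hL : L.Nodup) :
    (2 : k) • R v (om v 1 (tp v)) (wd v L) = (((l : k) - 2 * L.length) / 2) • wd v L := by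
  have h2 : (2 : k) ≠ 0 := NeZero.ne _
  rw [R_om]
  have t1 : ∀ i, bb v (cr v i 1) (tp v) • an v i (wd v L) +
      bb v (an v i 1) (tp v) • cr v i (wd v L) = 0 := fun i => by
    rw [bb_cr, cr_tp, bb_zero_right, neg_zero, an_one, bb_zero_left, zero_smul, zero_smul, add_zero]
  have t2 : ∀ i j, bb v (cr v i (cr v j 1)) (tp v) • an v j (an v i (wd v L)) +
      bb v (an v i (an v j 1)) (tp v) • cr v j (cr v i (wd v L)) = 0 := fun i j => by
    rw [bb_cr, cr_tp, bb_zero_right, neg_zero, an_one, map_zero, bb_zero_left, zero_smul, zero_smul,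
      add_zero]
  have t3 : ∀ i j, bb v (cr v i (an v j 1) - an v j (cr v i 1)) (tp v) •
      (cr v j (an v i (wd v L)) - an v i (cr v j (wd v L))) =
      if i = j then (2 : k) • (if i ∈ L then 0 else wd v L) - wd v L else 0 := fun i j => by
    rw [an_one, map_zero, zero_sub, an_cr, an_one, map_zero, sub_zero]
    rcases eq_or_ne i j with rfl | h
    · rw [if_pos rfl, if_pos rfl, bb_neg_left, bb_one_tp, an_cr_wd_ite]
      split_ifs with h
      · rw [cr_an_wd v h]; module
      · rw [an_wd_notMem v h, map_zero]; module
    · rw [if_neg (Ne.symm h), if_neg h, neg_zero, bb_zero_left, zero_smul]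
  simp only [t1, t2, t3]
  simp only [Finset.sum_ite_eq, Finset.mem_univ, if_true, Finset.sum_const_zero,
    Finset.sum_sub_distrib, ← Finset.smul_sum, sum_ite_notMem hL, Finset.sum_const,
    Finset.card_univ, Fintype.card_fin]
  rw [← Nat.cast_smul_eq_nsmul k]
  match_scalars
  field_simp
  ring

/-- The cyclic sum of the odd triple products. -/
def jac (r s t : S k V) : S k V :=
  R v (om v r s) t + R v (om v s t) r + R v (om v t r) s

/-- Twice the eigenvalue of `s ↦ jac 1 s tp`. -/
def cf (k : Type*) [Field k] (l m : ℕ) : k :=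
  gg k l m - gg k l (l - m) - eps k l * (((l : k) - 2 * m) / 2)

/-- The word is an eigenvector for each of the three cyclic terms. `om_symm` brings two of them to
the form computed above, and `eps` squares to `1`. -/
theorem jac_one_wd_tp {L : List (Fin l)} (hL : L.Nodup) :
    (2 : k) • jac v 1 (wd v L) (tp v) = cf k l L.length • wd v L := by
  rw [jac, smul_add, smul_add, R_om_one_wd v hL, om_symm v (tp v) (wd v L), om_symm v 1 (tp v),
    R_neg, R_neg, R_smul, R_smul, LinearMap.neg_apply, LinearMap.neg_apply, LinearMap.smul_apply,
    LinearMap.smul_apply, smul_neg, smul_neg, smul_comm (2 : k), smul_comm (2 : k),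
    R_om_tp_wd v hL, R_om_one_tp v hL, cf]
  have := eps_mul_self (k := k) (l := l)
  rw [smul_neg, smul_smul, ← mul_assoc, this]
  module

theorem R_jac (A : so k V) (r s t : S k V) : R v A (jac v r s t) =
    jac v (R v A r) s t + jac v r (R v A s) t + jac v r s (R v A t) := by
  have h : ∀ r s t, R v A (R v (om v r s) t) =
      R v (om v (R v A r) s) t + R v (om v r (R v A s)) t + R v (om v r s) (R v A t) := by
    intro r s t
    have := LinearMap.congr_fun (R_lie v A (om v r s)) t
    rw [lie_om, R_add, LinearMap.add_apply, LinearMap.sub_apply, Module.End.mul_apply,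
      Module.End.mul_apply] at this
    rw [this, sub_add_cancel]
  simp only [jac, map_add, h]
  abel

/-- Equivariance reduces the identity to the triples `(1, w, tp v)`. Since every length `m ≤ l` is
attained by a nonzero word, none of the scalars `cf k l m` can be dropped. -/
theorem jac_eq_zero_iff : (∀ r s t, jac v r s t = 0) ↔ ∀ m ≤ l, cf k l m = 0 := by
  have h2 : (2 : k) ≠ 0 := NeZero.ne _
  constructor
  · intro h m hm
    have hL : ((List.finRange l).take m).Nodup := (List.nodup_finRange l).take
    have := jac_one_wd_tp v hL
    rw [h, smul_zero, List.length_take, List.length_finRange, min_eq_left hm] at this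
    refine (smul_eq_zero.1 this.symm).resolve_right fun h0 => ?_
    -- The word of the first `m` letters is nonzero because it is a left factor of the top element.
    have e : wd v ((List.finRange l).take m) * wd v ((List.finRange l).drop m) = tp v := by
      rw [tp, wd, wd, wd, ← List.prod_append, ← List.map_append, List.take_append_drop]
    rw [h0, zero_mul] at e
    have := Phi_tp v
    rw [← e, map_zero] at this
    exact zero_ne_one this
  · intro h
    refine eq_zero_of_equivariant v (jac v) ?_ ?_ ?_ ?_ (R_jac v) fun s => ?_
    · intro r r' s t
      simp only [jac, om_add_left, om_add_right, R_add, LinearMap.add_apply, map_add]; abel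
    · intro c r s t
      simp only [jac, om_smul_left, om_smul_right, R_smul, LinearMap.smul_apply, map_smul, smul_add]
    · intro r s t t'
      simp only [jac, om_add_left, om_add_right, R_add, LinearMap.add_apply, map_add]; abel
    · intro c r s t
      simp only [jac, om_smul_left, om_smul_right, R_smul, LinearMap.smul_apply, map_smul, smul_add]
    · have z : jac v 1 0 (tp v) = 0 := by
        simp only [jac, om_zero_left, om_zero_right, R_zero, LinearMap.zero_apply, map_zero, add_zero]
      induction s using wd_induction v with
      | h0 => exact z
      | hadd s t hs ht =>
        have : jac v 1 (s + t) (tp v) = jac v 1 s (tp v) + jac v 1 t (tp v) := by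
          simp only [jac, om_add_left, om_add_right, R_add, LinearMap.add_apply, map_add]; abel
        rw [this, hs, ht, add_zero]
      | hsmul c s hs =>
        have : jac v 1 (c • s) (tp v) = c • jac v 1 s (tp v) := by
          simp only [jac, om_smul_left, om_smul_right, R_smul, LinearMap.smul_apply, map_smul,
            smul_add]
        rw [this, hs, smul_zero]
      | hwd L hL =>
        have := jac_one_wd_tp v hL
        rw [h L.length (by simpa using hL.length_le_card), zero_smul] at this
        exact (smul_eq_zero.1 this).resolve_left h2

end Jacobi

/-! ### Lie algebra and superalgebra axioms for a sum of an algebra and a module. -/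

section SemidirectProduct

variable {L M : Type*} [LieRing L] [LieAlgebra k L] [AddCommGroup M] [Module k M]
  {μ : (L × M) →ₗ[k] (L × M) →ₗ[k] (L × M)} {ρ : L →ₗ[k] Module.End k M} {o : M →ₗ[k] M →ₗ[k] L}

/-- With even arguments the Jacobi identity is that of `L`, the representation property or the
equivariance of `o`. Only three odd arguments give a new condition. -/
theorem isLieProduct_of_jacobi [NeZero (2 : k)]
    (hμ : ∀ x y, μ x y = (⁅x.1, y.1⁆ + o x.2 y.2, ρ x.1 y.2 - ρ y.1 x.2))
    (hρ : ∀ A B s, ρ ⁅A, B⁆ s = ρ A (ρ B s) - ρ B (ρ A s))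
    (ho : ∀ A s t, ⁅A, o s t⁆ = o (ρ A s) t + o s (ρ A t)) (anti : ∀ s t, o s t = -o t s)
    (hj : ∀ r s t, ρ (o r s) t + ρ (o s t) r + ρ (o t r) s = 0) : IsLieProduct μ := by
  have h2 : (2 : k) ≠ 0 := NeZero.ne _
  refine ⟨fun x => ?_, ?_⟩
  · rw [hμ, sub_self, lie_self]
    have : o x.2 x.2 = 0 := by
      have := anti x.2 x.2
      rw [eq_neg_iff_add_eq_zero, ← two_smul k, smul_eq_zero] at this
      exact this.resolve_left h2
    rw [this, add_zero, Prod.mk_zero_zero]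
  · rintro ⟨A, r⟩ ⟨B, s⟩ ⟨C, t⟩
    have ol : ∀ (C : L) r s, ⁅o r s, C⁆ = o (ρ C s) r - o (ρ C r) s := fun C r s => by
      rw [← lie_skew, ho, anti r]; abel
    have lj : ⁅⁅A, B⁆, C⁆ + ⁅⁅B, C⁆, A⁆ + ⁅⁅C, A⁆, B⁆ = 0 := by
      rw [← neg_eq_zero, neg_add, neg_add, lie_skew C, lie_skew A, lie_skew B, ← lie_jacobi A B C]
      abel
    refine Prod.ext ?_ ?_
    · simp only [hμ, Prod.fst_add, add_lie, ol, map_sub, LinearMap.sub_apply, Prod.fst_zero]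
      rw [← lj]
      abel
    · simp only [hμ, Prod.snd_add, Prod.snd_zero, map_add, hρ, LinearMap.add_apply, map_sub]
      rw [← hj r s t]
      abel

theorem isLieSuperProduct_of_jacobi {𝒢 : ZMod 2 → Submodule k (L × M)}
    (h𝒢0 : ∀ x, x ∈ 𝒢 0 ↔ x.2 = 0) (h𝒢1 : ∀ x, x ∈ 𝒢 1 ↔ x.1 = 0)
    (hμ : ∀ x y, μ x y = (⁅x.1, y.1⁆ + o x.2 y.2, ρ x.1 y.2 - ρ y.1 x.2))
    (hρ : ∀ A B s, ρ ⁅A, B⁆ s = ρ A (ρ B s) - ρ B (ρ A s))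
    (ho : ∀ A s t, ⁅A, o s t⁆ = o (ρ A s) t + o s (ρ A t)) (symm : ∀ s t, o s t = o t s)
    (hj : ∀ r s t, ρ (o r s) t + ρ (o s t) r + ρ (o t r) s = 0) : IsLieSuperProduct 𝒢 μ := by
  have v0 : ∀ i : ZMod 2, (0 : ZMod 2).val * i.val = 0 := by decide
  have v0' : ∀ i : ZMod 2, i.val * (0 : ZMod 2).val = 0 := by decide
  have v1 : (1 : ZMod 2).val * (1 : ZMod 2).val = 1 := by decide
  have cases2 : ∀ i : ZMod 2, i = 0 ∨ i = 1 := by decide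
  have z00 : (0 : ZMod 2) + 0 = 0 := by decide
  have z01 : (0 : ZMod 2) + 1 = 1 := by decide
  have z10 : (1 : ZMod 2) + 0 = 1 := by decide
  have z11 : (1 : ZMod 2) + 1 = 0 := by decide
  refine ⟨?_, ?_, ?_, ?_⟩
  · rw [DirectSum.isInternal_submodule_iff_isCompl _ (i := 0) (j := 1) (by decide)]
    · refine ⟨Submodule.disjoint_def.2 fun x h0 h1 => ?_,
        Submodule.codisjoint_iff_exists_add_eq.2 ?_⟩
      · exact Prod.ext ((h𝒢1 _).1 h1) ((h𝒢0 _).1 h0)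
      · rintro ⟨A, s⟩
        exact ⟨(A, 0), (0, s), (h𝒢0 _).2 rfl, (h𝒢1 _).2 rfl, Prod.ext (add_zero A) (zero_add s)⟩
    · ext i
      simpa using cases2 i
  · rintro i j ⟨A, r⟩ hx ⟨B, s⟩ hy
    rw [hμ]
    obtain rfl | rfl := cases2 i <;> obtain rfl | rfl := cases2 j <;>
      simp only [z00, z01, z10, z11, h𝒢0, h𝒢1] at hx hy ⊢ <;> subst hx hy <;> simp
  · rintro i j ⟨A, r⟩ hx ⟨B, s⟩ hy
    rw [hμ, hμ]
    obtain rfl | rfl := cases2 i <;> obtain rfl | rfl := cases2 j <;>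
      simp only [h𝒢0, h𝒢1] at hx hy ⊢ <;> subst hx hy <;> simp [v0, v1]
    exact symm r s
  · rintro i j ⟨A, r⟩ hx ⟨B, s⟩ hy ⟨C, t⟩
    have sl : ∀ (C : L) r s, ⁅o r s, C⁆ = -(o (ρ C r) s + o r (ρ C s)) := fun C r s => by
      rw [← lie_skew, ho]
    obtain rfl | rfl := cases2 i <;> obtain rfl | rfl := cases2 j <;>
      simp only [h𝒢0, h𝒢1] at hx hy ⊢ <;> subst hx hy <;>
      refine Prod.ext ?_ ?_ <;>
      simp only [hμ, v0, v0', v1, pow_zero, pow_one, one_smul, neg_one_smul, map_zero,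
        map_neg, LinearMap.zero_apply, zero_lie, lie_zero, add_zero, zero_add, sub_zero,
        zero_sub, Prod.fst_add, Prod.snd_add, Prod.fst_neg, Prod.snd_neg, hρ, ho, sl, lie_lie,
        LinearMap.neg_apply, neg_zero]
    -- Two odd first arguments remain: the even component needs the symmetry of `o`, the odd
    -- component the cyclic identity.
    any_goals abel1
    · rw [symm s (ρ C r)]; abel
    · have := hj r s t
      rw [symm t r, add_right_comm, add_eq_zero_iff_neg_eq] at this
      rw [← this, neg_neg, neg_neg]

theorem IsLieProduct.odd
    (hμ : ∀ x y, μ x y = (⁅x.1, y.1⁆ + o x.2 y.2, ρ x.1 y.2 - ρ y.1 x.2)) (h : IsLieProduct μ) :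
    (∀ s, o s s = 0) ∧ ∀ r s t, ρ (o r s) t + ρ (o s t) r + ρ (o t r) s = 0 := by
  constructor
  · intro s
    simpa [hμ] using h.self_eq_zero (0, s)
  · intro r s t
    simpa [hμ] using h.jacobi (0, r) (0, s) (0, t)

theorem IsLieSuperProduct.odd {𝒢 : ZMod 2 → Submodule k (L × M)}
    (h𝒢1 : ∀ x, x ∈ 𝒢 1 ↔ x.1 = 0)
    (hμ : ∀ x y, μ x y = (⁅x.1, y.1⁆ + o x.2 y.2, ρ x.1 y.2 - ρ y.1 x.2))
    (h : IsLieSuperProduct 𝒢 μ) :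
    (∀ s t, o s t = o t s) ∧ ∀ r s t, ρ (o r s) t + ρ (o s t) r + ρ (o t r) s = 0 := by
  have mem1 : ∀ s : M, ((0 : L), s) ∈ 𝒢 1 := fun s => (h𝒢1 _).2 rfl
  have v1 : (1 : ZMod 2).val * (1 : ZMod 2).val = 1 := by decide
  have symm : ∀ s t, o s t = o t s := fun s t => by
    simpa [hμ, v1] using h.skew 1 1 _ (mem1 s) _ (mem1 t)
  refine ⟨symm, fun r s t => ?_⟩
  have := congrArg Prod.snd (h.jacobi 1 1 _ (mem1 r) _ (mem1 s) (0, t))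
  simp only [hμ, v1, pow_one, neg_one_smul, Prod.snd_add, Prod.snd_neg, lie_zero, zero_add,
    map_zero, LinearMap.zero_apply, sub_zero, zero_sub, neg_neg] at this
  rw [symm t r, add_right_comm, ← this, neg_add_cancel]

end SemidirectProduct

/-! ### When the product is of Lie or of super type; the cube of an odd element. -/

section Product

theorem charP_iff {p : ℕ} (hp : p.Prime) : CharP k p ↔ (p : k) = 0 := by
  refine ⟨fun _ => CharP.cast_eq_zero k p, fun h => ?_⟩
  obtain ⟨q, hq⟩ := CharP.exists k
  rcases (Nat.dvd_prime hp).1 ((CharP.cast_eq_zero_iff k q p).1 h) with rfl | rfl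
  · exact absurd rfl (CharP.char_ne_one k 1)
  · exact hq

variable {l : ℕ}

/-- For `l ≥ 7` the lengths `3` and `4`, and their colengths, are outside the range where `gg` is
nonzero; so `l - 6` and `l - 8` both vanish, which contradicts `2 ≠ 0`. For smaller `l` one scalar
already forces the characteristic. -/
theorem cf_eq_zero_iff [NeZero (2 : k)] (hl : 1 ≤ l) : (∀ m ≤ l, cf k l m = 0) ↔
    l = 1 ∨ l = 2 ∨ (l = 3 ∧ CharP k 3) ∨ l = 4 ∨ (l = 5 ∧ CharP k 5) ∨ (l = 6 ∧ CharP k 3) := by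
  have h2 : (2 : k) ≠ 0 := NeZero.ne _
  rw [charP_iff (k := k) Nat.prime_three, charP_iff (k := k) Nat.prime_five]
  constructor
  · intro h
    obtain rfl | rfl | rfl | rfl | rfl | rfl | h7 :
      l = 1 ∨ l = 2 ∨ l = 3 ∨ l = 4 ∨ l = 5 ∨ l = 6 ∨ 7 ≤ l := by omega
    · exact Or.inl rfl
    · exact Or.inr (Or.inl rfl)
    -- Here `cf` equals `3/2`.
    · have := h 2 (by omega)
      simp only [cf, gg, eps] at this
      norm_num [Nat.choose] at this
      refine Or.inr (Or.inr (Or.inl ⟨rfl, ?_⟩))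
      try field_simp at this
      push_cast
      linear_combination this
    · exact Or.inr (Or.inr (Or.inr (Or.inl rfl)))
    -- Here `cf` equals `5`.
    · have := h 0 (by omega)
      simp only [cf, gg, eps] at this
      norm_num [Nat.choose] at this
      refine Or.inr (Or.inr (Or.inr (Or.inr (Or.inl ⟨rfl, ?_⟩))))
      try field_simp at this
      push_cast
      linear_combination this
    -- Here `cf` equals `6`, and the factor `2` is removed afterwards.
    · have := h 0 (by omega)
      simp only [cf, gg, eps] at this
      norm_num [Nat.choose] at this
      refine Or.inr (Or.inr (Or.inr (Or.inr (Or.inr ⟨rfl, ?_⟩))))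
      push_cast
      exact (mul_eq_zero.1 (show (2 : k) * 3 = 0 by linear_combination this)).resolve_left h2
    · exfalso
      have e3 := h 3 (by omega)
      have e4 := h 4 (by omega)
      have g : ∀ n, 3 ≤ n → gg k l n = 0 := fun n hn => by
        rw [gg, if_neg (by omega), if_neg (by omega), if_neg (by omega)]
      rw [cf, g _ (by omega), g _ (by omega), sub_zero, zero_sub, neg_eq_zero] at e3 e4
      have e := eps_mul_self (k := k) (l := l)
      have ne : eps k l ≠ 0 := left_ne_zero_of_mul_eq_one e
      have e3 := (mul_eq_zero.1 e3).resolve_left ne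
      have e4 := (mul_eq_zero.1 e4).resolve_left ne
      rw [div_eq_zero_iff, or_iff_left h2] at e3 e4
      push_cast at e3 e4
      exact h2 (by linear_combination e3 - e4)
  · rintro (rfl | rfl | ⟨rfl, h⟩ | rfl | ⟨rfl, h⟩ | ⟨rfl, h⟩) m hm <;>
    · interval_cases m <;>
      · simp only [cf, gg, eps]
        norm_num [Nat.choose]
        try push_cast at h
        try field_simp
        try first
          | done
          | ring1
          | linear_combination (-4 * h)
          | linear_combination (h)
          | linear_combination (-h)
          | linear_combination (2 * h)
          | linear_combination (-2 * h)

theorem eps_cases : eps k l = 1 ∨ eps k l = -1 := neg_one_pow_eq_or k _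

variable [NeZero (2 : k)] (v : Module.Basis (Fin l) k V)

theorem gMul_apply (x y : so k V × S k V) :
    gMul v x y = (⁅x.1, y.1⁆ + om v x.2 y.2, R v x.1 y.2 - R v y.1 x.2) := by
  rw [← om_eq, ← rho_eq_R, ← rho_eq_R]; rfl

theorem gMul_odd_odd (r s : S k V) : gMul v (0, r) (0, s) = (om v r s, 0) := by
  rw [gMul_apply, so_lie_zero, zero_add, R_zero, LinearMap.zero_apply, LinearMap.zero_apply,
    sub_zero]

theorem gMul_even_odd (A : so k V) (s : S k V) : gMul v (A, 0) (0, s) = (0, R v A s) := by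
  rw [gMul_apply, so_lie_zero, zero_add, R_zero, LinearMap.zero_apply, sub_zero, om_zero_left]

/-- The eigenvalues of `[1, v₁⋯vₗ]` on `1` and on a single letter are proportional to `l` and `l -
2`, which cannot both vanish as `2 ≠ 0`. -/
theorem om_one_tp_ne_zero (hl : 1 ≤ l) : om v 1 (tp v) ≠ 0 := by
  intro h
  have h2 : (2 : k) ≠ 0 := NeZero.ne _
  have key : ∀ L : List (Fin l), L.Nodup → L.length ≤ l → wd v L ≠ 0 →
      (l : k) - 2 * L.length = 0 := by
    intro L hL _ hne
    have := R_om_one_tp v hL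
    rw [h, R_zero, LinearMap.zero_apply, smul_zero, eq_comm, smul_eq_zero, or_iff_left hne,
      div_eq_zero_iff, or_iff_left h2] at this
    exact this
  have one_ne : (1 : S k V) ≠ 0 := fun h => by
    have := bb_one_tp v
    rw [h, bb_zero_left] at this
    exact zero_ne_one this
  have e0 := key [] List.nodup_nil (Nat.zero_le _) one_ne
  have e1 := key [⟨0, hl⟩] (List.nodup_singleton _) hl fun h => one_ne <| by
    have nil := wd_nil v
    rw [← an_cr_wd v (L := []) (i := ⟨0, hl⟩) List.not_mem_nil, ← wd_cons, h, map_zero] at nil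
    exact nil.symm
  simp only [List.length_nil, List.length_singleton, Nat.cast_zero, Nat.cast_one] at e0 e1
  exact h2 (by linear_combination e0 - e1)

omit [NeZero (2 : k)] in
theorem mem_gGrading_zero (x : so k V × S k V) : x ∈ gGrading k V 0 ↔ x.2 = 0 := by
  rw [gGrading, if_pos rfl, Submodule.mem_prod]
  simp

omit [NeZero (2 : k)] in
theorem mem_gGrading_one (x : so k V × S k V) : x ∈ gGrading k V 1 ↔ x.1 = 0 := by
  rw [gGrading, if_neg (by decide), Submodule.mem_prod]
  simp

theorem gMul_gMul_odd (r s t : S k V) :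
    gMul v (gMul v (0, r) (0, s)) (0, t) = (0, R v (om v r s) t) := by
  rw [gMul_odd_odd, gMul_even_odd]

/-- If `eps` were `-1`, the odd product would be symmetric as well as alternating; then `2 [1,
v₁⋯vₗ] = 0`, against `om_one_tp_ne_zero`. The super case is the same with the signs exchanged. -/
theorem isLieProduct_gMul_iff (hl : 1 ≤ l) : IsLieProduct (gMul v) ↔
    eps k l = 1 ∧ ∀ r s t, jac v r s t = 0 := by
  have h2 : (2 : k) ≠ 0 := NeZero.ne _
  constructor
  · intro h
    obtain ⟨self, hj⟩ := IsLieProduct.odd (ρ := rho v) (o := oddMul v) (fun _ _ => rfl) h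
    simp only [om_eq, rho_eq_R] at self hj
    have anti : om v 1 (tp v) = -om v (tp v) 1 := by
      have := self (1 + tp v)
      rw [om_add_left, om_add_right, om_add_right, self, self, zero_add, add_zero] at this
      exact eq_neg_of_add_eq_zero_left this
    refine ⟨eps_cases.resolve_right fun he => om_one_tp_ne_zero v hl ?_, hj⟩
    rw [om_symm v 1 (tp v), he, neg_smul, one_smul, neg_neg, eq_neg_iff_add_eq_zero,
      ← two_smul k, smul_eq_zero] at anti
    exact anti.resolve_left h2
  · rintro ⟨he, hj⟩
    refine isLieProduct_of_jacobi (ρ := rho v) (o := oddMul v) (fun _ _ => rfl) (fun A B s => ?_)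
      (fun A s t => ?_) (fun s t => ?_) (fun r s t => ?_)
    · simp only [rho_eq_R]; rw [R_lie]; rfl
    · simp only [om_eq, rho_eq_R]; exact lie_om v A s t
    · rw [om_eq, om_eq, om_symm v t s, he, one_smul]
    · simp only [om_eq, rho_eq_R]; exact hj r s t

theorem isLieSuperProduct_gMul_iff (hl : 1 ≤ l) : IsLieSuperProduct (gGrading k V) (gMul v) ↔
    eps k l = -1 ∧ ∀ r s t, jac v r s t = 0 := by
  have h2 : (2 : k) ≠ 0 := NeZero.ne _
  constructor
  · intro h
    obtain ⟨symm, hj⟩ := IsLieSuperProduct.odd (ρ := rho v) (o := oddMul v) mem_gGrading_one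
      (fun _ _ => rfl) h
    simp only [om_eq, rho_eq_R] at symm hj
    refine ⟨eps_cases.resolve_left fun he => om_one_tp_ne_zero v hl ?_, hj⟩
    have := om_symm v 1 (tp v)
    rw [he, one_smul, symm, eq_neg_iff_add_eq_zero, ← two_smul k, smul_eq_zero] at this
    exact this.resolve_left h2
  · rintro ⟨he, hj⟩
    refine isLieSuperProduct_of_jacobi (ρ := rho v) (o := oddMul v) mem_gGrading_zero
      mem_gGrading_one (fun _ _ => rfl) (fun A B s => ?_)
      (fun A s t => ?_) (fun s t => ?_) (fun r s t => ?_)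
    · simp only [rho_eq_R]; rw [R_lie]; rfl
    · simp only [om_eq, rho_eq_R]; exact lie_om v A s t
    · rw [om_eq, om_eq, om_symm v t s, he, neg_smul, one_smul, neg_neg]
    · simp only [om_eq, rho_eq_R]; exact hj r s t

/-- For each index either the creation or the annihilation operator kills a word, and `b` vanishes
on a word paired with itself when `l ≥ 1`. So every single term of `R_om` is zero. -/
theorem R_om_self_wd (hl : 1 ≤ l) (L : List (Fin l)) : R v (om v (wd v L) (wd v L)) (wd v L) = 0 := by
  have h2 : (2 : k) ≠ 0 := NeZero.ne _
  have hb : bb v (wd v L) (wd v L) = 0 := by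
    cases L with
    | nil =>
      rw [wd_nil, bb_one]
      exact Phi_wd_of_length_ne v (L := []) (by rw [List.length_nil]; omega)
    | cons i L =>
      conv_lhs => rw [wd_cons, bb_cr, ← wd_cons]
      rw [cr_wd_mem v List.mem_cons_self, bb_zero_right, neg_zero]
  have ca : ∀ i, cr v i (wd v L) = 0 ∨ an v i (wd v L) = 0 := fun i => by
    by_cases h : i ∈ L
    · exact Or.inl (cr_wd_mem v h)
    · exact Or.inr (an_wd_notMem v h)
  have t1 : ∀ i, bb v (cr v i (wd v L)) (wd v L) • an v i (wd v L) +
      bb v (an v i (wd v L)) (wd v L) • cr v i (wd v L) = 0 := fun i => by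
    rcases ca i with h | h <;> simp only [h, bb_zero_left, smul_zero, zero_smul, add_zero]
  have t2 : ∀ i j, bb v (cr v i (cr v j (wd v L))) (wd v L) • an v j (an v i (wd v L)) +
      bb v (an v i (an v j (wd v L))) (wd v L) • cr v j (cr v i (wd v L)) = 0 := fun i j => by
    rw [an_an v j i, cr_cr v j i]
    rcases ca j with h | h <;>
      simp only [h, bb_zero_left, smul_zero, zero_smul, add_zero, map_zero, neg_zero]
  have t3 : ∀ i j, bb v (cr v i (an v j (wd v L)) - an v j (cr v i (wd v L))) (wd v L) •
      (cr v j (an v i (wd v L)) - an v i (cr v j (wd v L))) = 0 := fun i j => by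
    rw [an_cr, an_cr]
    rcases eq_or_ne i j with rfl | hij
    · rw [if_pos rfl]
      by_cases h : i ∈ L
      · rw [cr_an_wd v h, sub_self, sub_zero, hb, zero_smul]
      · rw [an_wd_notMem v h, map_zero, sub_zero, zero_sub, bb_neg_left, hb, neg_zero, zero_smul]
    · rw [if_neg hij.symm, if_neg hij]
      by_cases h : j ∈ L
      · have : cr v j (an v i (wd v L)) = 0 := by
          have := an_cr v i j (wd v L)
          rw [cr_wd_mem v h, if_neg hij, map_zero, zero_sub, eq_comm, neg_eq_zero] at this
          exact this
        rw [this, sub_self, sub_zero, smul_zero]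
      · rw [an_wd_notMem v h, map_zero, sub_self, sub_zero, bb_zero_left, zero_smul]
  have := R_om v (wd v L) (wd v L) (wd v L)
  simp only [t1, t2, t3, Finset.sum_const_zero, add_zero, smul_zero] at this
  exact (smul_eq_zero.1 this).resolve_left h2

/-- The cube of an odd element vanishes. -/
theorem gMul_gMul_self (hl : 1 ≤ l) (h : IsLieSuperProduct (gGrading k V) (gMul v))
    {x : so k V × S k V} (hx : x ∈ gGrading k V 1) : gMul v (gMul v x x) x = 0 := by
  obtain ⟨he, hj⟩ := (isLieSuperProduct_gMul_iff v hl).1 h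
  have symm : ∀ s t, om v s t = om v t s := fun s t => by
    rw [om_symm v t s, he, neg_smul, one_smul, neg_neg]
  obtain ⟨A, s⟩ := x
  obtain rfl : A = 0 := (mem_gGrading_one _).1 hx
  suffices R v (om v s s) s = 0 by rw [gMul_gMul_odd, this, Prod.mk_zero_zero]
  -- The Jacobi identity for `s, s, t` makes the mixed terms of the cubic expression cancel, so that
  -- it is additive and only words need checking. For `s, s, s` the identity would be void in
  -- characteristic `3`.
  have two : ∀ s t, R v (om v s s) t = -((2 : k) • R v (om v s t) s) := fun s t => by
    have := hj s s t
    rw [jac, symm t s, add_assoc, ← two_smul k] at this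
    exact eq_neg_of_add_eq_zero_left this
  induction s using wd_induction v with
  | h0 => rw [map_zero]
  | hadd s t hs ht =>
    rw [om_add_left, om_add_right, om_add_right, symm t s, R_add, R_add, R_add]
    simp only [LinearMap.add_apply, map_add]
    rw [hs ((mem_gGrading_one _).2 rfl), ht ((mem_gGrading_one _).2 rfl), two s t, two t s,
      symm t s]
    module
  | hsmul c s hs =>
    rw [om_smul_left, om_smul_right, R_smul, R_smul, LinearMap.smul_apply, LinearMap.smul_apply,
      map_smul, hs ((mem_gGrading_one _).2 rfl), smul_zero, smul_zero, smul_zero]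
  | hwd L hL => exact R_om_self_wd v hl L

end Product

/-! ### A simplicity criterion. -/

section SemidirectProduct

variable {L M : Type*} [LieRing L] [LieAlgebra k L] [AddCommGroup M] [Module k M]
  {μ : (L × M) →ₗ[k] (L × M) →ₗ[k] (L × M)} {ρ : L →ₗ[k] Module.End k M} {o : M →ₗ[k] M →ₗ[k] L}

/-- A criterion for a product on `L ⊕ M` to be simple. Three elements of `L` separate the even part
from the odd part. -/
theorem ideal_eq_bot_or_top
    (hμ : ∀ x y, μ x y = (⁅x.1, y.1⁆ + o x.2 y.2, ρ x.1 y.2 - ρ y.1 x.2)) {a b c : L} {z : k}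
    (heven : ∀ B : L, ⁅a, ⁅b, ⁅c, B⁆⁆⁆ = 0)
    (hodd : ∀ s, z • ρ a (ρ b (ρ c (ρ a (ρ b (ρ c s))))) = s)
    (irr : ∀ N : Submodule k M, (∀ A, ∀ s ∈ N, ρ A s ∈ N) → N = ⊥ ∨ N = ⊤)
    (faithful : ∀ A, ρ A = 0 → A = 0) (span : ∀ N : Submodule k L, (∀ s t, o s t ∈ N) → N = ⊤)
    (I : Submodule k (L × M)) (hI : ∀ x, ∀ y ∈ I, μ x y ∈ I) : I = ⊥ ∨ I = ⊤ := by
  have ad : ∀ A : L, ∀ y ∈ I, (⁅A, y.1⁆, ρ A y.2) ∈ I := fun A y hy => by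
    have := hI (A, 0) y hy
    rw [hμ] at this
    simpa using this
  -- Applying the three elements twice annihilates the even component and, after scaling by `z`,
  -- restores the odd one.
  have odd_mem : ∀ y ∈ I, ((0 : L), y.2) ∈ I := fun y hy => by
    have := ad a _ (ad b _ (ad c _ (ad a _ (ad b _ (ad c y hy)))))
    simp only [heven, lie_zero] at this
    have := I.smul_mem z this
    rwa [Prod.smul_mk, smul_zero, hodd] at this
  have even_mem : ∀ y ∈ I, (y.1, (0 : M)) ∈ I := fun y hy => by
    have e : (y.1, (0 : M)) = y - (0, y.2) := by ext <;> simp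
    exact e ▸ I.sub_mem hy (odd_mem y hy)
  rcases irr (I.comap (LinearMap.inr k L M)) (fun A s hs => by simpa using ad A _ hs) with h | h
  · refine Or.inl ((Submodule.eq_bot_iff _).2 fun y hy => ?_)
    have h2 : ∀ y ∈ I, y.2 = 0 := fun y hy => by
      have : y.2 ∈ I.comap (LinearMap.inr k L M) := odd_mem y hy
      rwa [h] at this
    refine Prod.ext (faithful _ (LinearMap.ext fun s => ?_)) (h2 y hy)
    have := hI (0, s) _ (even_mem y hy)
    rw [hμ] at this
    simpa using h2 _ this
  · have hs : ∀ s, ((0 : L), s) ∈ I := fun s => by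
      have : s ∈ I.comap (LinearMap.inr k L M) := h ▸ Submodule.mem_top
      exact this
    have hL := span (I.comap (LinearMap.inl k L M)) fun s t => by
      have := hI (0, s) _ (hs t)
      rw [hμ] at this
      simpa using this
    refine Or.inr (Submodule.eq_top_iff'.2 fun y => ?_)
    have h1 : y.1 ∈ I.comap (LinearMap.inl k L M) := hL ▸ Submodule.mem_top
    have := I.add_mem (show (y.1, (0 : M)) ∈ I from h1) (hs y.2)
    simpa using this

end SemidirectProduct

/-! ### Irreducibility, faithfulness and simplicity. -/

section Simple

variable {l : ℕ} (v : Module.Basis (Fin l) k V)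

theorem pol_uW_uW : pol (uW : W k V) uW = -2 := by rw [pol_eq]; simp [uW]
theorem pol_uW_fW (i : Fin l) : pol uW (fW v i) = 0 := by rw [pol_eq]; simp [uW, fW]
theorem pol_vW_uW (i : Fin l) : pol (vW v i) uW = 0 := by rw [pol_eq]; simp [uW, vW]
theorem pol_fW_uW (i : Fin l) : pol (fW v i) uW = 0 := by rw [pol_eq]; simp [uW, fW]
theorem pol_vW_vW (i j : Fin l) : pol (vW v i) (vW v j) = 0 := by rw [pol_eq]; simp [vW]
theorem pol_fW_fW (i j : Fin l) : pol (fW v i) (fW v j) = 0 := by rw [pol_eq]; simp [fW]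
theorem pol_vW_fW (i j : Fin l) : pol (vW v i) (fW v j) = if i = j then 1 else 0 := by
  rw [pol_eq]; simp [vW, fW, Finsupp.single_apply]
theorem pol_fW_vW (i j : Fin l) : pol (fW v i) (vW v j) = if i = j then 1 else 0 := by
  rw [pol_comm, pol_vW_fW]; exact if_congr eq_comm rfl rfl

/-- The coroots of the split Cartan subalgebra of `so(W,q)`. -/
def hh (i : Fin l) : so k V := sg (vW v i) (fW v i)

theorem hh_ap (i : Fin l) (x : W k V) :
    ap (hh v i) x = pol (vW v i) x • fW v i - pol (fW v i) x • vW v i := sg_ap _ _ _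

/-- The image of `hh v j` lies in the hyperbolic plane of `vⱼ` and `fⱼ`, on which `hh v i` is zero.
-/
theorem hh_hh_ap {i j : Fin l} (h : i ≠ j) (x : W k V) : ap (hh v i) (ap (hh v j) x) = 0 := by
  rw [hh_ap, hh_ap]
  simp only [pol_sub_right, pol_smul_right, pol_vW_vW, pol_fW_fW, pol_vW_fW, pol_fW_vW, h, if_false,
    mul_zero, sub_zero, zero_smul]

variable [NeZero (2 : k)]

/-- By the Leibniz rule three operators are distributed over the two vectors of `σ_{x,y}`, so one
vector receives two distinct ones and becomes zero. -/
theorem lie_hh_hh_hh {a b c : Fin l} (hab : a ≠ b) (hac : a ≠ c) (hbc : b ≠ c) (A : so k V) :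
    ⁅hh v a, ⁅hh v b, ⁅hh v c, A⁆⁆⁆ = 0 := by
  induction A using so_induction v with
  | h0 => rw [so_lie_zero, so_lie_zero, so_lie_zero]
  | hadd A B hA hB => rw [so_lie_add, so_lie_add, so_lie_add, hA, hB, add_zero]
  | hsmul c A hA => rw [so_lie_smul, so_lie_smul, so_lie_smul, hA, smul_zero]
  | hsg x y =>
    simp only [lie_sg, so_lie_add, hh_hh_ap v hab, hh_hh_ap v hac, hh_hh_ap v hbc, sg_zero_left,
      sg_zero_right, so_lie_zero, add_zero]

theorem R_hh_wd (i : Fin l) (L : List (Fin l)) :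
    (2 : k) • R v (hh v i) (wd v L) = (if i ∈ L then -1 else 1 : k) • wd v L := by
  have h2 : (2 : k) ≠ 0 := NeZero.ne _
  rw [hh, R_vf, smul_smul, mul_neg, mul_one_div_cancel h2]
  split_ifs with h
  · rw [cr_an_wd v h, cr_wd_mem v h, map_zero, sub_zero]
  · rw [an_cr_wd v h, an_wd_notMem v h, map_zero, zero_sub, smul_neg, neg_smul, neg_neg]

theorem R_hh_sq (i : Fin l) (s : S k V) : (4 : k) • R v (hh v i) (R v (hh v i) s) = s := by
  have h2 : (2 : k) ≠ 0 := NeZero.ne _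
  induction s using wd_induction v with
  | h0 => simp only [map_zero, smul_zero]
  | hadd s t hs ht => rw [map_add, map_add, smul_add, hs, ht]
  | hsmul c s hs => rw [map_smul, map_smul, smul_comm, hs]
  | hwd L hL =>
    rw [show (4 : k) = 2 * 2 by norm_num, mul_smul, ← map_smul, R_hh_wd, map_smul,
      smul_comm, R_hh_wd]
    split_ifs
    · rw [neg_one_smul, neg_one_smul, neg_neg]
    · rw [one_smul, one_smul]

omit [NeZero (2 : k)] in
theorem hh_comm (i j : Fin l) : ⁅hh v i, hh v j⁆ = 0 := by
  rcases eq_or_ne i j with rfl | h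
  · exact lie_self _
  · have : ∀ x y : W k V, x = vW v j ∨ x = fW v j → ap (hh v i) x = 0 := by
      rintro x y (rfl | rfl) <;> rw [hh_ap] <;>
        simp only [pol_vW_vW, pol_fW_fW, pol_vW_fW, pol_fW_vW, h, if_false, zero_smul, sub_zero]
    conv_lhs => rw [hh.eq_def v j]
    rw [lie_sg, this _ 0 (Or.inl rfl), this _ 0 (Or.inr rfl), sg_zero_left, sg_zero_right, add_zero]

theorem R_hh_comm (i j : Fin l) (s : S k V) :
    R v (hh v i) (R v (hh v j) s) = R v (hh v j) (R v (hh v i) s) := by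
  have := LinearMap.congr_fun (R_lie v (hh v i) (hh v j)) s
  rw [hh_comm, R_zero] at this
  exact (sub_eq_zero.1 this.symm)

theorem R_hh_hh_hh (a b c : Fin l) (s : S k V) : (64 : k) • R v (hh v a) (R v (hh v b)
    (R v (hh v c) (R v (hh v a) (R v (hh v b) (R v (hh v c) s))))) = s := by
  rw [R_hh_comm v c a, R_hh_comm v b a, R_hh_comm v c b,
    show (64 : k) = 4 * (4 * 4) by norm_num, mul_smul, mul_smul, ← map_smul, ← map_smul,
    ← map_smul, ← map_smul, R_hh_sq, ← map_smul, ← map_smul, R_hh_sq, map_smul, map_smul, R_hh_sq]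

/-- A nonzero submodule contains `1` by annihilation, and hence everything by creation. -/
theorem eq_bot_or_top_of_R (N : Submodule k (S k V)) (hN : ∀ A, ∀ s ∈ N, R v A s ∈ N) :
    N = ⊥ ∨ N = ⊤ := by
  rw [or_iff_not_imp_left]
  intro h
  refine eq_top_of_cr v (one_mem_of_an v (fun i s hs => ?_) h) fun i s hs => ?_
  · have := hN (-sg uW (fW v i)) s hs
    rwa [R_neg, R_uf, neg_neg] at this
  · have := hN (-sg uW (vW v i)) s hs
    rwa [R_neg, R_uv, neg_neg] at this

theorem R_sg_u_apply (w : W k V) (s : S k V) : R v (sg uW w) s =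
    -∑ i, (pol (vW v i) w • an v i s + pol (fW v i) w • cr v i s) := by
  have e : sg uW w = sg uW (w.1, 0) := by
    have : w = (w.1, 0) + w.2 • uW := by ext <;> simp [uW]
    conv_lhs => rw [this]
    rw [sg_add_right, sg_smul_right, sg_self, smul_zero, add_zero]
  rw [e, R_sg_u, fock_expand v, LinearMap.neg_apply, LinearMap.sum_apply]
  simp [pol_eq, vW, fW]

omit [NeZero (2 : k)] in
theorem cst_cr_an (i j : Fin l) : cr v i (an v j 1) - an v j (cr v i 1) =
    if i = j then -1 else (0 : S k V) := by
  rw [an_one, map_zero, zero_sub, an_cr, an_one, map_zero, sub_zero]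
  by_cases h : i = j
  · rw [if_pos h.symm, if_pos h]
  · rw [if_neg (Ne.symm h), if_neg h, neg_zero]

include v in
theorem W_ext {x y : W k V} (hu : pol uW x = pol uW y) (hv : ∀ i, pol (vW v i) x = pol (vW v i) y)
    (hf : ∀ i, pol (fW v i) x = pol (fW v i) y) : x = y := by
  rw [W_expand v x, W_expand v y, hu]
  simp only [hv, hf]

omit [NeZero (2 : k)] in
include v in
theorem one_ne_zero_S : (1 : S k V) ≠ 0 := fun h => by
  have := bb_one_tp v
  rw [h, bb_zero_left] at this
  exact zero_ne_one this

/-- The coefficients are read off as constant terms, after acting on `vᵢ` and on `1`. -/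
theorem eq_zero_of_R_u {w : W k V} (h : R v (sg uW w) = 0) (i : Fin l) :
    pol (vW v i) w = 0 ∧ pol (fW v i) w = 0 := by
  have hs : ∀ s, ∑ i, (pol (vW v i) w • an v i s + pol (fW v i) w • cr v i s) = 0 := fun s => by
    rw [← neg_eq_zero, ← R_sg_u_apply, h]; rfl
  constructor
  · have := congrArg cst (hs (cr v i 1))
    rw [map_sum, map_zero, Finset.sum_eq_single i] at this
    · simpa [an_cr, an_one, cst_cr, cst_one] using this
    · intro j _ hj
      simp [an_cr, an_one, cst_cr, hj]
    · simp
  · have := congrArg (fun s => cst (an v i s)) (hs 1)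
    simp only [an_one, smul_zero, zero_add, map_sum, map_zero, map_smul, an_cr, sub_zero,
      apply_ite cst, cst_one, smul_eq_mul] at this
    simpa using this

/-- The kernel contains `[A, σ_{u,w}] = σ_{Au,w} + σ_{u,Aw}`. The second summand sends `1` to
something without constant term, so the first does too, for all `w`; this forces `A u = 0`. Then
`σ_{u,Ax}` lies in the kernel, which removes all components of `A x` but that along `u`, and
skewness removes the last one. -/
theorem eq_zero_of_R {A : so k V} (hA : R v A = 0) : A = 0 := by
  have h2 : (2 : k) ≠ 0 := NeZero.ne _
  have hlie : ∀ B, R v ⁅A, B⁆ = 0 := fun B => by rw [R_lie, hA, zero_mul, mul_zero, sub_zero]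
  have huu : pol uW (ap A uW) = 0 := by
    have := pol_ap A uW uW
    rw [pol_comm, eq_neg_iff_add_eq_zero, ← two_mul] at this
    exact (mul_eq_zero.1 this).resolve_left h2
  have expand : ∀ w, cst (R v (sg (ap A uW) w) 1) =
      ∑ i, (pol (fW v i) (ap A uW) * cst (R v (sg (vW v i) w) 1) +
        pol (vW v i) (ap A uW) * cst (R v (sg (fW v i) w) 1)) := fun w => by
    have sgs : ∀ (f : Fin l → W k V), sg (∑ i, f i) w = ∑ i, sg (f i) w := fun f => by
      induction (Finset.univ : Finset (Fin l)) using Finset.cons_induction with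
      | empty => rw [Finset.sum_empty, Finset.sum_empty, sg_zero_left]
      | cons a t ha ih => rw [Finset.sum_cons, Finset.sum_cons, sg_add_left, ih]
    conv_lhs => rw [W_expand v (ap A uW), huu, mul_zero, zero_smul, zero_add, sgs, R_sum]
    simp only [sg_add_left, sg_smul_left, R_add, R_smul, LinearMap.sum_apply, LinearMap.add_apply,
      LinearMap.smul_apply, map_sum, map_add, map_smul, smul_eq_mul]
  have cu : ∀ w, cst (R v (sg uW w) 1) = 0 := fun w => by
    rw [R_sg_u_apply]
    simp [an_one, cst_cr]
  have key : ∀ w, cst (R v (sg (ap A uW) w) 1) = 0 := fun w => by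
    have := LinearMap.congr_fun (hlie (sg uW w)) 1
    rw [lie_sg, R_add, LinearMap.add_apply] at this
    have := congrArg cst this
    rwa [map_add, cu, add_zero, LinearMap.zero_apply, map_zero] at this
  have hf : ∀ i, pol (fW v i) (ap A uW) = 0 := fun j => by
    have := key (fW v j)
    rw [expand] at this
    simp only [R_vf, R_ff, an_one, map_zero, neg_zero, mul_zero, add_zero] at this
    have e : ∀ i, cst (-(1 / 2 : k) • ((0 : S k V) - an v j (cr v i 1))) =
        if i = j then 1 / 2 else 0 := fun i => by
      rw [an_cr, an_one, map_zero, sub_zero]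
      split_ifs with h1 h2 h2
      · simp [cst_one]
      · exact absurd h1.symm h2
      · exact absurd h2.symm h1
      · simp
    simp only [e] at this
    simpa [h2] using this
  have hv : ∀ i, pol (vW v i) (ap A uW) = 0 := fun j => by
    have := key (vW v j)
    rw [expand] at this
    simp only [hf, zero_mul, zero_add] at this
    have e : ∀ i, cst (R v (sg (fW v i) (vW v j)) 1) = if i = j then -(1 / 2) else 0 := fun i => by
      rw [sg_swap, R_neg, LinearMap.neg_apply, R_vf, cst_cr_an]
      split_ifs with h1 h2 h2
      · simp [cst_one]
      · exact absurd h1.symm h2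
      · exact absurd h2.symm h1
      · simp
    simp only [e] at this
    simpa [h2] using this
  have hu : ap A uW = 0 := W_ext v (by rw [huu, pol_zero_right])
    (fun i => by rw [hv, pol_zero_right]) fun i => by rw [hf, pol_zero_right]
  refine so_ext fun x => W_ext v ?_ (fun i => ?_) fun i => ?_
  · rw [zero_ap, pol_zero_right, ← neg_eq_zero, ← pol_ap, hu, pol_zero_left]
  all_goals
    have := hlie (sg uW x)
    rw [lie_sg, hu, sg_zero_left, zero_add] at this
    rw [zero_ap, pol_zero_right]
  · exact (eq_zero_of_R_u v this i).1
  · exact (eq_zero_of_R_u v this i).2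

/-- A functional vanishing on all `[s,t]` is `½ tr(B ·)` for some `B`, and then `b(Bs, t) = 0` for
all `s`, `t`; so `B` acts as zero and is zero. -/
theorem eq_top_of_om (N : Submodule k (so k V)) (hN : ∀ s t, om v s t ∈ N) : N = ⊤ := by
  have : FiniteDimensional k V := Module.Finite.of_basis v
  by_contra h
  obtain ⟨φ, hφ, hN'⟩ := Submodule.exists_le_ker_of_lt_top N (lt_top_iff_ne_top.2 h)
  obtain ⟨B, rfl⟩ := ((halfTrace k V).toDual halfTrace_nondegenerate).surjective φ
  have hB : ∀ A, (halfTrace k V).toDual halfTrace_nondegenerate B A = ht B A := fun A => by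
    rw [LinearMap.BilinForm.toDual_def]; unfold ht; rfl
  refine hφ ?_
  rw [eq_zero_of_R v (LinearMap.ext fun s => eq_zero_of_bb v fun t => ?_ : R v B = 0), map_zero]
  rw [← ht_om, ← hB]
  exact hN' (hN s t)

/-- The bound `3 ≤ l` supplies three distinct coroots. The scalar `64` is `4³`, each coroot acting
by `±½` on words. Ideals are not assumed to be graded. -/
theorem gMul_ideal (hl : 3 ≤ l) (I : Submodule k (so k V × S k V))
    (hI : ∀ x, ∀ y ∈ I, gMul v x y ∈ I) : I = ⊥ ∨ I = ⊤ := by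
  refine ideal_eq_bot_or_top (ρ := rho v) (o := oddMul v) (fun _ _ => rfl)
    (a := hh v ⟨0, by omega⟩) (b := hh v ⟨1, by omega⟩) (c := hh v ⟨2, by omega⟩) (z := 64)
    (lie_hh_hh_hh v (by simp) (by simp) (by simp)) (fun s => ?_) (fun N hN => ?_) (fun A hA => ?_)
    (fun N hN => ?_) I hI
  · simp only [rho_eq_R]
    exact R_hh_hh_hh v _ _ _ s
  · simp only [rho_eq_R] at hN
    exact eq_bot_or_top_of_R v N hN
  · rw [rho_eq_R] at hA
    exact eq_zero_of_R v hA
  · simp only [om_eq] at hN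
    exact eq_top_of_om v N hN

theorem gMul_ne_zero (hl : 1 ≤ l) : gMul v ≠ 0 := fun h => by
  have := gMul_odd_odd v 1 (tp v)
  rw [h, LinearMap.zero_apply, LinearMap.zero_apply] at this
  exact om_one_tp_ne_zero v hl (Prod.ext_iff.1 this).1.symm

theorem isGradedSimple_gMul (hl : 3 ≤ l) : IsGradedSimple (gGrading k V) (gMul v) :=
  ⟨gMul_ne_zero v (by omega), fun I hI _ => gMul_ideal v hl I fun x y hy => (hI x y hy).1⟩

end Simple

/-! ### Weight spaces of a torus action and independence of characters. -/

section Weights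

variable {B Q : Type*} [Fintype B] [AddCommGroup Q] [Module k Q]

/-- The character of the torus `(kˣ)^B` given by an element of the root lattice. -/
def character (k : Type*) [Field k] {B : Type*} [Fintype B] (d : B → ℤ) : (B → kˣ) →* k where
  toFun t := ((∏ i, t i ^ d i : kˣ) : k)
  map_one' := by simp
  map_mul' s t := by simp [mul_zpow, Finset.prod_mul_distrib]

theorem character_apply (d : B → ℤ) (t : B → kˣ) :
    character k d t = ((∏ i, t i ^ d i : kˣ) : k) := rfl

theorem character_zero (t : B → kˣ) : character k (0 : B → ℤ) t = 1 := by simp [character_apply]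

theorem character_add (d e : B → ℤ) (t : B → kˣ) :
    character k (d + e) t = character k d t * character k e t := by
  simp [character_apply, zpow_add, Finset.prod_mul_distrib]

theorem character_single [DecidableEq B] (i : B) (t : B → kˣ) :
    character k (Pi.single i 1) t = t i := by
  rw [character_apply, Finset.prod_eq_single i] <;> simp +contextual

theorem character_neg (d : B → ℤ) (t : B → kˣ) :
    character k (-d) t = (character k d t)⁻¹ := by
  simp [character_apply]

/-- Otherwise the polynomials `X ^ (m + 1)` and `X` would agree at every point of an infinite field.
-/
theorem exists_units_pow_ne_one [Infinite k] {m : ℕ} (hm : m ≠ 0) : ∃ z : kˣ, z ^ m ≠ 1 := by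
  by_contra! h
  have : (Polynomial.X ^ (m + 1) : Polynomial k) = Polynomial.X := Polynomial.funext fun r => by
    rw [Polynomial.eval_pow, Polynomial.eval_X]
    rcases eq_or_ne r 0 with rfl | hr
    · simp
    · have := congrArg Units.val (h (Units.mk0 r hr))
      rw [Units.val_pow_eq_pow_val, Units.val_mk0, Units.val_one] at this
      rw [pow_succ, this, one_mul]
  have := congrArg Polynomial.natDegree this
  rw [Polynomial.natDegree_X_pow, Polynomial.natDegree_X] at this
  omega

theorem character_injective [Infinite k] :
    Function.Injective (character k : (B → ℤ) → (B → kˣ) →* k) := by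
  classical
  intro d d' h
  funext i
  by_contra hi
  obtain ⟨z, hz⟩ := exists_units_pow_ne_one (k := k) (Int.natAbs_ne_zero.2 (sub_ne_zero.2 hi))
  have key : ∀ d : B → ℤ, character k d (Pi.mulSingle i z) = ((z ^ d i : kˣ) : k) := fun d => by
    rw [character_apply, Finset.prod_eq_single i] <;>
      simp +contextual
  have e := DFunLike.congr_fun h (Pi.mulSingle i z)
  rw [key, key] at e
  have e := Units.ext e
  have e : z ^ (d i - d' i) = 1 := by rw [zpow_sub, e, mul_inv_cancel]
  refine hz ?_
  rcases Int.natAbs_eq (d i - d' i) with h | h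
  · rwa [h, zpow_natCast] at e
  · rwa [h, zpow_neg, inv_eq_one, zpow_natCast] at e

variable (ψ : (B → kˣ) → Q →ₗ[k] Q)

/-- The weight spaces of an action of the torus. -/
def weight (d : B → ℤ) : Submodule k Q where
  carrier := {x | ∀ t, ψ t x = character k d t • x}
  zero_mem' := fun t => by simp
  add_mem' := fun hx hy t => by rw [map_add, hx, hy, smul_add]
  smul_mem' := fun c x hx t => by rw [map_smul, hx, smul_comm]

/-- Dedekind's independence of characters, applied after a linear functional has turned the vectors
into scalars. -/
theorem weight_independent [Infinite k] (x : (B → ℤ) →₀ Q) (hx : ∀ d, x d ∈ weight ψ d)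
    (h : ∑ d ∈ x.support, x d = 0) : x = 0 := by
  have li := (linearIndependent_monoidHom (B → kˣ) k).comp _ (character_injective (k := k) (B := B))
  rw [linearIndependent_iff'] at li
  ext d
  rw [Finsupp.zero_apply]
  by_contra hd
  refine hd ((Module.forall_dual_apply_eq_zero_iff k (x d)).1 fun φ => ?_)
  refine li x.support (fun d => φ (x d)) ?_ d (Finsupp.mem_support_iff.2 hd)
  funext t
  have := congrArg (fun y => φ (ψ t y)) h
  simp only [map_sum, map_zero] at this
  rw [Finset.sum_apply, Pi.zero_apply, ← this]
  refine Finset.sum_congr rfl fun d _ => ?_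
  rw [hx d t, map_smul, Pi.smul_apply, smul_eq_mul, smul_eq_mul, mul_comm]
  rfl

theorem eq_of_sum_mem_weight_zero [Infinite k] (x : (B → ℤ) →₀ Q) (hx : ∀ d, x d ∈ weight ψ d) {y : Q}
    (hy : y ∈ weight ψ 0) (h : ∑ d ∈ x.support, x d = y) : x 0 = y := by
  have e := weight_independent ψ (x - Finsupp.single 0 y) (fun d => ?_) ?_
  · simpa [sub_eq_zero] using DFunLike.congr_fun e 0
  · rw [Finsupp.sub_apply]
    refine sub_mem (hx d) ?_
    rcases eq_or_ne d 0 with rfl | h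
    · rwa [Finsupp.single_eq_same]
    · rw [Finsupp.single_eq_of_ne h]
      exact zero_mem _
  · have s : ∀ x : (B → ℤ) →₀ Q, ∑ d ∈ x.support, x d = x.sum fun _ y => y := fun x => rfl
    rw [s] at h ⊢
    rw [Finsupp.sum_sub_index fun _ _ _ => rfl, h, Finsupp.sum_single_index rfl, sub_self]

/-- Homogeneous summands are collected into one for each degree. Closure of the predicates under
linear combinations suffices; directness of the sum is not presupposed. -/
theorem exists_finsupp_of_mem_span {ι : Type*} {P : ι → Q → Prop} (h0 : ∀ d, P d 0)
    (hadd : ∀ d x y, P d x → P d y → P d (x + y)) (hsmul : ∀ d (c : k) x, P d x → P d (c • x))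
    {x : Q} (hx : x ∈ Submodule.span k {x | ∃ d, P d x}) :
    ∃ f : ι →₀ Q, (∀ d, P d (f d)) ∧ ∑ d ∈ f.support, f d = x := by
  classical
  have s : ∀ x : ι →₀ Q, ∑ d ∈ x.support, x d = x.sum fun _ y => y := fun x => rfl
  simp only [s]
  induction hx using Submodule.span_induction with
  | mem x hx =>
    obtain ⟨d, hd⟩ := hx
    refine ⟨Finsupp.single d x, fun d' => ?_, Finsupp.sum_single_index rfl⟩
    rcases eq_or_ne d' d with rfl | h
    · rwa [Finsupp.single_eq_same]
    · rw [Finsupp.single_eq_of_ne h]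
      exact h0 _
  | zero => exact ⟨0, fun d => h0 d, Finsupp.sum_zero_index⟩
  | add x y _ _ hx hy =>
    obtain ⟨f, hf, rfl⟩ := hx
    obtain ⟨g, hg, rfl⟩ := hy
    exact ⟨f + g, fun d => hadd d _ _ (hf d) (hg d),
      Finsupp.sum_add_index' (fun _ => rfl) fun _ _ _ => rfl⟩
  | smul c x _ hx =>
    obtain ⟨f, hf, rfl⟩ := hx
    refine ⟨c • f, fun d => hsmul d _ _ (hf d), ?_⟩
    rw [Finsupp.sum_smul_index' fun _ => rfl, Finsupp.smul_sum]

end Weights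

/-! ### The triangular decomposition for Chevalley generators. -/

section Triangular

variable {B Q : Type*} [DecidableEq B] [LieRing Q] [LieAlgebra k Q]

/-- The relations between Chevalley generators. -/
structure IsChevalley (C : Matrix B B ℤ) (e f h : B → Q) : Prop where
  hh : ∀ i j, ⁅h i, h j⁆ = 0
  ef : ∀ i j, ⁅e i, f j⁆ = if i = j then h i else 0
  he : ∀ i j, ⁅h i, e j⁆ = C i j • e j
  hf : ∀ i j, ⁅h i, f j⁆ = -(C i j • f j)

theorem lie_mem_span_right {N : Submodule k Q} {s : Set Q} {y : Q} (h : ∀ x ∈ s, ⁅x, y⁆ ∈ N) {x : Q}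
    (hx : x ∈ Submodule.span k s) : ⁅x, y⁆ ∈ N := by
  induction hx using Submodule.span_induction with
  | mem x hx => exact h x hx
  | zero => rw [zero_lie]; exact zero_mem _
  | add x x' _ _ h1 h2 => rw [add_lie]; exact add_mem h1 h2
  | smul c x _ h1 => rw [smul_lie]; exact N.smul_mem c h1

variable {C : Matrix B B ℤ} {e f h : B → Q}

/-- The Chevalley involution, which transfers each statement about the `e i` to the `f i`. -/
theorem IsChevalley.symm (H : IsChevalley C e f h) : IsChevalley C f e (fun i => -h i) where
  hh i j := by rw [neg_lie, lie_neg, H.hh, neg_zero, neg_zero]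
  ef i j := by
    rw [← lie_skew, H.ef]
    rcases eq_or_ne i j with rfl | hij
    · rw [if_pos rfl, if_pos rfl]
    · rw [if_neg hij.symm, if_neg hij, neg_zero]
  he i j := by rw [neg_lie, H.hf, neg_neg]
  hf i j := by rw [neg_lie, H.he]

/-- For a bracket, the Leibniz rule lets `f j` hit one factor at a time. The part of the result in
the span of the `h i` acts on the other factor and stays within the subalgebra generated by the `e
i`, by the first half of the induction. -/
theorem IsChevalley.lie_mem (H : IsChevalley C e f h) {x : Q}
    (hx : x ∈ LieSubalgebra.lieSpan k Q (Set.range e)) :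
    (∀ j, ⁅h j, x⁆ ∈ LieSubalgebra.lieSpan k Q (Set.range e)) ∧
    ∀ j, ⁅f j, x⁆ ∈ (LieSubalgebra.lieSpan k Q (Set.range e)).toSubmodule ⊔
      Submodule.span k (Set.range h) := by
  induction hx using LieSubalgebra.lieSpan_induction with
  | mem x hx =>
    obtain ⟨i, rfl⟩ := hx
    constructor
    · intro j
      rw [H.he, ← Int.cast_smul_eq_zsmul k]
      exact SMulMemClass.smul_mem _ (LieSubalgebra.subset_lieSpan ⟨i, rfl⟩)
    · intro j
      rw [← lie_skew, H.ef]
      refine neg_mem (Submodule.mem_sup_right ?_)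
      split_ifs
      · exact Submodule.subset_span ⟨i, rfl⟩
      · exact zero_mem _
  | zero =>
    refine ⟨fun j => ?_, fun j => ?_⟩ <;> rw [lie_zero] <;> exact zero_mem _
  | add x y _ _ hx hy =>
    refine ⟨fun j => ?_, fun j => ?_⟩ <;> rw [lie_add]
    · exact add_mem (hx.1 j) (hy.1 j)
    · exact add_mem (hx.2 j) (hy.2 j)
  | smul c x _ hx =>
    refine ⟨fun j => ?_, fun j => ?_⟩ <;> rw [lie_smul]
    · exact SMulMemClass.smul_mem c (hx.1 j)
    · exact Submodule.smul_mem _ c (hx.2 j)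
  | lie x y hx' hy' hx hy =>
    have key : ∀ x y, y ∈ LieSubalgebra.lieSpan k Q (Set.range e) →
        (∀ j, ⁅h j, y⁆ ∈ LieSubalgebra.lieSpan k Q (Set.range e)) →
        x ∈ (LieSubalgebra.lieSpan k Q (Set.range e)).toSubmodule ⊔
          Submodule.span k (Set.range h) →
        ⁅x, y⁆ ∈ (LieSubalgebra.lieSpan k Q (Set.range e)).toSubmodule := by
      intro x y hy hhy hx
      obtain ⟨n, hn, z, hz, rfl⟩ := Submodule.mem_sup.1 hx
      rw [add_lie]
      refine add_mem (LieSubalgebra.lie_mem _ hn hy) (lie_mem_span_right ?_ hz)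
      rintro _ ⟨j, rfl⟩
      exact hhy j
    refine ⟨fun j => ?_, fun j => ?_⟩ <;> rw [leibniz_lie]
    · exact add_mem (LieSubalgebra.lie_mem _ (hx.1 j) hy') (LieSubalgebra.lie_mem _ hx' (hy.1 j))
    · refine Submodule.mem_sup_left (add_mem (key _ _ hy' hy.1 (hx.2 j)) ?_)
      rw [← lie_skew]
      exact neg_mem (key _ _ hx' hx.1 (hy.2 j))

/-- The sum of the three pieces is stable under bracketing with each `e i` and `f i`, hence with
everything they generate; as it contains them, it is everything. -/
theorem IsChevalley.sup_eq_top (H : IsChevalley C e f h)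
    (hgen : LieSubalgebra.lieSpan k Q (Set.range e ∪ Set.range f) = ⊤) :
    (LieSubalgebra.lieSpan k Q (Set.range e)).toSubmodule ⊔
      (LieSubalgebra.lieSpan k Q (Set.range f)).toSubmodule ⊔ Submodule.span k (Set.range h) = ⊤ := by
  set P := (LieSubalgebra.lieSpan k Q (Set.range e)).toSubmodule with hP
  set N := (LieSubalgebra.lieSpan k Q (Set.range f)).toSubmodule with hN
  set Z := Submodule.span k (Set.range h) with hZ
  have Zneg : Submodule.span k (Set.range fun i => -h i) = Z := by
    rw [hZ, ← Submodule.span_neg (Set.range h)]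
    congr 1
    ext x
    simp only [Set.mem_range, Set.mem_neg]
    exact exists_congr fun y => ⟨fun h => by rw [← h, neg_neg], fun h => by rw [h, neg_neg]⟩
  have heP : ∀ i, e i ∈ P := fun i => LieSubalgebra.subset_lieSpan ⟨i, rfl⟩
  have hfN : ∀ i, f i ∈ N := fun i => LieSubalgebra.subset_lieSpan ⟨i, rfl⟩
  have stable : ∀ g ∈ Set.range e ∪ Set.range f, ∀ y ∈ P ⊔ N ⊔ Z, ⁅g, y⁆ ∈ P ⊔ N ⊔ Z := by
    intro g hg y hy
    obtain ⟨w, hw, z, hz, rfl⟩ := Submodule.mem_sup.1 hy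
    obtain ⟨p, hp, n, hn, rfl⟩ := Submodule.mem_sup.1 hw
    rw [lie_add, lie_add]
    rcases hg with ⟨i, rfl⟩ | ⟨i, rfl⟩
    · refine add_mem (add_mem ?_ ?_) ?_
      · exact Submodule.mem_sup_left (Submodule.mem_sup_left (LieSubalgebra.lie_mem _ (heP i) hp))
      · have := (H.symm.lie_mem hn).2 i
        rw [Zneg] at this
        exact (sup_le_sup_right le_sup_right Z : N ⊔ Z ≤ P ⊔ N ⊔ Z) this
      · refine Submodule.mem_sup_left (Submodule.mem_sup_left ?_)
        rw [← lie_skew]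
        refine neg_mem (lie_mem_span_right ?_ hz)
        rintro _ ⟨j, rfl⟩
        exact (H.lie_mem (heP i)).1 j
    · refine add_mem (add_mem ?_ ?_) ?_
      · exact (sup_le_sup_right le_sup_left Z : P ⊔ Z ≤ P ⊔ N ⊔ Z) ((H.lie_mem hp).2 i)
      · exact Submodule.mem_sup_left (Submodule.mem_sup_right (LieSubalgebra.lie_mem _ (hfN i) hn))
      · refine Submodule.mem_sup_left (Submodule.mem_sup_right ?_)
        rw [← lie_skew]
        refine neg_mem (lie_mem_span_right ?_ hz)
        rintro _ ⟨j, rfl⟩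
        have := (H.symm.lie_mem (hfN i)).1 j
        rw [neg_lie] at this
        exact neg_mem_iff.1 this
  have lie_mem : ∀ g y : Q, y ∈ P ⊔ N ⊔ Z → ⁅g, y⁆ ∈ P ⊔ N ⊔ Z := by
    intro g
    have hg : g ∈ LieSubalgebra.lieSpan k Q (Set.range e ∪ Set.range f) := hgen ▸ trivial
    induction hg using LieSubalgebra.lieSpan_induction with
    | mem x hx => exact stable x hx
    | zero => intro y _; rw [zero_lie]; exact zero_mem _
    | add a b _ _ ha hb => intro y hy; rw [add_lie]; exact add_mem (ha y hy) (hb y hy)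
    | smul c a _ ha => intro y hy; rw [smul_lie]; exact Submodule.smul_mem _ c (ha y hy)
    | lie a b _ _ ha hb =>
      intro y hy
      rw [lie_lie]
      exact sub_mem (ha _ (hb y hy)) (hb _ (ha y hy))
  refine Submodule.eq_top_iff'.2 fun x => ?_
  have hx : x ∈ LieSubalgebra.lieSpan k Q (Set.range e ∪ Set.range f) := hgen ▸ trivial
  induction hx using LieSubalgebra.lieSpan_induction with
  | mem x hx =>
    rcases hx with ⟨i, rfl⟩ | ⟨i, rfl⟩
    · exact Submodule.mem_sup_left (Submodule.mem_sup_left (heP i))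
    · exact Submodule.mem_sup_left (Submodule.mem_sup_right (hfN i))
  | zero => exact zero_mem _
  | add a b _ _ ha hb => exact add_mem ha hb
  | smul c a _ ha => exact Submodule.smul_mem _ c ha
  | lie a b _ _ _ hb => exact lie_mem a b hb

end Triangular

/-! ### The largest admissible ideal as a kernel. -/

section Contragredient

open CartanMatrix (Generators)

variable {B : Type*} [DecidableEq B] {C : Matrix B B ℤ}

local notation "FL" => FreeLieAlgebra k (Generators B)

/-- The universal property gives a map into the subalgebra whose composite with the inclusion is the
identity. -/
theorem FreeLieAlgebra_lieSpan {X : Type*} :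
    LieSubalgebra.lieSpan k (FreeLieAlgebra k X) (Set.range (FreeLieAlgebra.of k)) = ⊤ := by
  set N := LieSubalgebra.lieSpan k (FreeLieAlgebra k X) (Set.range (FreeLieAlgebra.of k))
  have e : N.incl.comp (FreeLieAlgebra.lift k fun x =>
      (⟨FreeLieAlgebra.of k x, LieSubalgebra.subset_lieSpan ⟨x, rfl⟩⟩ : N)) = LieHom.id := by
    ext x
    simp
  refine eq_top_iff.2 fun x _ => ?_
  have := LieHom.congr_fun e x
  rw [LieHom.id_apply] at this
  rw [← this]
  exact Subtype.property _

theorem span_hasDegree (x : FL) : x ∈ Submodule.span k {x : FL | ∃ d, HasDegree k d x} := by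
  have hx : x ∈ LieSubalgebra.lieSpan k FL (Set.range (FreeLieAlgebra.of k)) := by
    rw [FreeLieAlgebra_lieSpan]; trivial
  induction hx using LieSubalgebra.lieSpan_induction with
  | mem x hx =>
    obtain ⟨i | i | i, rfl⟩ := hx
    · exact Submodule.subset_span ⟨_, .H i⟩
    · exact Submodule.subset_span ⟨_, .E i⟩
    · exact Submodule.subset_span ⟨_, .F i⟩
  | zero => exact zero_mem _
  | add a b _ _ ha hb => exact add_mem ha hb
  | smul c a _ ha => exact Submodule.smul_mem _ c ha
  | lie a b _ _ ha hb =>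
    refine lie_mem_span_right ?_ ha
    rintro a ⟨d, hd⟩
    rw [← lie_skew]
    refine neg_mem (lie_mem_span_right ?_ hb)
    rintro b ⟨d', hd'⟩
    exact Submodule.subset_span ⟨_, hd'.lie hd⟩

/-- The images of the generators under a map of `e`, `f` and `h`. -/
def genMap {Q : Type*} (e f h : B → Q) : Generators B → Q
  | .H i => h i
  | .E i => e i
  | .F i => f i

theorem IsChevalley.map_eq_zero {Q : Type*} [LieRing Q] [LieAlgebra k Q] {e f h : B → Q}
    (H : IsChevalley C e f h) {x : FL} (hx : x ∈ chevalleyRelations k C) :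
    FreeLieAlgebra.lift k (genMap e f h) x = 0 := by
  rcases hx with ((⟨⟨i, j⟩, rfl⟩ | ⟨⟨i, j⟩, rfl⟩) | ⟨⟨i, j⟩, rfl⟩) | ⟨⟨i, j⟩, rfl⟩
  · simp [CartanMatrix.Relations.HH, genMap, H.hh]
  · by_cases hij : i = j <;> simp [CartanMatrix.Relations.EF, genMap, H.ef, hij]
  · simp [CartanMatrix.Relations.HE, genMap, H.he]
  · simp [CartanMatrix.Relations.HF, genMap, H.hf]

variable [Fintype B]

/-- Turns the inductively defined degree into a weight of a torus action, to which the independence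
of characters applies. -/
theorem hasDegree_weight {Q : Type*} [LieRing Q] [LieAlgebra k Q] {e f h : B → Q}
    (ψ : (B → kˣ) → Q →ₗ[k] Q) (hψ : ∀ t x y, ψ t ⁅x, y⁆ = ⁅ψ t x, ψ t y⁆)
    (ψe : ∀ t i, ψ t (e i) = (t i : k) • e i) (ψf : ∀ t i, ψ t (f i) = (t i : k)⁻¹ • f i)
    (ψh : ∀ t i, ψ t (h i) = h i) {d : B → ℤ} {x : FL} (hx : HasDegree k d x) :
    FreeLieAlgebra.lift k (genMap e f h) x ∈ weight ψ d := by
  induction hx with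
  | H i =>
    intro t
    rw [FreeLieAlgebra.lift_of_apply, character_zero, one_smul]
    exact ψh t i
  | E i =>
    intro t
    rw [FreeLieAlgebra.lift_of_apply, character_single]
    exact ψe t i
  | F i =>
    intro t
    rw [FreeLieAlgebra.lift_of_apply, character_neg, character_single]
    exact ψf t i
  | zero d => rw [map_zero]; exact zero_mem _
  | add _ _ hx hy => rw [map_add]; exact add_mem hx hy
  | smul c _ hx => rw [map_smul]; exact Submodule.smul_mem _ c hx
  | lie _ _ hx hy =>
    intro t
    rw [LieHom.map_lie, hψ, hx t, hy t, smul_lie, lie_smul, smul_smul, character_add]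

omit [DecidableEq B] in
theorem lieSpan_weight {Q : Type*} [LieRing Q] [LieAlgebra k Q]
    (ψ : (B → kˣ) → Q →ₗ[k] Q) (hψ : ∀ t x y, ψ t ⁅x, y⁆ = ⁅ψ t x, ψ t y⁆) {D : Set (B → ℤ)}
    (hD : ∀ d ∈ D, ∀ d' ∈ D, d + d' ∈ D) {e : B → Q} (he : ∀ i, ∃ d ∈ D, e i ∈ weight ψ d) {x : Q}
    (hx : x ∈ LieSubalgebra.lieSpan k Q (Set.range e)) :
    x ∈ Submodule.span k {x | ∃ d, d ∈ D ∧ x ∈ weight ψ d} := by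
  induction hx using LieSubalgebra.lieSpan_induction with
  | mem x hx =>
    obtain ⟨i, rfl⟩ := hx
    exact Submodule.subset_span (he i)
  | zero => exact zero_mem _
  | add a b _ _ ha hb => exact add_mem ha hb
  | smul c a _ ha => exact Submodule.smul_mem _ c ha
  | lie a b _ _ ha hb =>
    refine lie_mem_span_right ?_ ha
    rintro a ⟨d, hd, ha⟩
    rw [← lie_skew]
    refine neg_mem (lie_mem_span_right ?_ hb)
    rintro b ⟨d', hd', hb⟩
    refine Submodule.subset_span ⟨d' + d, hD _ hd' _ hd, fun t => ?_⟩
    rw [hψ, ha t, hb t, smul_lie, lie_smul, smul_smul, character_add]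

/-- Vectors of weight zero in a Lie algebra generated by Chevalley generators. -/
theorem IsChevalley.mem_span_of_weight_zero [Infinite k] {Q : Type*} [LieRing Q] [LieAlgebra k Q]
    {e f h : B → Q} (H : IsChevalley C e f h)
    (hgen : LieSubalgebra.lieSpan k Q (Set.range e ∪ Set.range f) = ⊤)
    (ψ : (B → kˣ) → Q →ₗ[k] Q) (hψ : ∀ t x y, ψ t ⁅x, y⁆ = ⁅ψ t x, ψ t y⁆)
    (ψe : ∀ t i, ψ t (e i) = (t i : k) • e i) (ψf : ∀ t i, ψ t (f i) = (t i : k)⁻¹ • f i)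
    (ψh : ∀ t i, ψ t (h i) = h i) {x : Q} (hx : x ∈ weight ψ 0) :
    x ∈ Submodule.span k (Set.range h) := by
  have hx' : x ∈ (⊤ : Submodule k Q) := trivial
  rw [← H.sup_eq_top hgen] at hx'
  obtain ⟨w, hw, z, hz, rfl⟩ := Submodule.mem_sup.1 hx'
  obtain ⟨p, hp, n, hn, rfl⟩ := Submodule.mem_sup.1 hw
  have hz0 : z ∈ weight ψ 0 := by
    refine Submodule.span_le.2 ?_ hz
    rintro _ ⟨i, rfl⟩ t
    rw [character_zero, one_smul, ψh]
  have sum_single : ∀ i : B, ∑ j, (Pi.single i 1 : B → ℤ) j = 1 := fun i => by simp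
  -- Heights, that is sums of coordinates, are positive for the `e`-part and negative for the
  -- `f`-part. So `p + n` is a sum of vectors of nonzero weights; having weight zero itself, it
  -- vanishes.
  have hp' := lieSpan_weight ψ hψ (D := {d | 0 < ∑ i, d i})
    (fun d hd d' hd' => by
      simp only [Set.mem_ofPred_eq, Pi.add_apply, Finset.sum_add_distrib] at *; omega)
    (fun i => ⟨Pi.single i 1, by simp only [Set.mem_ofPred_eq, sum_single]; omega, fun t => by
      rw [character_single, ψe]⟩) hp
  have hn' := lieSpan_weight ψ hψ (D := {d | ∑ i, d i < 0})
    (fun d hd d' hd' => by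
      simp only [Set.mem_ofPred_eq, Pi.add_apply, Finset.sum_add_distrib] at *; omega)
    (fun i => ⟨-Pi.single i 1, by
      simp only [Set.mem_ofPred_eq, Pi.neg_apply, Finset.sum_neg_distrib, sum_single]; omega,
      fun t => by rw [character_neg, character_single, ψf]⟩) hn
  -- The alternative `x = 0` makes the predicate true of zero in every degree, including degree
  -- zero, as the regrouping requires.
  have hpn : p + n ∈ Submodule.span k {x | ∃ d, d ≠ 0 ∧ x ∈ weight ψ d ∨ x = 0} := by
    refine add_mem (Submodule.span_mono ?_ hp') (Submodule.span_mono ?_ hn')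
    · rintro x ⟨d, hd, hx⟩
      refine ⟨d, Or.inl ⟨?_, hx⟩⟩
      rintro rfl
      simp at hd
    · rintro x ⟨d, hd, hx⟩
      refine ⟨d, Or.inl ⟨?_, hx⟩⟩
      rintro rfl
      simp at hd
  obtain ⟨g, hg, hs⟩ := exists_finsupp_of_mem_span (k := k)
    (P := fun d x => d ≠ 0 ∧ x ∈ weight ψ d ∨ x = 0) (fun _ => Or.inr rfl)
    (by
      rintro d x y (⟨hd, hx⟩ | rfl) (⟨hd, hy⟩ | rfl)
      · exact Or.inl ⟨hd, add_mem hx hy⟩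
      · rw [add_zero]; exact Or.inl ⟨hd, hx⟩
      · rw [zero_add]; exact Or.inl ⟨‹_›, ‹_›⟩
      · rw [zero_add]; exact Or.inr rfl)
    (by
      rintro d c x (⟨hd, hx⟩ | rfl)
      · exact Or.inl ⟨hd, Submodule.smul_mem _ c hx⟩
      · exact Or.inr (smul_zero c)) hpn
  have hpn0 : p + n ∈ weight ψ 0 := by
    have := sub_mem hx hz0
    rwa [add_sub_cancel_right] at this
  have := eq_of_sum_mem_weight_zero ψ g (fun d => ?_) hpn0 hs
  · have g0 : g 0 = 0 := (hg 0).resolve_left fun h => h.1 rfl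
    rw [← this, g0, zero_add]
    exact hz
  · rcases hg d with h | h
    · exact h.2
    · rw [h]; exact zero_mem _

/-- The ideal generated by the relations. -/
def relIdeal (k : Type*) [Field k] {B : Type*} [DecidableEq B] (C : Matrix B B ℤ) :
    LieIdeal k (FreeLieAlgebra k (Generators B)) :=
  LieSubmodule.lieSpan k _ (chevalleyRelations k C)

/-- The action of the torus on the free Lie algebra. -/
def torusFree (t : B → kˣ) : FL →ₗ⁅k⁆ FL :=
  FreeLieAlgebra.lift k (genMap (fun i => (t i : k) • FreeLieAlgebra.of k (.E i))
    (fun i => (t i : k)⁻¹ • FreeLieAlgebra.of k (.F i)) fun i => FreeLieAlgebra.of k (.H i))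

omit [Fintype B] in
theorem isChevalley_quotient (I : LieIdeal k FL) (hI : chevalleyRelations k C ⊆ I) :
    IsChevalley C (fun i => (LieSubmodule.Quotient.mk (FreeLieAlgebra.of k (.E i)) : FL ⧸ I))
      (fun i => LieSubmodule.Quotient.mk (FreeLieAlgebra.of k (.F i)))
      fun i => LieSubmodule.Quotient.mk (FreeLieAlgebra.of k (.H i)) := by
  have z : ∀ x ∈ chevalleyRelations k C, (LieSubmodule.Quotient.mk x : FL ⧸ I) = 0 :=
    fun x hx => LieSubmodule.Quotient.mk_eq_zero'.2 (hI hx)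
  constructor
  · intro i j
    exact z _ (Or.inl (Or.inl (Or.inl ⟨(i, j), rfl⟩)))
  · intro i j
    have := z _ (Or.inl (Or.inl (Or.inr ⟨(i, j), rfl⟩)))
    simp only [CartanMatrix.Relations.EF, Function.uncurry_apply_pair, Function.comp_apply] at this
    rw [← LieSubmodule.Quotient.mk_bracket]
    split_ifs at this ⊢ with hij
    · subst hij
      exact sub_eq_zero.1 this
    · exact this
  · intro i j
    have := z _ (Or.inl (Or.inr ⟨(i, j), rfl⟩))
    exact sub_eq_zero.1 this
  · intro i j
    have := z _ (Or.inr ⟨(i, j), rfl⟩)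
    exact eq_neg_of_add_eq_zero_left this

-- Every defining relation is an eigenvector of the torus, so the ideal generated by the relations
-- is stable.
omit [Fintype B] in
theorem torusFree_mem (t : B → kˣ) {x : FL} (hx : x ∈ relIdeal k C) :
    torusFree t x ∈ relIdeal k C := by
  suffices relIdeal k C ≤ LieIdeal.comap (torusFree t) (relIdeal k C) from
    LieIdeal.mem_comap.1 (this hx)
  refine LieSubmodule.lieSpan_le.2 fun x hx => LieIdeal.mem_comap.2 ?_
  have tt : ∀ i, ((t i : k)⁻¹ * (t i : k)) = 1 := fun i => inv_mul_cancel₀ (Units.ne_zero _)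
  have mem : ∀ y ∈ chevalleyRelations k C, y ∈ relIdeal k C :=
    fun y hy => LieSubmodule.subset_lieSpan hy
  rcases hx with ((⟨⟨i, j⟩, rfl⟩ | ⟨⟨i, j⟩, rfl⟩) | ⟨⟨i, j⟩, rfl⟩) | ⟨⟨i, j⟩, rfl⟩
  · refine mem _ (Or.inl (Or.inl (Or.inl ⟨(i, j), ?_⟩)))
    simp [CartanMatrix.Relations.HH, torusFree, genMap]
  · have := mem _ (Or.inl (Or.inl (Or.inr ⟨(i, j), rfl⟩)))
    have e : torusFree t (CartanMatrix.Relations.EF k (i, j)) =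
        ((t j : k)⁻¹ * (t i : k)) • CartanMatrix.Relations.EF k (i, j) := by
      by_cases h : i = j
      · subst h
        simp [CartanMatrix.Relations.EF, torusFree, genMap, smul_smul]
      · simp [CartanMatrix.Relations.EF, torusFree, genMap, h, smul_smul]
    rw [e]
    exact Submodule.smul_mem _ _ this
  · have := mem _ (Or.inl (Or.inr ⟨(i, j), rfl⟩))
    have e : torusFree t (CartanMatrix.Relations.HE k C (i, j)) =
        (t j : k) • CartanMatrix.Relations.HE k C (i, j) := by
      simp [CartanMatrix.Relations.HE, torusFree, genMap, smul_sub]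
      exact smul_comm _ _ _
    rw [e]
    exact Submodule.smul_mem _ _ this
  · have := mem _ (Or.inr ⟨(i, j), rfl⟩)
    have e : torusFree t (CartanMatrix.Relations.HF k C (i, j)) =
        (t j : k)⁻¹ • CartanMatrix.Relations.HF k C (i, j) := by
      simp [CartanMatrix.Relations.HF, torusFree, genMap, smul_add]
      exact smul_comm _ _ _
    rw [e]
    exact Submodule.smul_mem _ _ this

omit [Fintype B] in
theorem lieSpan_quotient (I : LieIdeal k FL) (hI : chevalleyRelations k C ⊆ I) :
    LieSubalgebra.lieSpan k (FL ⧸ I)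
      (Set.range (fun i => (LieSubmodule.Quotient.mk (FreeLieAlgebra.of k (.E i)) : FL ⧸ I)) ∪
      Set.range fun i => LieSubmodule.Quotient.mk (FreeLieAlgebra.of k (.F i))) = ⊤ := by
  set N := LieSubalgebra.lieSpan k (FL ⧸ I)
      (Set.range (fun i => (LieSubmodule.Quotient.mk (FreeLieAlgebra.of k (.E i)) : FL ⧸ I)) ∪
      Set.range fun i => LieSubmodule.Quotient.mk (FreeLieAlgebra.of k (.F i))) with hN
  have hE : ∀ i, LieSubmodule.Quotient.mk (FreeLieAlgebra.of k (.E i)) ∈ N :=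
    fun i => LieSubalgebra.subset_lieSpan (Or.inl ⟨i, rfl⟩)
  have hF : ∀ i, LieSubmodule.Quotient.mk (FreeLieAlgebra.of k (.F i)) ∈ N :=
    fun i => LieSubalgebra.subset_lieSpan (Or.inr ⟨i, rfl⟩)
  refine eq_top_iff.2 fun x _ => ?_
  obtain ⟨x, rfl⟩ := LieSubmodule.Quotient.surjective_mk' I x
  change LieSubmodule.Quotient.mk x ∈ N
  have hx : x ∈ LieSubalgebra.lieSpan k FL (Set.range (FreeLieAlgebra.of k)) := by
    rw [FreeLieAlgebra_lieSpan]; trivial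
  induction hx using LieSubalgebra.lieSpan_induction with
  | mem x hx =>
    obtain ⟨i | i | i, rfl⟩ := hx
    · have := (isChevalley_quotient I hI).ef i i
      rw [if_pos rfl] at this
      rw [← this]
      exact N.lie_mem (hE i) (hF i)
    · exact hE i
    · exact hF i
  | zero => exact zero_mem _
  | add a b _ _ ha hb => exact add_mem (ha trivial) (hb trivial)
  | smul c a _ ha => exact SMulMemClass.smul_mem c (ha trivial)
  | lie a b _ _ ha hb => exact N.lie_mem (ha trivial) (hb trivial)

/-- An element of degree zero is a combination of the `Hᵢ` modulo the relations. -/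
theorem exists_sub_mem_relIdeal [Infinite k] {x : FL} (hx : HasDegree k 0 x) :
    ∃ y ∈ Submodule.span k (Set.range fun i : B => FreeLieAlgebra.of k (Generators.H i)),
      x - y ∈ relIdeal k C := by
  let R := relIdeal k C
  have hR : chevalleyRelations k C ⊆ R := LieSubmodule.subset_lieSpan
  let ψ : (B → kˣ) → (FL ⧸ R) →ₗ[k] (FL ⧸ R) := fun t =>
    R.toSubmodule.mapQ R.toSubmodule (torusFree t : FL →ₗ[k] FL) fun x hx => torusFree_mem t hx
  have ψmk : ∀ t x, ψ t (LieSubmodule.Quotient.mk x) = LieSubmodule.Quotient.mk (torusFree t x) :=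
    fun t x => rfl
  have ψlie : ∀ t x y, ψ t ⁅x, y⁆ = ⁅ψ t x, ψ t y⁆ := by
    intro t x y
    obtain ⟨x, rfl⟩ := LieSubmodule.Quotient.surjective_mk' R x
    obtain ⟨y, rfl⟩ := LieSubmodule.Quotient.surjective_mk' R y
    change ψ t ⁅LieSubmodule.Quotient.mk x, LieSubmodule.Quotient.mk y⁆ =
      ⁅ψ t (LieSubmodule.Quotient.mk x), ψ t (LieSubmodule.Quotient.mk y)⁆
    rw [← LieSubmodule.Quotient.mk_bracket, ψmk, ψmk, ψmk, LieHom.map_lie,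
      LieSubmodule.Quotient.mk_bracket]
  have H := isChevalley_quotient R hR
  have ψe : ∀ t i, ψ t (LieSubmodule.Quotient.mk (FreeLieAlgebra.of k (.E i))) =
      (t i : k) • LieSubmodule.Quotient.mk (FreeLieAlgebra.of k (.E i)) := fun t i => by
    rw [ψmk, torusFree, FreeLieAlgebra.lift_of_apply]; rfl
  have ψf : ∀ t i, ψ t (LieSubmodule.Quotient.mk (FreeLieAlgebra.of k (.F i))) =
      (t i : k)⁻¹ • LieSubmodule.Quotient.mk (FreeLieAlgebra.of k (.F i)) := fun t i => by
    rw [ψmk, torusFree, FreeLieAlgebra.lift_of_apply]; rfl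
  have ψh : ∀ t i, ψ t (LieSubmodule.Quotient.mk (FreeLieAlgebra.of k (.H i))) =
      LieSubmodule.Quotient.mk (FreeLieAlgebra.of k (.H i)) := fun t i => by
    rw [ψmk, torusFree, FreeLieAlgebra.lift_of_apply]; rfl
  have hmk : FreeLieAlgebra.lift k (genMap
      (fun i : B => (LieSubmodule.Quotient.mk (FreeLieAlgebra.of k (.E i)) : FL ⧸ R))
      (fun i => LieSubmodule.Quotient.mk (FreeLieAlgebra.of k (.F i)))
      (fun i => LieSubmodule.Quotient.mk (FreeLieAlgebra.of k (.H i)))) x =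
      LieSubmodule.Quotient.mk x := by
    have hx : x ∈ LieSubalgebra.lieSpan k FL (Set.range (FreeLieAlgebra.of k)) := by
      rw [FreeLieAlgebra_lieSpan]; trivial
    clear * - hx
    induction hx using LieSubalgebra.lieSpan_induction with
    | mem x hx =>
      obtain ⟨i | i | i, rfl⟩ := hx <;> rw [FreeLieAlgebra.lift_of_apply] <;> rfl
    | zero => rw [map_zero]; rfl
    | add a b _ _ ha hb => rw [map_add, ha, hb]; rfl
    | smul c a _ ha => rw [map_smul, ha]; rfl
    | lie a b _ _ ha hb => rw [LieHom.map_lie, ha, hb]; rfl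
  have hw := hasDegree_weight ψ ψlie ψe ψf ψh hx
  rw [hmk] at hw
  have := H.mem_span_of_weight_zero (lieSpan_quotient R hR) ψ ψlie ψe ψf ψh hw
  obtain ⟨y, hy, hxy⟩ : ∃ y ∈ Submodule.span k (Set.range fun i : B => FreeLieAlgebra.of k
      (Generators.H i)), (LieSubmodule.Quotient.mk y : FL ⧸ R) = LieSubmodule.Quotient.mk x := by
    have e : (Set.range fun i => (LieSubmodule.Quotient.mk (FreeLieAlgebra.of k (.H i)) : FL ⧸ R)) =
        (R.toSubmodule.mkQ : FL → FL ⧸ R) '' (Set.range fun i : B => FreeLieAlgebra.of k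
          (Generators.H i)) := by
      rw [← Set.range_comp]; rfl
    rw [e] at this
    have := (Submodule.map_span R.toSubmodule.mkQ _).symm.le this
    exact this
  refine ⟨y, hy, LieSubmodule.Quotient.mk_eq_zero'.1 ?_⟩
  change (LieSubmodule.Quotient.mk x : FL ⧸ R) - LieSubmodule.Quotient.mk y = 0
  rw [hxy, sub_self]

/-- An admissible ideal has image zero or everything. In the second case some element of it maps to
`h j`, and so does its component of degree zero, which lies in the ideal by homogeneity. Modulo
relations that component is a combination of the `Hᵢ` in the ideal, hence zero, so `h j = 0`, which
is false. The kernel itself is admissible. -/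
theorem sSup_admissibleIdeals_eq_ker [Infinite k] [Nonempty B] {L : Type*} [LieRing L] [LieAlgebra k L]
    {e f h : B → L} (H : IsChevalley C e f h) (hC : (C.map (Int.cast : ℤ → k)).det ≠ 0)
    (he : ∀ i, e i ≠ 0)
    (hgen : Function.Surjective (FreeLieAlgebra.lift k (genMap e f h)))
    (hsimple : ∀ I : LieIdeal k L, I = ⊥ ∨ I = ⊤)
    (ψ : (B → kˣ) → L →ₗ[k] L) (hψ : ∀ t x y, ψ t ⁅x, y⁆ = ⁅ψ t x, ψ t y⁆)
    (ψe : ∀ t i, ψ t (e i) = (t i : k) • e i) (ψf : ∀ t i, ψ t (f i) = (t i : k)⁻¹ • f i) :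
    sSup (admissibleIdeals k C) = (FreeLieAlgebra.lift k (genMap e f h)).ker := by
  set φ := FreeLieAlgebra.lift k (genMap e f h) with hφ
  have ψh : ∀ t i, ψ t (h i) = h i := fun t i => by
    have := H.ef i i
    rw [if_pos rfl] at this
    rw [← this, hψ, ψe, ψf, smul_lie, lie_smul, smul_smul, mul_inv_cancel₀ (Units.ne_zero _),
      one_smul]
  have hdeg : ∀ {d x}, HasDegree k d x → φ x ∈ weight ψ d := hasDegree_weight ψ hψ ψe ψf ψh
  have hrel : chevalleyRelations k C ⊆ φ.ker := fun x hx => LieHom.mem_ker.2 (H.map_eq_zero hx)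
  -- Bracketing a relation among the `h i` with the nonzero `e j` gives a row vector killed by the
  -- invertible matrix `C`.
  have hli : LinearIndependent k h := by
    rw [Fintype.linearIndependent_iff]
    intro c hc
    have : Matrix.vecMul c (C.map (Int.cast : ℤ → k)) = 0 := by
      funext j
      have e' : (∑ i, c i * (C i j : k)) • e j = 0 := by
        rw [Finset.sum_smul]
        have := congrArg (fun y => ⁅y, e j⁆) hc
        rw [zero_lie, sum_lie] at this
        rw [← this]
        refine Finset.sum_congr rfl fun i _ => ?_
        rw [smul_lie, H.he, mul_smul, Int.cast_smul_eq_zsmul]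
      exact (smul_eq_zero.1 e').resolve_right (he j)
    exact fun i => congrFun (Matrix.eq_zero_of_vecMul_eq_zero hC this) i
  have hne : ∀ i, h i ≠ 0 := fun i => hli.ne_zero i
  refine le_antisymm (sSup_le fun I hI => ?_) (le_sSup ⟨hrel, fun x hx => ?_, fun x hx hx' => ?_⟩)
  · obtain ⟨hI1, hI2, hI3⟩ := hI
    rcases hsimple (LieIdeal.map φ I) with hb | ht
    · exact (LieIdeal.map_eq_bot_iff).1 hb
    · exfalso
      obtain ⟨j⟩ := ‹Nonempty B›
      have hj : h j ∈ LieIdeal.map φ I := ht ▸ trivial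
      obtain ⟨⟨x, hx⟩, hxj⟩ := LieIdeal.mem_map_of_surjective hgen hj
      have hxj : φ x = h j := hxj
      obtain ⟨g, hg, hs⟩ := exists_finsupp_of_mem_span (k := k)
        (P := fun d y => y ∈ I ∧ HasDegree k d y) (fun d => ⟨zero_mem _, .zero d⟩)
        (fun d x y hx hy => ⟨add_mem hx.1 hy.1, hx.2.add hy.2⟩)
        (fun d c x hx => ⟨I.toSubmodule.smul_mem c hx.1, hx.2.smul c⟩)
        (Submodule.span_mono (by rintro y ⟨hy, d, hd⟩; exact ⟨d, hy, hd⟩) (hI2 x hx))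
      have h0 := eq_of_sum_mem_weight_zero ψ (g.mapRange φ φ.map_zero) (fun d => hdeg (hg d).2)
        (y := h j) (fun t => by rw [ψh, character_zero, one_smul]) (by
          rw [← hxj, ← hs]
          change (g.mapRange φ φ.map_zero).sum (fun _ y => y) = φ (g.sum fun _ y => y)
          rw [Finsupp.sum_mapRange_index fun _ => rfl]
          exact (map_finsuppSum (φ : FL →ₗ[k] L) g _).symm)
      obtain ⟨y, hy, hxy⟩ := exists_sub_mem_relIdeal (C := C) (hg 0).2
      have relI : relIdeal k C ≤ I := LieSubmodule.lieSpan_le.2 hI1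
      have relK : relIdeal k C ≤ φ.ker := LieSubmodule.lieSpan_le.2 hrel
      have hyI : y ∈ I := by
        have := sub_mem (hg 0).1 (relI hxy)
        rwa [sub_sub_cancel] at this
      have hy0 := hI3 y hyI hy
      rw [hy0, sub_zero] at hxy
      refine hne j ?_
      rw [← h0]
      exact LieHom.mem_ker.1 (relK hxy)
  -- Homogeneity of the kernel: the images of the components of `x` have different weights and sum
  -- to zero, so each of them is zero.
  · obtain ⟨g, hg, rfl⟩ := exists_finsupp_of_mem_span (k := k)
      (P := fun d y => HasDegree k d y) (fun d => .zero d)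
      (fun d x y hx hy => hx.add hy) (fun d c x hx => hx.smul c) (span_hasDegree x)
    have h0 := weight_independent ψ (g.mapRange φ φ.map_zero) (fun d => hdeg (hg d)) (by
      rw [← LieHom.mem_ker.1 hx]
      change (g.mapRange φ φ.map_zero).sum (fun _ y => y) = φ (g.sum fun _ y => y)
      rw [Finsupp.sum_mapRange_index fun _ => rfl]
      exact (map_finsuppSum (φ : FL →ₗ[k] L) g _).symm)
    refine sum_mem fun d _ => Submodule.subset_span ⟨?_, d, hg d⟩
    exact LieHom.mem_ker.2 (DFunLike.congr_fun h0 d)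
  · obtain ⟨c, rfl⟩ := (Submodule.mem_span_range_iff_exists_fun k).1 hx'
    have := LieHom.mem_ker.1 hx
    have hφH : ∀ i, φ (FreeLieAlgebra.of k (.H i)) = h i :=
      fun i => FreeLieAlgebra.lift_of_apply _ _
    have hc : ∑ i, c i • h i = 0 := by
      rw [← this, ← LieHom.coe_toLinearMap, map_sum]
      exact Finset.sum_congr rfl fun i _ => by
        rw [map_smul, LieHom.coe_toLinearMap, hφH]
    exact Finset.sum_eq_zero fun i _ => by
      rw [Fintype.linearIndependent_iff.1 hli c hc i, zero_smul]

/-- A simple Lie algebra with Chevalley generators and an action of the torus is contragredient. -/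
theorem isoLie_contragredient [Infinite k] [Nonempty B] {A : Type*} [AddCommGroup A] [Module k A]
    {μ : A →ₗ[k] A →ₗ[k] A} (hμ : IsLieProduct μ) {e f h : B → A}
    (hh : ∀ i j, μ (h i) (h j) = 0) (ef : ∀ i j, μ (e i) (f j) = if i = j then h i else 0)
    (hhe : ∀ i j, μ (h i) (e j) = (C i j : k) • e j)
    (hhf : ∀ i j, μ (h i) (f j) = -((C i j : k) • f j))
    (hC : (C.map (Int.cast : ℤ → k)).det ≠ 0) (he : ∀ i, e i ≠ 0)
    (hgen : ∀ N : Submodule k A, (∀ i, e i ∈ N) → (∀ i, f i ∈ N) →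
      (∀ x ∈ N, ∀ y ∈ N, μ x y ∈ N) → N = ⊤)
    (hsimple : ∀ I : Submodule k A, (∀ x, ∀ y ∈ I, μ x y ∈ I) → I = ⊥ ∨ I = ⊤)
    (hne : μ ≠ 0)
    (torus : ∀ t : B → kˣ, ∃ ψ : A →ₗ[k] A, (∀ x y, ψ (μ x y) = μ (ψ x) (ψ y)) ∧
      (∀ i, ψ (e i) = (t i : k) • e i) ∧ ∀ i, ψ (f i) = (t i : k)⁻¹ • f i) :
    IsoLie μ (Contragredient k C) ∧ LieAlgebra.IsSimple k (Contragredient k C) := by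
  have skew : ∀ x y, μ x y = -μ y x := fun x y => by
    have := hμ.self_eq_zero (x + y)
    rw [map_add, map_add, LinearMap.add_apply, LinearMap.add_apply, hμ.self_eq_zero,
      hμ.self_eq_zero, zero_add, add_zero] at this
    exact eq_neg_of_add_eq_zero_right this
  let _ : LieRing A :=
    { bracket := fun x y => μ x y
      add_lie := fun x y z => by change μ (x + y) z = μ x z + μ y z; rw [map_add]; rfl
      lie_add := fun x y z => map_add (μ x) y z
      lie_self := hμ.self_eq_zero
      leibniz_lie := fun x y z => by
        change μ x (μ y z) = μ (μ x y) z + μ y (μ x z)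
        have := hμ.jacobi x y z
        rw [skew x (μ y z), skew y (μ x z), skew x z, map_neg,
          LinearMap.neg_apply, neg_neg]
        exact neg_eq_of_add_eq_zero_right (by rw [← this]; abel) }
  let _ : LieAlgebra k A := { lie_smul := fun c x y => map_smul (μ x) c y }
  have br : ∀ x y : A, ⁅x, y⁆ = μ x y := fun _ _ => rfl
  have H : IsChevalley C e f h :=
    ⟨hh, ef, fun i j => by rw [br, hhe, Int.cast_smul_eq_zsmul],
      fun i j => by rw [br, hhf, Int.cast_smul_eq_zsmul]⟩
  set φ := FreeLieAlgebra.lift k (genMap e f h) with hφ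
  have hsurj : Function.Surjective φ := by
    have : LinearMap.range (φ : FL →ₗ[k] A) = ⊤ := by
      refine hgen _ (fun i => ⟨FreeLieAlgebra.of k (.E i), ?_⟩)
        (fun i => ⟨FreeLieAlgebra.of k (.F i), ?_⟩) ?_
      · exact FreeLieAlgebra.lift_of_apply _ _
      · exact FreeLieAlgebra.lift_of_apply _ _
      · rintro _ ⟨x, rfl⟩ _ ⟨y, rfl⟩
        exact ⟨⁅x, y⁆, LieHom.map_lie φ x y⟩
    exact LinearMap.range_eq_top.1 this
  choose ψ hψ ψe ψf using torus
  have hK := sSup_admissibleIdeals_eq_ker H hC he hsurj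
    (fun I => by
      rcases hsimple I.toSubmodule (fun x y hy => I.lie_mem hy) with h | h
      · exact Or.inl ((LieSubmodule.toSubmodule_eq_bot I).1 h)
      · exact Or.inr ((LieSubmodule.toSubmodule_eq_top _).1 h)) ψ hψ ψe ψf
  let K := sSup (admissibleIdeals k C)
  have hKmem : ∀ x, x ∈ K ↔ φ x = 0 := fun x => by
    rw [show K = φ.ker from hK, LieHom.mem_ker]
  let E : Contragredient k C →ₗ[k] A := K.toSubmodule.liftQ (φ : FL →ₗ[k] A) fun x hx =>
    (hKmem x).1 hx
  have Emk : ∀ x, E (LieSubmodule.Quotient.mk x) = φ x := fun x => rfl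
  have Elie : ∀ x y, E ⁅x, y⁆ = μ (E x) (E y) := fun x y => by
    obtain ⟨x, rfl⟩ := LieSubmodule.Quotient.surjective_mk' K x
    obtain ⟨y, rfl⟩ := LieSubmodule.Quotient.surjective_mk' K y
    change E ⁅LieSubmodule.Quotient.mk x, LieSubmodule.Quotient.mk y⁆ =
      μ (E (LieSubmodule.Quotient.mk x)) (E (LieSubmodule.Quotient.mk y))
    rw [← LieSubmodule.Quotient.mk_bracket, Emk, Emk, Emk, LieHom.map_lie, br]
  have Einj : Function.Injective E := by
    rw [← LinearMap.ker_eq_bot, Submodule.eq_bot_iff]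
    intro x hx
    obtain ⟨x, rfl⟩ := LieSubmodule.Quotient.surjective_mk' K x
    exact LieSubmodule.Quotient.mk_eq_zero'.2 ((hKmem x).2 hx)
  have Esurj : Function.Surjective E := fun y => by
    obtain ⟨x, rfl⟩ := hsurj y
    exact ⟨LieSubmodule.Quotient.mk x, rfl⟩
  let e' := LinearEquiv.ofBijective E ⟨Einj, Esurj⟩
  have e'apply : ∀ x, e' x = E x := fun x => rfl
  refine ⟨⟨e'.symm, fun x y => ?_⟩, ⟨fun I => ?_, fun hab => hne ?_⟩⟩
  · rw [LinearEquiv.symm_apply_eq, e'apply, Elie, ← e'apply, ← e'apply,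
      LinearEquiv.apply_symm_apply, LinearEquiv.apply_symm_apply]
  · have := hsimple (I.toSubmodule.map E) (by
      rintro x _ ⟨y, hy, rfl⟩
      obtain ⟨x, rfl⟩ := Esurj x
      exact ⟨⁅x, y⁆, I.lie_mem hy, Elie x y⟩)
    rcases this with h | h
    · refine Or.inl ((LieSubmodule.toSubmodule_eq_bot I).1
        ((Submodule.eq_bot_iff _).2 fun x hx => Einj ?_))
      have hx : E x ∈ I.toSubmodule.map E := ⟨x, hx, rfl⟩
      rw [map_zero]
      rwa [h] at hx
    · refine Or.inr ((LieSubmodule.toSubmodule_eq_top _).1 (Submodule.eq_top_iff'.2 fun x => ?_))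
      have hx : E x ∈ I.toSubmodule.map E := h ▸ Submodule.mem_top
      obtain ⟨y, hy, hyx⟩ := hx
      rwa [← Einj hyx]
  · ext x y
    obtain ⟨x, rfl⟩ := Esurj x
    obtain ⟨y, rfl⟩ := Esurj y
    rw [← Elie, trivial_lie_zero, map_zero]
    rfl

end Contragredient

/-! ### Automorphisms that respect the decomposition. -/

section SemidirectProduct

variable {L M : Type*} [LieRing L] [LieAlgebra k L] [AddCommGroup M] [Module k M]
  {μ : (L × M) →ₗ[k] (L × M) →ₗ[k] (L × M)} {ρ : L →ₗ[k] Module.End k M} {o : M →ₗ[k] M →ₗ[k] L}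

theorem prodMap_mul
    (hμ : ∀ x y, μ x y = (⁅x.1, y.1⁆ + o x.2 y.2, ρ x.1 y.2 - ρ y.1 x.2)) {α : L →ₗ[k] L}
    {β : M →ₗ[k] M} (hα : ∀ A B, α ⁅A, B⁆ = ⁅α A, α B⁆) (hβ : ∀ A s, β (ρ A s) = ρ (α A) (β s))
    (ho : ∀ s t, α (o s t) = o (β s) (β t)) (x y : L × M) :
    α.prodMap β (μ x y) = μ (α.prodMap β x) (α.prodMap β y) := by
  simp only [hμ, LinearMap.prodMap_apply, map_add, map_sub, hα, hβ, ho]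

end SemidirectProduct

/-! ### The action of diagonal maps on `W`, `so(W,q)` and `S`. -/

section Torus

variable {l : ℕ} (v : Module.Basis (Fin l) k V) (τ : Fin l → kˣ)

/-- The diagonal map of `V` with entries `τ`. -/
def diagV : V →ₗ[k] V := v.constr k fun i => (τ i : k) • v i

theorem diagV_basis (i : Fin l) : diagV v τ (v i) = (τ i : k) • v i := v.constr_basis _ _ _

theorem diagV_inv (x : V) : diagV v τ⁻¹ (diagV v τ x) = x := by
  refine LinearMap.congr_fun (f := diagV v τ⁻¹ ∘ₗ diagV v τ) (g := LinearMap.id)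
    (v.ext fun i => ?_) x
  simp [diagV_basis, smul_smul]

theorem coord_diagV (i : Fin l) (x : V) : v.coord i (diagV v τ x) = τ i * v.coord i x := by
  refine LinearMap.congr_fun (f := v.coord i ∘ₗ diagV v τ) (g := (τ i : k) • v.coord i)
    (v.ext fun j => ?_) x
  rw [LinearMap.comp_apply, diagV_basis, map_smul, LinearMap.smul_apply, smul_eq_mul, smul_eq_mul]
  rcases eq_or_ne i j with rfl | h
  · rfl
  · simp [h.symm]

/-- The isometry of `W` with entries `τ`, `τ⁻¹` and `1`. -/
def diagW : W k V →ₗ[k] W k V :=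
  LinearMap.prodMap (LinearMap.prodMap (diagV v τ⁻¹).dualMap (diagV v τ)) LinearMap.id

theorem diagW_apply (x : W k V) :
    diagW v τ x = ((x.1.1 ∘ₗ diagV v τ⁻¹, diagV v τ x.1.2), x.2) := rfl

theorem diagW_inv (x : W k V) : diagW v τ⁻¹ (diagW v τ x) = x := by
  rw [diagW_apply, diagW_apply]
  refine Prod.ext (Prod.ext (LinearMap.ext fun y => ?_) ?_) rfl
  · change x.1.1 (diagV v τ⁻¹ (diagV v τ⁻¹⁻¹ y)) = _
    rw [inv_inv, diagV_inv]
  · exact diagV_inv v τ _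

theorem diagW_inv' (x : W k V) : diagW v τ (diagW v τ⁻¹ x) = x := by
  have := diagW_inv v τ⁻¹ x
  rwa [inv_inv] at this

theorem pol_diagW (x y : W k V) : pol (diagW v τ x) (diagW v τ y) = pol x y := by
  rw [pol_eq, pol_eq, diagW_apply, diagW_apply]
  simp only [LinearMap.comp_apply, diagV_inv]

theorem pol_diagW_right (x y : W k V) : pol x (diagW v τ y) = pol (diagW v τ⁻¹ x) y := by
  rw [← pol_diagW v τ (diagW v τ⁻¹ x), diagW_inv']

theorem diagW_uW : diagW v τ uW = uW := by
  rw [diagW_apply]; simp [uW]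

theorem diagW_vW (i : Fin l) : diagW v τ (vW v i) = (τ i : k) • vW v i := by
  rw [diagW_apply]; simp [vW, diagV_basis]

theorem diagW_fW (i : Fin l) : diagW v τ (fW v i) = (τ i : k)⁻¹ • fW v i := by
  rw [diagW_apply]
  refine Prod.ext (Prod.ext (LinearMap.ext fun y => ?_) ?_) ?_
  · change v.coord i (diagV v τ⁻¹ y) = (τ i : k)⁻¹ * v.coord i y
    rw [coord_diagV, Pi.inv_apply, Units.val_inv_eq_inv_val]
  · simp [fW]
  · simp [fW]

/-- Conjugation of endomorphisms of `W` by `diagW`. -/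
def conjEnd (A : Module.End k (W k V)) : Module.End k (W k V) := diagW v τ ∘ₗ A ∘ₗ diagW v τ⁻¹

theorem conjEnd_mem (A : so k V) : conjEnd v τ A.1 ∈ so k V := mem_so.2 fun x y => by
  have key : pol (diagW v τ (ap A (diagW v τ⁻¹ x))) y =
      -pol x (diagW v τ (ap A (diagW v τ⁻¹ y))) := by
    rw [pol_comm, pol_diagW_right, pol_comm, pol_ap, pol_diagW_right]
  unfold ap pol at key
  exact key

/-- Conjugation by `diagW`. -/
def conjSoFun (A : so k V) : so k V := ⟨conjEnd v τ A.1, conjEnd_mem v τ A⟩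

theorem conjSoFun_ap (A : so k V) (x : W k V) :
    ap (conjSoFun v τ A) x = diagW v τ (ap A (diagW v τ⁻¹ x)) := by
  unfold ap; rfl

/-- Conjugation by `diagW`, as a linear map. -/
def conjSo : so k V →ₗ[k] so k V where
  toFun := conjSoFun v τ
  map_add' A B := so_ext fun x => by
    simp only [add_ap, conjSoFun_ap, map_add]
  map_smul' c A := so_ext fun x => by
    simp only [RingHom.id_apply, smul_ap, conjSoFun_ap, map_smul]

theorem conjSo_ap (A : so k V) (x : W k V) :
    ap (conjSo v τ A) x = diagW v τ (ap A (diagW v τ⁻¹ x)) := conjSoFun_ap v τ A x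

theorem conjSo_lie (A B : so k V) : conjSo v τ ⁅A, B⁆ = ⁅conjSo v τ A, conjSo v τ B⁆ :=
  so_ext fun x => by simp only [conjSo_ap, lie_ap, map_sub, diagW_inv]

theorem conjSo_sg (a b : W k V) : conjSo v τ (sg a b) = sg (diagW v τ a) (diagW v τ b) :=
  so_ext fun x => by
    rw [conjSo_ap, sg_ap, sg_ap, map_sub, map_smul, map_smul, pol_diagW_right, pol_diagW_right,
      inv_inv]

/-- The automorphism of `⋀V` induced by `diagV`. -/
def diagS : S k V →ₗ[k] S k V := (ExteriorAlgebra.map (diagV v τ)).toLinearMap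

theorem diagS_one : diagS v τ 1 = 1 := map_one (ExteriorAlgebra.map (diagV v τ))

theorem diagS_mul (s t : S k V) : diagS v τ (s * t) = diagS v τ s * diagS v τ t :=
  map_mul (ExteriorAlgebra.map (diagV v τ)) s t

theorem diagS_cr (i : Fin l) (s : S k V) : diagS v τ (cr v i s) = (τ i : k) • cr v i (diagS v τ s) := by
  rw [cr_apply, cr_apply, diagS_mul, ← smul_mul_assoc, ← map_smul, ← diagV_basis]
  congr 1
  exact ExteriorAlgebra.map_apply_ι _ _

theorem diagS_wd (L : List (Fin l)) :
    diagS v τ (wd v L) = (L.map fun i => (τ i : k)).prod • wd v L := by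
  induction L with
  | nil => rw [wd_nil, diagS_one]; simp
  | cons i L ih => rw [wd_cons, diagS_cr, ih, map_smul, smul_smul, List.map_cons, List.prod_cons]

theorem diagS_an (i : Fin l) (s : S k V) :
    diagS v τ (an v i s) = (τ i : k)⁻¹ • an v i (diagS v τ s) := by
  induction s using wd_induction v with
  | h0 => simp only [map_zero, smul_zero]
  | hadd s t hs ht => simp only [map_add, smul_add, hs, ht]
  | hsmul c s hs => simp only [map_smul, hs]; rw [smul_comm]
  | hwd L hL =>
    clear hL
    induction L with
    | nil => rw [wd_nil, an_one, diagS_one, an_one, map_zero, smul_zero]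
    | cons j L ih =>
      rw [wd_cons, an_cr, map_sub, diagS_cr, diagS_cr, map_smul, an_cr, ih, map_smul]
      split_ifs with h
      · subst h
        rw [smul_sub, smul_sub, inv_smul_smul₀ (Units.ne_zero _), smul_smul, smul_smul, mul_comm]
      · rw [map_zero, zero_sub, zero_sub, smul_neg, smul_neg, smul_comm]

theorem diagS_fock (x : W k V) (s : S k V) :
    diagS v τ (fock x.1 s) = fock (diagW v τ x).1 (diagS v τ s) := by
  rw [fock_expand v, fock_expand v, LinearMap.sum_apply, LinearMap.sum_apply, map_sum]
  refine Finset.sum_congr rfl fun i _ => ?_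
  rw [LinearMap.add_apply, LinearMap.add_apply, LinearMap.smul_apply, LinearMap.smul_apply,
    LinearMap.smul_apply, LinearMap.smul_apply, map_add, map_smul, map_smul, diagS_an, diagS_cr,
    smul_smul, smul_smul]
  have e1 : (diagW v τ x).1.1 (v i) = x.1.1 (v i) * (τ i : k)⁻¹ := by
    change x.1.1 (diagV v τ⁻¹ (v i)) = _
    rw [diagV_basis, map_smul, smul_eq_mul, Pi.inv_apply, Units.val_inv_eq_inv_val, mul_comm]
  have e2 : v.coord i (diagW v τ x).1.2 = v.coord i x.1.2 * τ i := by
    change v.coord i (diagV v τ x.1.2) = _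
    rw [coord_diagV, mul_comm]
  rw [e1, e2]

theorem diagS_gp (a : W k V) (s : S k V) : diagS v τ (gp a s) = gp (diagW v τ a) (diagS v τ s) := by
  rw [gp_eq, gp_eq, LinearMap.add_apply, LinearMap.add_apply, map_add, diagS_fock]
  simp only [LinearMap.smul_apply, Module.End.one_apply, map_smul]
  rfl

theorem diagS_gm (a : W k V) (s : S k V) : diagS v τ (gm a s) = gm (diagW v τ a) (diagS v τ s) := by
  rw [gm_eq, gm_eq, LinearMap.sub_apply, LinearMap.sub_apply, map_sub, diagS_fock]
  simp only [LinearMap.smul_apply, Module.End.one_apply, map_smul]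
  rfl

/-- The diagonal map is an algebra automorphism commuting with the bar involution, and it scales the
top degree by its determinant. -/
theorem bb_diagS (s t : S k V) :
    bb v (diagS v τ s) (diagS v τ t) = (∏ i, (τ i : k)) * bb v s t := by
  have hbr : br (diagS v τ s) = diagS v τ (br s) := by
    induction s using wd_induction v with
    | h0 => simp only [map_zero]
    | hadd s t hs ht => simp only [map_add, hs, ht]
    | hsmul c s hs => simp only [map_smul, hs]
    | hwd L _ => rw [diagS_wd, map_smul, br_wd, map_smul, diagS_wd, smul_comm]
  have hPhi : ∀ s, Phi v (diagS v τ s) = (∏ i, (τ i : k)) * Phi v s := fun s => by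
    induction s using wd_induction v with
    | h0 => simp only [map_zero, mul_zero]
    | hadd s t hs ht => simp only [map_add, hs, ht, mul_add]
    | hsmul c s hs => simp only [map_smul, hs, smul_eq_mul]; ring
    | hwd L hL =>
      rw [diagS_wd, map_smul, smul_eq_mul]
      by_cases h : L.length = l
      · congr 1
        have : L.toFinset = Finset.univ := Finset.eq_univ_of_card _ (by
          rw [List.toFinset_card_of_nodup hL, h, Fintype.card_fin])
        rw [← this, List.prod_toFinset _ hL]
      · rw [Phi_wd_of_length_ne v h, mul_zero, mul_zero]
  rw [bb_eq, bb_eq, hbr, ← diagS_mul, hPhi]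

variable [NeZero (2 : k)]

theorem diagS_R (A : so k V) (s : S k V) :
    diagS v τ (R v A s) = R v (conjSo v τ A) (diagS v τ s) := by
  induction A using so_induction v with
  | h0 => rw [map_zero, R_zero]; exact map_zero _
  | hadd A B hA hB =>
    rw [map_add, R_add, R_add, LinearMap.add_apply, LinearMap.add_apply, map_add, hA, hB]
  | hsmul c A hA =>
    rw [map_smul, R_smul, R_smul, LinearMap.smul_apply, LinearMap.smul_apply, map_smul, hA]
  | hsg a b =>
    rw [conjSo_sg, R_sg, R_sg]
    simp only [LinearMap.smul_apply, LinearMap.sub_apply, Module.End.mul_apply, map_smul, map_sub,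
      diagS_gp, diagS_gm]

/-- The automorphism multiplies `b` by its determinant, so it respects the odd product only after a
rescaling by `c`; the condition on `c` cancels the determinant. -/
theorem conjSo_om {c : k} (hc : c ^ 2 * ∏ i, (τ i : k) = 1) (s t : S k V) :
    conjSo v τ (om v s t) = om v (c • diagS v τ s) (c • diagS v τ t) := by
  have key : ∀ x z, pol z (ap (conjSo v τ (om v s t)) x) =
      pol z (ap (om v (c • diagS v τ s) (c • diagS v τ t)) x) := fun x z => by
    rw [conjSo_ap, pol_diagW_right, pol_om, pol_om, map_smul, bb_smul_left, bb_smul_right]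
    have e : sg z x = conjSo v τ (sg (diagW v τ⁻¹ z) (diagW v τ⁻¹ x)) := by
      rw [conjSo_sg, diagW_inv', diagW_inv']
    rw [e, ← diagS_R, bb_diagS]
    linear_combination (-(bb v (R v (sg (diagW v τ⁻¹ z) (diagW v τ⁻¹ x)) s) t)) * hc
  exact so_ext fun x => W_ext v (key x _) (fun i => key x _) fun i => key x _

/-- The automorphism of `so(W,q) ⊕ S` given by an element of the torus. -/
theorem gMul_diag {c : k} (hc : c ^ 2 * ∏ i, (τ i : k) = 1) (x y : so k V × S k V) :
    (conjSo v τ).prodMap (c • diagS v τ) (gMul v x y) =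
      gMul v ((conjSo v τ).prodMap (c • diagS v τ) x) ((conjSo v τ).prodMap (c • diagS v τ) y) := by
  refine prodMap_mul (ρ := rho v) (o := oddMul v) (fun _ _ => rfl) (conjSo_lie v τ) (fun A s => ?_)
    (fun s t => ?_) x y
  · simp only [rho_eq_R]
    rw [LinearMap.smul_apply, LinearMap.smul_apply, diagS_R, map_smul]
  · simp only [om_eq]
    exact conjSo_om v τ hc s t

end Torus

/-! ### Products of words by degree, and the Cartan subalgebra. -/

section Words

variable {l : ℕ} (v : Module.Basis (Fin l) k V)

theorem wd_append (L L' : List (Fin l)) : wd v (L ++ L') = wd v L * wd v L' := by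
  rw [wd, wd, wd, List.map_append, List.prod_append]

theorem wd_perm {L L' : List (Fin l)} (h : L.Perm L') :
    wd v L = wd v L' ∨ wd v L = -wd v L' := by
  induction h with
  | nil => exact Or.inl rfl
  | cons i _ ih =>
    rw [wd_cons, wd_cons]
    rcases ih with h | h
    · exact Or.inl (by rw [h])
    · exact Or.inr (by rw [h, map_neg])
  | swap i j L => exact Or.inr (by rw [wd_cons, wd_cons, wd_cons, wd_cons, cr_cr])
  | trans _ _ ih ih' =>
    rcases ih with h | h <;> rcases ih' with h' | h' <;> rw [h, h']
    · exact Or.inl rfl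
    · exact Or.inr rfl
    · exact Or.inr rfl
    · exact Or.inl (neg_neg _)

/-- A word that uses each letter once is the top element up to sign. -/
theorem Phi_wd_ne_zero {L : List (Fin l)} (hL : L.Nodup) (h : L.length = l) :
    Phi v (wd v L) ≠ 0 := by
  have hp : L.Perm (List.finRange l) := by
    refine (List.perm_ext_iff_of_nodup hL (List.nodup_finRange l)).2 fun i => ?_
    have : L.toFinset = Finset.univ := Finset.eq_univ_of_card _ (by
      rw [List.toFinset_card_of_nodup hL, h, Fintype.card_fin])
    have hi := Finset.mem_univ i
    rw [← this, List.mem_toFinset] at hi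
    exact iff_of_true hi (List.mem_finRange i)
  have ht := Phi_tp v
  rw [tp] at ht
  rcases wd_perm v hp with h | h
  · rw [h, ht]; exact one_ne_zero
  · rw [h, map_neg, ht]; exact neg_ne_zero.2 one_ne_zero

theorem bb_wd (L L' : List (Fin l)) :
    bb v (wd v L) (wd v L') = (-1) ^ (L.length + 1).choose 2 * Phi v (wd v (L ++ L')) := by
  rw [bb_eq, br_wd, smul_mul_assoc, map_smul, smul_eq_mul, wd_append]

theorem bb_wd_ne_zero {L L' : List (Fin l)} (hL : (L ++ L').Nodup)
    (h : L.length + L'.length = l) : bb v (wd v L) (wd v L') ≠ 0 := by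
  rw [bb_wd]
  exact mul_ne_zero (pow_ne_zero _ (neg_ne_zero.2 one_ne_zero))
    (Phi_wd_ne_zero v hL (by rw [List.length_append, h]))

theorem bb_wd_eq_zero_of_length {L L' : List (Fin l)} (h : L.length + L'.length ≠ l) :
    bb v (wd v L) (wd v L') = 0 := by
  rw [bb_wd, Phi_wd_of_length_ne v (by rwa [List.length_append]), mul_zero]

/-- The homogeneous component of degree `n`. -/
def dz (n : ℤ) : Submodule k (S k V) :=
  Submodule.span k (wd v '' {L | (L.length : ℤ) = n})

theorem wd_mem_dz (L : List (Fin l)) : wd v L ∈ dz v L.length :=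
  Submodule.subset_span ⟨L, rfl, rfl⟩

theorem dz_cast {m n : ℤ} {s : S k V} (hs : s ∈ dz v m) (h : m = n) : s ∈ dz v n := h ▸ hs

theorem cr_mem_dz {n : ℤ} {s : S k V} (hs : s ∈ dz v n) (i : Fin l) :
    cr v i s ∈ dz v (n + 1) := by
  induction hs using Submodule.span_induction with
  | mem x hx =>
    obtain ⟨L, hL, rfl⟩ := hx
    rw [← wd_cons, ← hL]
    exact dz_cast v (wd_mem_dz v (i :: L)) (by simp)
  | zero => rw [map_zero]; exact Submodule.zero_mem _
  | add x y _ _ hx hy => rw [map_add]; exact Submodule.add_mem _ hx hy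
  | smul c x _ hx => rw [map_smul]; exact Submodule.smul_mem _ c hx

theorem an_mem_dz {n : ℤ} {s : S k V} (hs : s ∈ dz v n) (i : Fin l) :
    an v i s ∈ dz v (n - 1) := by
  induction hs using Submodule.span_induction with
  | mem x hx =>
    obtain ⟨L, hL, rfl⟩ := hx
    rw [← hL]
    clear hL
    induction L with
    | nil => rw [wd_nil, an_one]; exact Submodule.zero_mem _
    | cons j L ih =>
      rw [wd_cons, an_cr]
      refine Submodule.sub_mem _ ?_ (dz_cast v (cr_mem_dz v ih j) (by simp))
      split_ifs
      · exact dz_cast v (wd_mem_dz v L) (by simp)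
      · exact Submodule.zero_mem _
  | zero => rw [map_zero]; exact Submodule.zero_mem _
  | add x y _ _ hx hy => rw [map_add]; exact Submodule.add_mem _ hx hy
  | smul c x _ hx => rw [map_smul]; exact Submodule.smul_mem _ c hx

theorem bb_eq_zero_of_mem_dz {m n : ℤ} (h : m + n ≠ l) {s t : S k V} (hs : s ∈ dz v m)
    (ht : t ∈ dz v n) : bb v s t = 0 := by
  induction hs using Submodule.span_induction with
  | mem x hx =>
    obtain ⟨L, hL, rfl⟩ := hx
    have hL : (L.length : ℤ) = m := hL
    induction ht using Submodule.span_induction with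
    | mem x hx =>
      obtain ⟨L', hL', rfl⟩ := hx
      have hL' : (L'.length : ℤ) = n := hL'
      exact bb_wd_eq_zero_of_length v fun e => h (by rw [← hL, ← hL']; exact_mod_cast e)
    | zero => exact bb_zero_right v _
    | add x y _ _ hx hy => rw [bb_add_right, hx, hy, add_zero]
    | smul c x _ hx => rw [bb_smul_right, hx, mul_zero]
  | zero => exact bb_zero_left v _
  | add x y _ _ hx hy => rw [bb_add_left, hx, hy, add_zero]
  | smul c x _ hx => rw [bb_smul_left, hx, mul_zero]

variable [NeZero (2 : k)]

/-- Since `b` pairs complementary degrees only, the total degree of `s` and `t` selects one kind of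
term in `om_expand`: the mixed `v`–`f` terms here, those with `u` and `fᵢ` one degree lower, those
with `u` and `vᵢ` one degree higher. -/
theorem om_of_degree_middle {m n : ℤ} (h : m + n = l) {s t : S k V} (hs : s ∈ dz v m)
    (ht : t ∈ dz v n) : (2 : k) • om v s t =
      -∑ i, ∑ j, bb v (cr v i (an v j s) - an v j (cr v i s)) t • sg (vW v j) (fW v i) := by
  have h1 : ∀ i, bb v (cr v i s) t = 0 := fun i =>
    bb_eq_zero_of_mem_dz v (by omega) (cr_mem_dz v hs i) ht
  have h2 : ∀ i, bb v (an v i s) t = 0 := fun i =>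
    bb_eq_zero_of_mem_dz v (by omega) (an_mem_dz v hs i) ht
  have h3 : ∀ i j, bb v (cr v i (cr v j s)) t = 0 := fun i j =>
    bb_eq_zero_of_mem_dz v (by omega) (cr_mem_dz v (cr_mem_dz v hs j) i) ht
  have h4 : ∀ i j, bb v (an v i (an v j s)) t = 0 := fun i j =>
    bb_eq_zero_of_mem_dz v (by omega) (an_mem_dz v (an_mem_dz v hs j) i) ht
  rw [om_expand]
  simp only [h1, h2, h3, h4, zero_smul, add_zero, Finset.sum_const_zero, neg_zero, zero_sub]

theorem om_of_degree_low {m n : ℤ} (h : m + n + 1 = l) {s t : S k V} (hs : s ∈ dz v m)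
    (ht : t ∈ dz v n) : (2 : k) • om v s t = -∑ i, bb v (cr v i s) t • sg uW (fW v i) := by
  have h1 : ∀ i j, bb v (cr v i (an v j s) - an v j (cr v i s)) t = 0 := fun i j =>
    bb_eq_zero_of_mem_dz v (m := m) (by omega)
      (Submodule.sub_mem _ (dz_cast v (cr_mem_dz v (an_mem_dz v hs j) i) (by omega))
        (dz_cast v (an_mem_dz v (cr_mem_dz v hs i) j) (by omega))) ht
  have h2 : ∀ i, bb v (an v i s) t = 0 := fun i =>
    bb_eq_zero_of_mem_dz v (by omega) (an_mem_dz v hs i) ht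
  have h3 : ∀ i j, bb v (cr v i (cr v j s)) t = 0 := fun i j =>
    bb_eq_zero_of_mem_dz v (by omega) (cr_mem_dz v (cr_mem_dz v hs j) i) ht
  have h4 : ∀ i j, bb v (an v i (an v j s)) t = 0 := fun i j =>
    bb_eq_zero_of_mem_dz v (by omega) (an_mem_dz v (an_mem_dz v hs j) i) ht
  rw [om_expand]
  simp only [h1, h2, h3, h4, zero_smul, add_zero, Finset.sum_const_zero, sub_zero]

theorem om_of_degree_high {m n : ℤ} (h : m + n = l + 1) {s t : S k V} (hs : s ∈ dz v m)
    (ht : t ∈ dz v n) : (2 : k) • om v s t = -∑ i, bb v (an v i s) t • sg uW (vW v i) := by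
  have h1 : ∀ i j, bb v (cr v i (an v j s) - an v j (cr v i s)) t = 0 := fun i j =>
    bb_eq_zero_of_mem_dz v (m := m) (by omega)
      (Submodule.sub_mem _ (dz_cast v (cr_mem_dz v (an_mem_dz v hs j) i) (by omega))
        (dz_cast v (an_mem_dz v (cr_mem_dz v hs i) j) (by omega))) ht
  have h2 : ∀ i, bb v (cr v i s) t = 0 := fun i =>
    bb_eq_zero_of_mem_dz v (by omega) (cr_mem_dz v hs i) ht
  have h3 : ∀ i j, bb v (cr v i (cr v j s)) t = 0 := fun i j =>
    bb_eq_zero_of_mem_dz v (by omega) (cr_mem_dz v (cr_mem_dz v hs j) i) ht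
  have h4 : ∀ i j, bb v (an v i (an v j s)) t = 0 := fun i j =>
    bb_eq_zero_of_mem_dz v (by omega) (an_mem_dz v (an_mem_dz v hs j) i) ht
  rw [om_expand]
  simp only [h1, h2, h3, h4, zero_smul, zero_add, add_zero, Finset.sum_const_zero, sub_zero]

omit [NeZero (2 : k)] in
/-- The element of the Cartan subalgebra of `so(W,q)` with eigenvalues `c` on `V`. -/
def hc (c : Fin l → k) : so k V := ∑ i, c i • sg (fW v i) (vW v i)

omit [NeZero (2 : k)] in
theorem hc_eq (c : Fin l → k) : hc v c = ∑ i, c i • sg (fW v i) (vW v i) := rfl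

omit [NeZero (2 : k)] in
theorem hc_vW (c : Fin l → k) (j : Fin l) : ap (hc v c) (vW v j) = c j • vW v j := by
  rw [hc, sum_ap, Finset.sum_eq_single j]
  · rw [smul_ap, sg_ap, pol_fW_vW, if_pos rfl, pol_vW_vW, one_smul, zero_smul, sub_zero]
  · intro i _ hi
    rw [smul_ap, sg_ap, pol_fW_vW, if_neg hi, pol_vW_vW, zero_smul, zero_smul, sub_zero, smul_zero]
  · simp

omit [NeZero (2 : k)] in
theorem hc_fW (c : Fin l → k) (j : Fin l) : ap (hc v c) (fW v j) = -(c j • fW v j) := by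
  rw [hc, sum_ap, Finset.sum_eq_single j]
  · rw [smul_ap, sg_ap, pol_vW_fW, if_pos rfl, pol_fW_fW, one_smul, zero_smul, zero_sub, smul_neg]
  · intro i _ hi
    rw [smul_ap, sg_ap, pol_vW_fW, if_neg hi, pol_fW_fW, zero_smul, zero_smul, sub_zero, smul_zero]
  · simp

omit [NeZero (2 : k)] in
theorem hc_uW (c : Fin l → k) : ap (hc v c) uW = 0 := by
  rw [hc, sum_ap]
  refine Finset.sum_eq_zero fun i _ => ?_
  rw [smul_ap, sg_ap, pol_vW_uW, pol_fW_uW, zero_smul, zero_smul, sub_zero, smul_zero]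

omit [NeZero (2 : k)] in
theorem hc_smul (r : k) (c : Fin l → k) : r • hc v c = hc v (r • c) := by
  rw [hc, hc, Finset.smul_sum]
  exact Finset.sum_congr rfl fun i _ => by rw [smul_smul, Pi.smul_apply, smul_eq_mul]

omit [NeZero (2 : k)] in
theorem lie_hc_sg_fv (c : Fin l → k) (i j : Fin l) :
    ⁅hc v c, sg (fW v j) (vW v i)⁆ = (c i - c j) • sg (fW v j) (vW v i) := by
  rw [lie_sg, hc_vW, hc_fW, ← neg_smul, sg_smul_left, sg_smul_right, ← add_smul, neg_add_eq_sub]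

omit [NeZero (2 : k)] in
theorem lie_hc_sg_uv (c : Fin l → k) (i : Fin l) :
    ⁅hc v c, sg uW (vW v i)⁆ = c i • sg uW (vW v i) := by
  rw [lie_sg, hc_vW, hc_uW, sg_zero_left, zero_add, sg_smul_right]

omit [NeZero (2 : k)] in
theorem lie_hc_sg_uf (c : Fin l → k) (i : Fin l) :
    ⁅hc v c, sg uW (fW v i)⁆ = -(c i) • sg uW (fW v i) := by
  rw [lie_sg, hc_fW, hc_uW, sg_zero_left, zero_add, ← neg_smul, sg_smul_right]

omit [NeZero (2 : k)] in
theorem lie_hc_hc (c c' : Fin l → k) : ⁅hc v c, hc v c'⁆ = 0 := by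
  have : ⁅hc v c, hc v c'⁆ = ∑ i, ⁅hc v c, c' i • sg (fW v i) (vW v i)⁆ :=
    lie_sum _ _ _
  rw [this]
  refine Finset.sum_eq_zero fun i _ => ?_
  rw [so_lie_smul, lie_hc_sg_fv, sub_self, zero_smul, smul_zero]

theorem R_hc_wd (c : Fin l → k) (L : List (Fin l)) :
    R v (hc v c) (wd v L) = (1 / 2 * ∑ i, if i ∈ L then c i else -c i) • wd v L := by
  have h2 : (2 : k) ≠ 0 := NeZero.ne _
  rw [hc, R_sum, LinearMap.sum_apply, Finset.mul_sum, Finset.sum_smul]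
  refine Finset.sum_congr rfl fun i _ => ?_
  have h := R_hh_wd v i L
  rw [hh, sg_swap, R_neg, LinearMap.neg_apply] at h
  have h' := congrArg (fun s => (1 / 2 : k) • s) h
  rw [smul_smul, one_div, inv_mul_cancel₀ h2, one_smul, neg_eq_iff_eq_neg] at h'
  rw [R_smul, LinearMap.smul_apply, h']
  split_ifs <;> module

theorem R_fv_of_ne {i j : Fin l} (h : i ≠ j) (s : S k V) :
    R v (sg (fW v j) (vW v i)) s = cr v i (an v j s) := by
  have h2 : (2 : k) ≠ 0 := NeZero.ne _
  rw [sg_swap, R_neg, LinearMap.neg_apply, R_vf, an_cr, if_neg h.symm, zero_sub]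
  match_scalars
  field_simp
  norm_num

theorem R_fv_wd_of_mem {i j : Fin l} (h : i ≠ j) {L : List (Fin l)} (hi : i ∈ L) :
    R v (sg (fW v j) (vW v i)) (wd v L) = 0 := by
  have := an_cr v j i (wd v L)
  rw [cr_wd_mem v hi, map_zero, if_neg h.symm, zero_sub] at this
  rw [R_fv_of_ne v h, ← neg_eq_zero, ← this]

theorem R_fv_wd_of_notMem {i j : Fin l} (h : i ≠ j) {L : List (Fin l)} (hj : j ∉ L) :
    R v (sg (fW v j) (vW v i)) (wd v L) = 0 := by
  rw [R_fv_of_ne v h, an_wd_notMem v hj, map_zero]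

omit [NeZero (2 : k)] in
theorem lie_fv_fv (a b i j : Fin l) :
    ⁅sg (fW v b) (vW v a), sg (fW v j) (vW v i)⁆ =
      (if b = i then (1 : k) else 0) • sg (fW v j) (vW v a) -
        (if a = j then (1 : k) else 0) • sg (fW v b) (vW v i) := by
  rw [lie_sg, sg_ap, sg_ap, pol_fW_fW, pol_vW_fW, pol_fW_vW, pol_vW_vW, zero_smul, zero_sub,
    zero_smul, sub_zero, sg_smul_right, ← neg_smul, sg_smul_left, neg_smul, neg_add_eq_sub]

omit [NeZero (2 : k)] in
theorem lie_fv_uv (a b i : Fin l) :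
    ⁅sg (fW v b) (vW v a), sg uW (vW v i)⁆ = (if b = i then (1 : k) else 0) • sg uW (vW v a) := by
  rw [lie_sg, sg_ap, sg_ap, pol_fW_uW, pol_vW_uW, pol_fW_vW, pol_vW_vW, zero_smul, zero_smul,
    sub_zero, sg_zero_left, zero_add, sub_zero, sg_smul_right]

omit [NeZero (2 : k)] in
theorem lie_fv_uf (a b i : Fin l) :
    ⁅sg (fW v b) (vW v a), sg uW (fW v i)⁆ =
      -(if a = i then (1 : k) else 0) • sg uW (fW v b) := by
  rw [lie_sg, sg_ap, sg_ap, pol_fW_uW, pol_vW_uW, pol_fW_fW, pol_vW_fW, zero_smul, zero_smul,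
    sub_zero, sg_zero_left, zero_add, zero_sub, ← neg_smul, sg_smul_right]

-- The factor `2` comes from `pol u u = -2`; it is the reason why the coroot of a short root is
-- doubled.
omit [NeZero (2 : k)] in
theorem lie_uv_uf (i : Fin l) :
    ⁅sg uW (vW v i), sg uW (fW v i)⁆ = (2 : k) • sg (fW v i) (vW v i) := by
  rw [lie_sg, sg_ap, sg_ap, pol_uW_uW, pol_vW_uW, pol_uW_fW, pol_vW_fW, if_pos rfl, zero_smul,
    zero_smul, sub_zero, zero_sub, one_smul, ← neg_one_smul k uW, sg_smul_right, sg_self,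
    smul_zero, add_zero, sg_smul_left, sg_swap, smul_neg, neg_smul, neg_neg]

/-- The product of complementary weight vectors of degrees `1` and `l - 1`. -/
theorem om_cr_one_wd {a : Fin l} {L : List (Fin l)} (hL : (a :: L).Nodup)
    (h : L.length + 1 = l) : (2 : k) • om v (wd v [a]) (wd v L) =
      bb v (wd v [a]) (wd v L) • hc v (fun i => if i = a then 1 else -1) := by
  have h1 := wd_mem_dz v [a]
  rw [om_of_degree_middle v (by simp; omega) h1 (wd_mem_dz v L)]
  have hmem : ∀ i, i ≠ a → i ∈ L := fun i hi => by
    have : (a :: L).toFinset = Finset.univ := Finset.eq_univ_of_card _ (by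
      rw [List.toFinset_card_of_nodup hL, List.length_cons, h, Fintype.card_fin])
    have := this ▸ Finset.mem_univ i
    rw [List.mem_toFinset] at this
    exact List.mem_of_ne_of_mem hi this
  have hz : ∀ i, i ≠ a → bb v (cr v i 1) (wd v L) = 0 := fun i hi => by
    rw [bb_cr, cr_wd_mem v (hmem i hi), bb_zero_right, neg_zero]
  -- The coefficient matrix is diagonal because `L` contains every letter but `a`; the entry is `1`
  -- at `a`, and `-1` at each letter of `L`.
  have key : ∀ i j, bb v (cr v i (an v j (wd v [a])) - an v j (cr v i (wd v [a]))) (wd v L) =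
      (if i = j then (if i = a then 1 else -1) * bb v (wd v [a]) (wd v L) else 0) := fun i j => by
    rw [an_cr, wd_cons, wd_nil, an_cr, an_one, map_zero, sub_zero]
    rcases eq_or_ne j a with rfl | hja
    · rw [if_pos rfl]
      rcases eq_or_ne i j with rfl | hij
      · simp only [if_true, sub_self, sub_zero, one_mul]
      · rw [if_neg hij.symm, if_neg hij, zero_sub, sub_neg_eq_add, bb_add_left, hz i hij, add_zero]
    · rw [if_neg hja, map_zero, sub_zero, zero_sub]
      rcases eq_or_ne i j with rfl | hij
      · rw [if_pos rfl, if_pos rfl, if_neg hja, bb_neg_left, neg_one_mul]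
      · rw [if_neg hij.symm, if_neg hij, neg_zero, bb_zero_left]
  simp only [key, ite_smul, zero_smul]
  rw [hc, Finset.smul_sum, ← Finset.sum_neg_distrib]
  refine Finset.sum_congr rfl fun i _ => ?_
  rw [Finset.sum_ite_eq, if_pos (Finset.mem_univ i), sg_swap, smul_neg, neg_neg, smul_smul,
    mul_comm]

end Words

/-! ### Chevalley generators in a sum of an algebra and a module. -/

section SemidirectProduct

variable {L M : Type*} [LieRing L] [LieAlgebra k L] [AddCommGroup M] [Module k M]
  {μ : (L × M) →ₗ[k] (L × M) →ₗ[k] (L × M)} {ρ : L →ₗ[k] Module.End k M} {o : M →ₗ[k] M →ₗ[k] L}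

/-- Only the odd part has to be generated: the even part is then spanned by the products of odd
elements. -/
theorem eq_top_of_subalgebra
    (hμ : ∀ x y, μ x y = (⁅x.1, y.1⁆ + o x.2 y.2, ρ x.1 y.2 - ρ y.1 x.2))
    (span : ∀ N : Submodule k L, (∀ s t, o s t ∈ N) → N = ⊤) {ι : Type*} {A : ι → L} {s : ι → M}
    (hgen : ∀ (P : Submodule k L) (Q : Submodule k M), (∀ x ∈ P, ∀ y ∈ P, ⁅x, y⁆ ∈ P) →
      (∀ x ∈ P, ∀ y ∈ Q, ρ x y ∈ Q) → (∀ x ∈ Q, ∀ y ∈ Q, o x y ∈ P) →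
      (∀ i, A i ∈ P) → (∀ i, s i ∈ Q) → Q = ⊤)
    (N : Submodule k (L × M)) (hN : ∀ x ∈ N, ∀ y ∈ N, μ x y ∈ N)
    (hA : ∀ i, (A i, (0 : M)) ∈ N) (hs : ∀ i, ((0 : L), s i) ∈ N) : N = ⊤ := by
  have h := hgen (N.comap (LinearMap.inl k L M)) (N.comap (LinearMap.inr k L M))
    (fun x hx y hy => by
      have := hN _ hx _ hy
      rw [hμ] at this
      simpa using this)
    (fun x hx y hy => by
      have := hN _ hx _ hy
      rw [hμ] at this
      simpa using this)
    (fun x hx y hy => by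
      have := hN _ hx _ hy
      rw [hμ] at this
      simpa using this) hA hs
  have hodd : ∀ s, ((0 : L), s) ∈ N := fun s => by
    have : s ∈ N.comap (LinearMap.inr k L M) := h ▸ Submodule.mem_top
    exact this
  have heven := span (N.comap (LinearMap.inl k L M)) fun s t => by
    have := hN _ (hodd s) _ (hodd t)
    rw [hμ] at this
    simpa using this
  refine Submodule.eq_top_iff'.2 fun y => ?_
  have h1 : y.1 ∈ N.comap (LinearMap.inl k L M) := heven ▸ Submodule.mem_top
  have := N.add_mem (show (y.1, (0 : M)) ∈ N from h1) (hodd y.2)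
  simpa using this

/-- Identification of `L ⊕ M` with a contragredient Lie algebra by means of Chevalley generators,
each of which is even or odd. -/
theorem isoLie_of_generators [Infinite k] {B : Type*} [Fintype B] [DecidableEq B] [Nonempty B]
    (C : Matrix B B ℤ)
    (hμ : ∀ x y, μ x y = (⁅x.1, y.1⁆ + o x.2 y.2, ρ x.1 y.2 - ρ y.1 x.2)) (hlie : IsLieProduct μ)
    (hsimple : ∀ I : Submodule k (L × M), (∀ x, ∀ y ∈ I, μ x y ∈ I) → I = ⊥ ∨ I = ⊤)
    (hne0 : μ ≠ 0) (span : ∀ N : Submodule k L, (∀ s t, o s t ∈ N) → N = ⊤) {A A' H : B → L}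
    {s s' : B → M} (hh : ∀ i j, ⁅H i, H j⁆ = 0)
    (ef : ∀ i j, ⁅A i, A' j⁆ + o (s i) (s' j) = if i = j then H i else 0)
    (ef' : ∀ i j, ρ (A i) (s' j) = ρ (A' j) (s i))
    (he : ∀ i j, ⁅H i, A j⁆ = (C i j : k) • A j)
    (he' : ∀ i j, ρ (H i) (s j) = (C i j : k) • s j)
    (hf : ∀ i j, ⁅H i, A' j⁆ = -((C i j : k) • A' j))
    (hf' : ∀ i j, ρ (H i) (s' j) = -((C i j : k) • s' j))
    (hC : (C.map (Int.cast : ℤ → k)).det ≠ 0) (hne : ∀ i, A i ≠ 0 ∨ s i ≠ 0)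
    (hp : ∀ i, A i = 0 ∨ s i = 0) (hp' : ∀ i, A' i = 0 ∨ s' i = 0)
    (hgen : ∀ (P : Submodule k L) (Q : Submodule k M),
      (∀ x ∈ P, ∀ y ∈ P, ⁅x, y⁆ ∈ P) → (∀ x ∈ P, ∀ y ∈ Q, ρ x y ∈ Q) →
      (∀ x ∈ Q, ∀ y ∈ Q, o x y ∈ P) → (∀ i, A i ∈ P) → (∀ i, A' i ∈ P) → (∀ i, s i ∈ Q) →
      (∀ i, s' i ∈ Q) → Q = ⊤)
    (torus : ∀ t : B → kˣ, ∃ (α : L →ₗ[k] L) (β : M →ₗ[k] M),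
      (∀ x y, α.prodMap β (μ x y) = μ (α.prodMap β x) (α.prodMap β y)) ∧
      (∀ i, α (A i) = (t i : k) • A i) ∧ (∀ i, α (A' i) = (t i : k)⁻¹ • A' i) ∧
      (∀ i, β (s i) = (t i : k) • s i) ∧ ∀ i, β (s' i) = (t i : k)⁻¹ • s' i) :
    IsoLie μ (Contragredient k C) ∧ LieAlgebra.IsSimple k (Contragredient k C) := by
  have mul : ∀ {A B C : L} {s t r : M}, ⁅A, B⁆ + o s t = C → ρ A t - ρ B s = r →
      μ (A, s) (B, t) = (C, r) := fun h1 h2 => by rw [hμ, ← h1, ← h2]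
  -- Each generator is purely even or purely odd, so both of its components lie in `N`, one of them
  -- being zero.
  have pure_mem : ∀ (N : Submodule k (L × M)) (x : L) (y : M), (x, y) ∈ N → x = 0 ∨ y = 0 →
      (x, (0 : M)) ∈ N ∧ ((0 : L), y) ∈ N := fun N x y hN h => by
    rcases h with rfl | rfl
    · exact ⟨N.zero_mem, hN⟩
    · exact ⟨hN, N.zero_mem⟩
  refine isoLie_contragredient (e := fun i => (A i, s i)) (f := fun i => (A' i, s' i))
    (h := fun i => (H i, 0)) hlie (fun i j => ?_) (fun i j => ?_) (fun i j => ?_)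
    (fun i j => ?_) hC (fun i h => ?_) (fun N h1 h2 h3 => ?_) hsimple hne0 (fun t => ?_)
  · exact mul (by rw [hh, map_zero, add_zero]) (by rw [map_zero, map_zero, sub_zero])
  · refine (mul (ef i j) (by rw [ef', sub_self])).trans ?_
    split_ifs <;> rfl
  · rw [mul (r := (C i j : k) • s j) (by rw [he, map_zero, LinearMap.zero_apply, add_zero])
      (by rw [he', map_zero, sub_zero]), Prod.smul_mk]
  · rw [mul (r := -((C i j : k) • s' j)) (by rw [hf, map_zero, LinearMap.zero_apply, add_zero])
      (by rw [hf', map_zero, sub_zero]), Prod.smul_mk, Prod.neg_mk]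
  · have h := Prod.ext_iff.1 h
    exact (hne i).elim (fun h' => h' h.1) fun h' => h' h.2
  · refine eq_top_of_subalgebra (A := Sum.elim A A') (s := Sum.elim s s') hμ span
      (fun P Q g1 g2 g3 g4 g5 => hgen P Q g1 g2 g3 (fun i => g4 (.inl i)) (fun i => g4 (.inr i))
        (fun i => g5 (.inl i)) fun i => g5 (.inr i)) N h3 ?_ ?_
    · rintro (i | i)
      exacts [(pure_mem N _ _ (h1 i) (hp i)).1, (pure_mem N _ _ (h2 i) (hp' i)).1]
    · rintro (i | i)
      exacts [(pure_mem N _ _ (h1 i) (hp i)).2, (pure_mem N _ _ (h2 i) (hp' i)).2]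
  · obtain ⟨α, β, h, h1, h2, h3, h4⟩ := torus t
    refine ⟨α.prodMap β, h, fun i => ?_, fun i => ?_⟩
    · rw [LinearMap.prodMap_apply, h1, h3, Prod.smul_mk]
    · rw [LinearMap.prodMap_apply, h2, h4, Prod.smul_mk]

end SemidirectProduct

/-! ### The criterion for the spin construction. -/

section Chevalley

variable {l : ℕ} (v : Module.Basis (Fin l) k V) [NeZero (2 : k)]

theorem isoLie_gMul [Infinite k] {B : Type*} [Fintype B] [DecidableEq B] [Nonempty B]
    (C : Matrix B B ℤ) (hl : 3 ≤ l) (hμ : IsLieProduct (gMul v)) {A A' : B → so k V}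
    {s s' : B → S k V} {c : B → Fin l → k}
    (ef : ∀ i j, ⁅A i, A' j⁆ + om v (s i) (s' j) = if i = j then hc v (c i) else 0)
    (ef' : ∀ i j, R v (A i) (s' j) = R v (A' j) (s i))
    (he : ∀ i j, ⁅hc v (c i), A j⁆ = (C i j : k) • A j)
    (he' : ∀ i j, R v (hc v (c i)) (s j) = (C i j : k) • s j)
    (hf : ∀ i j, ⁅hc v (c i), A' j⁆ = -((C i j : k) • A' j))
    (hf' : ∀ i j, R v (hc v (c i)) (s' j) = -((C i j : k) • s' j))
    (hC : (C.map (Int.cast : ℤ → k)).det ≠ 0) (hne : ∀ i, A i ≠ 0 ∨ s i ≠ 0)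
    (hp : ∀ i, A i = 0 ∨ s i = 0) (hp' : ∀ i, A' i = 0 ∨ s' i = 0)
    (hgen : ∀ (P : Submodule k (so k V)) (Q : Submodule k (S k V)),
      (∀ x ∈ P, ∀ y ∈ P, ⁅x, y⁆ ∈ P) → (∀ x ∈ P, ∀ y ∈ Q, R v x y ∈ Q) →
      (∀ x ∈ Q, ∀ y ∈ Q, om v x y ∈ P) → (∀ i, A i ∈ P) → (∀ i, A' i ∈ P) → (∀ i, s i ∈ Q) →
      (∀ i, s' i ∈ Q) → Q = ⊤)
    (torus : ∀ t : B → kˣ, ∃ (τ : Fin l → kˣ) (a : k), a ^ 2 * ∏ i, (τ i : k) = 1 ∧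
      (∀ i, conjSo v τ (A i) = (t i : k) • A i) ∧
      (∀ i, conjSo v τ (A' i) = (t i : k)⁻¹ • A' i) ∧
      (∀ i, a • diagS v τ (s i) = (t i : k) • s i) ∧
      ∀ i, a • diagS v τ (s' i) = (t i : k)⁻¹ • s' i) :
    IsoLie (gMul v) (Contragredient k C) ∧ LieAlgebra.IsSimple k (Contragredient k C) := by
  refine isoLie_of_generators (ρ := rho v) (o := oddMul v) C (fun _ _ => rfl) hμ (gMul_ideal v hl)
    (gMul_ne_zero v (by omega)) ?_ (fun i j => lie_hc_hc v (c i) (c j)) ?_ ?_ he ?_ hf ?_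
    hC hne hp hp' ?_ fun t => ?_
  · simpa only [om_eq] using eq_top_of_om v
  · simpa only [om_eq] using ef
  · simpa only [rho_eq_R] using ef'
  · simpa only [rho_eq_R] using he'
  · simpa only [rho_eq_R] using hf'
  · simpa only [rho_eq_R, om_eq] using hgen
  · obtain ⟨τ, a, ha, t1, t2, t3, t4⟩ := torus t
    exact ⟨conjSo v τ, a • diagS v τ, gMul_diag v τ ha, t1, t2, t3, t4⟩

omit [NeZero (2 : k)] in
theorem lie_uv_fv (i a b : Fin l) : ⁅sg uW (vW v i), sg (fW v b) (vW v a)⁆ =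
    -((if b = i then (1 : k) else 0) • sg uW (vW v a)) := by
  rw [← lie_fv_uv, lie_skew]

omit [NeZero (2 : k)] in
theorem sg_fv_ne_zero (i j : Fin l) : sg (fW v j) (vW v i) ≠ 0 := fun h0 => by
  have := congrArg (fun A => pol (fW v i) (ap A (vW v j))) h0
  simp only [sg_ap, pol_vW_vW, pol_fW_vW, if_true, one_smul, zero_smul, sub_zero, zero_ap,
    pol_zero_right] at this
  exact one_ne_zero this

theorem sg_uv_ne_zero (i : Fin l) : sg uW (vW v i) ≠ 0 := fun h0 => by
  have h2 : (2 : k) ≠ 0 := NeZero.ne _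
  have := congrArg (fun A => pol (fW v i) (ap A uW)) h0
  simp only [sg_ap, pol_uW_uW, pol_fW_vW, if_true, pol_vW_uW, zero_smul, sub_zero, zero_ap,
    pol_zero_right, pol_smul_right, mul_one] at this
  exact neg_ne_zero.2 h2 this

omit [NeZero (2 : k)] in
theorem wd_ne_zero {L : List (Fin l)} (hL : L.Nodup) : wd v L ≠ 0 := by
  induction L with
  | nil => rw [wd_nil]; exact one_ne_zero_S v
  | cons i L ih =>
    intro h
    have := an_cr_wd v (List.nodup_cons.1 hL).1
    rw [← wd_cons, h, map_zero] at this
    exact ih (List.nodup_cons.1 hL).2 this.symm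

omit [NeZero (2 : k)] in
theorem conjSo_fv (τ : Fin l → kˣ) (i j : Fin l) : conjSo v τ (sg (fW v j) (vW v i)) =
    ((τ i : k) * (τ j : k)⁻¹) • sg (fW v j) (vW v i) := by
  rw [conjSo_sg, diagW_fW, diagW_vW, sg_smul_left, sg_smul_right, smul_smul, mul_comm]

omit [NeZero (2 : k)] in
theorem conjSo_uv (τ : Fin l → kˣ) (i : Fin l) : conjSo v τ (sg uW (vW v i)) =
    (τ i : k) • sg uW (vW v i) := by
  rw [conjSo_sg, diagW_uW, diagW_vW, sg_smul_right]

omit [NeZero (2 : k)] in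
theorem conjSo_uf (τ : Fin l → kˣ) (i : Fin l) : conjSo v τ (sg uW (fW v i)) =
    (τ i : k)⁻¹ • sg uW (fW v i) := by
  rw [conjSo_sg, diagW_uW, diagW_fW, sg_smul_right]

end Chevalley

/-! ### Rank four: type `F₄`. -/

section FFour

variable (v : Module.Basis (Fin 4) k V) [NeZero (2 : k)]

/-- Brackets of the even generators give creation and annihilation operators for the letters `1, 2,
3`, and annihilating `v₁v₂v₃` gives `1`. The letter `0` is only available through the odd generator
`v₀`. -/
theorem eq_top_of_generators_four {P : Submodule k (so k V)} {Q : Submodule k (S k V)}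
    (hP : ∀ x ∈ P, ∀ y ∈ P, ⁅x, y⁆ ∈ P) (hQ : ∀ x ∈ P, ∀ y ∈ Q, R v x y ∈ Q)
    (h23 : sg (fW v 3) (vW v 2) ∈ P) (h12 : sg (fW v 2) (vW v 1) ∈ P)
    (h32 : sg (fW v 2) (vW v 3) ∈ P) (h21 : sg (fW v 1) (vW v 2) ∈ P)
    (hv3 : sg uW (vW v 3) ∈ P) (hf3 : sg uW (fW v 3) ∈ P) (h0 : wd v [0] ∈ Q)
    (h123 : wd v [1, 2, 3] ∈ Q) : Q = ⊤ := by
  have hv2 : sg uW (vW v 2) ∈ P := by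
    have := hP _ h23 _ hv3
    rwa [lie_fv_uv, if_pos rfl, one_smul] at this
  have hv1 : sg uW (vW v 1) ∈ P := by
    have := hP _ h12 _ hv2
    rwa [lie_fv_uv, if_pos rfl, one_smul] at this
  have hf2 : sg uW (fW v 2) ∈ P := by
    have := P.neg_mem (hP _ h32 _ hf3)
    rwa [lie_fv_uf, if_pos rfl, neg_one_smul, neg_neg] at this
  have hf1 : sg uW (fW v 1) ∈ P := by
    have := P.neg_mem (hP _ h21 _ hf2)
    rwa [lie_fv_uf, if_pos rfl, neg_one_smul, neg_neg] at this
  have hcr : ∀ i, i ≠ 0 → ∀ s ∈ Q, cr v i s ∈ Q := by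
    have : ∀ i, sg uW (vW v i) ∈ P → ∀ s ∈ Q, cr v i s ∈ Q := fun i hi s hs => by
      have := Q.neg_mem (hQ _ hi s hs)
      rwa [R_uv, LinearMap.neg_apply, neg_neg] at this
    intro i hi
    fin_cases i
    · exact absurd rfl hi
    · exact this 1 hv1
    · exact this 2 hv2
    · exact this 3 hv3
  have han : ∀ i, sg uW (fW v i) ∈ P → ∀ s ∈ Q, an v i s ∈ Q := fun i hi s hs => by
    have := Q.neg_mem (hQ _ hi s hs)
    rwa [R_uf, LinearMap.neg_apply, neg_neg] at this
  have h1 : wd v [] ∈ Q := by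
    have := han 3 hf3 _ (han 2 hf2 _ (han 1 hf1 _ h123))
    rwa [wd_cons, an_cr_wd v (by decide), wd_cons, an_cr_wd v (by decide), wd_cons,
      an_cr_wd v (by decide)] at this
  -- Since left multiplication by `v₀` is not known to preserve `Q`, the vectors `s` with both `s`
  -- and `v₀ s` in `Q` are considered; they contain `1` and are stable under all creation operators.
  have key : Q ⊓ Q.comap (cr v 0) = ⊤ := by
    refine eq_top_of_cr v ⟨h1, show cr v 0 1 ∈ Q by rwa [wd_cons, wd_nil] at h0⟩ fun i s hs => ?_
    rcases eq_or_ne i 0 with rfl | hi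
    · refine ⟨hs.2, ?_⟩
      change cr v 0 (cr v 0 s) ∈ Q
      rw [cr_self]
      exact Q.zero_mem
    · refine ⟨hcr i hi s hs.1, ?_⟩
      change cr v 0 (cr v i s) ∈ Q
      rw [cr_cr]
      exact Q.neg_mem (hcr i hi _ hs.2)
  exact eq_top_iff.2 (key ▸ inf_le_left)

/-- The even components of the positive generators of type `F₄`. -/
def fourE : Fin 4 → so k V :=
  ![0, sg uW (vW v 3), sg (fW v 3) (vW v 2), sg (fW v 2) (vW v 1)]

/-- The even components of the negative generators of type `F₄`. -/
def fourF : Fin 4 → so k V :=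
  ![0, sg uW (fW v 3), sg (fW v 2) (vW v 3), sg (fW v 1) (vW v 2)]

/-- The coroots of type `F₄`. -/
def fourH : Fin 4 → Fin 4 → k := ![![1, -1, -1, -1], ![0, 0, 0, 2], ![0, 0, 1, -1], ![0, 1, -1, 0]]

/-- With the odd pair `v₀` and a multiple of `v₁v₂v₃`, the positive generators have weights
`½(1,-1,-1,-1)`, `ε₃`, `ε₂-ε₃`, `ε₁-ε₂`: two short simple roots followed by two long ones. -/
theorem lie_fourE_fourF {s t : S k V} (hom : om v s t = hc v ![1, -1, -1, -1]) (i j : Fin 4) :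
    ⁅fourE v i, fourF v j⁆ + om v (![s, 0, 0, 0] i) (![t, 0, 0, 0] j) =
      if i = j then hc v (fourH i) else 0 := by
  fin_cases i <;> fin_cases j <;>
    simp [fourE, fourF, fourH, om_zero_left, om_zero_right, lie_uv_fv,
      lie_fv_fv, lie_fv_uf, lie_uv_uf, hom, hc_eq, Fin.sum_univ_four, sub_eq_add_neg]

/-- Both sides are zero throughout: the even generator creates a letter already present or
annihilates an absent one. -/
theorem R_fourE_fourF (r : k) (i j : Fin 4) :
    R v (fourE v i) (![r • wd v [1, 2, 3], 0, 0, 0] j) =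
      R v (fourF v j) (![wd v [0], 0, 0, 0] i) := by
  fin_cases i <;> fin_cases j <;>
    simp [fourE, fourF, R_zero, R_uv, R_uf, cr_wd_mem, an_wd_notMem, R_fv_wd_of_mem,
      R_fv_wd_of_notMem]

omit [NeZero (2 : k)] in
theorem lie_fourH_fourE (i j : Fin 4) :
    ⁅hc v (fourH i), fourE v j⁆ = (CartanMatrix.F₄ i j : k) • fourE v j := by
  fin_cases i <;> fin_cases j <;>
    simp [fourE, fourH, lie_hc_sg_fv, lie_hc_sg_uv, CartanMatrix.F₄,
      one_add_one_eq_two]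

omit [NeZero (2 : k)] in
theorem lie_fourH_fourF (i j : Fin 4) :
    ⁅hc v (fourH i), fourF v j⁆ = -((CartanMatrix.F₄ i j : k) • fourF v j) := by
  fin_cases i <;> fin_cases j <;>
    simp [fourF, fourH, lie_hc_sg_fv, lie_hc_sg_uf, CartanMatrix.F₄] <;> module

theorem R_fourH_zero (i : Fin 4) :
    R v (hc v (fourH i)) (wd v [0]) = (CartanMatrix.F₄ i 0 : k) • wd v [0] := by
  have h2 : (2 : k) ≠ 0 := NeZero.ne _
  rw [R_hc_wd]
  congr 1
  fin_cases i <;> simp [fourH, CartanMatrix.F₄, Fin.sum_univ_four] <;> field_simp <;>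
    norm_num

theorem R_fourH_one_two_three (i : Fin 4) :
    R v (hc v (fourH i)) (wd v [1, 2, 3]) = (-(CartanMatrix.F₄ i 0 : k)) • wd v [1, 2, 3] := by
  have h2 : (2 : k) ≠ 0 := NeZero.ne _
  rw [R_hc_wd]
  congr 1
  fin_cases i <;> simp [fourH, CartanMatrix.F₄, Fin.sum_univ_four] <;> field_simp <;>
    norm_num

theorem forall_fin_four {P : Fin 4 → Prop} (h0 : P 0) (h1 : P 1) (h2 : P 2) (h3 : P 3) (i : Fin 4) :
    P i := by
  fin_cases i
  exacts [h0, h1, h2, h3]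

omit [NeZero (2 : k)] in
theorem torus_four (r : k) (t : Fin 4 → kˣ) : ∃ (τ : Fin 4 → kˣ) (a : k),
    a ^ 2 * ∏ i, (τ i : k) = 1 ∧
    (∀ i, conjSo v τ (fourE v i) = (t i : k) • fourE v i) ∧
    (∀ i, conjSo v τ (fourF v i) = (t i : k)⁻¹ • fourF v i) ∧
    (∀ i, a • diagS v τ (![wd v [0], 0, 0, 0] i) = (t i : k) • ![wd v [0], 0, 0, 0] i) ∧
    ∀ i, a • diagS v τ (![r • wd v [1, 2, 3], 0, 0, 0] i) =
      (t i : k)⁻¹ • ![r • wd v [1, 2, 3], 0, 0, 0] i := by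
  have ht := fun i => (t i).ne_zero
  -- The even generators force `τ₃ = t₁`, `τ₂ = t₂τ₃`, `τ₁ = t₃τ₂`. The conditions `aτ₀ = t₀` and
  -- `a² τ₀τ₁τ₂τ₃ = 1` then give `a = (t₀τ₁τ₂τ₃)⁻¹`, with no square root needed.
  refine ⟨![t 0 * (t 0 * (t 3 * t 2 * t 1) * (t 2 * t 1) * t 1), t 3 * t 2 * t 1, t 2 * t 1, t 1],
    (t 0 * (t 3 * t 2 * t 1) * (t 2 * t 1) * t 1 : k)⁻¹, ?_, ?_, ?_, ?_, ?_⟩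
  · rw [Fin.prod_univ_four]
    simp only [Matrix.cons_val, Units.val_mul]
    field_simp [ht]
  · refine forall_fin_four ?_ ?_ ?_ ?_
    all_goals simp only [fourE, Matrix.cons_val, map_zero, smul_zero, conjSo_fv, conjSo_uv,
      Units.val_mul]
    all_goals congr 1; field_simp [ht]
  · refine forall_fin_four ?_ ?_ ?_ ?_
    all_goals simp only [fourF, Matrix.cons_val, map_zero, smul_zero, conjSo_fv, conjSo_uf,
      Units.val_mul]
    all_goals congr 1; field_simp [ht]
  · refine forall_fin_four ?_ ?_ ?_ ?_
    all_goals simp only [Matrix.cons_val, map_zero, smul_zero, diagS_wd, smul_smul,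
      List.map_cons, List.map_nil, List.prod_cons, List.prod_nil, Units.val_mul]
    congr 1
    field_simp [ht]
  · refine forall_fin_four ?_ ?_ ?_ ?_
    all_goals simp only [Matrix.cons_val, map_zero, smul_zero, map_smul, diagS_wd, smul_smul,
      List.map_cons, List.map_nil, List.prod_cons, List.prod_nil, Units.val_mul]
    congr 1
    field_simp [ht]

theorem isoLie_gMul_four [Infinite k] (hμ : IsLieProduct (gMul v)) :
    IsoLie (gMul v) (TypeF4 k) ∧ LieAlgebra.IsSimple k (TypeF4 k) := by
  have h2 : (2 : k) ≠ 0 := NeZero.ne _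
  -- Twice the product of the two words is `β` times the coroot, so the factor `2 / β` normalises
  -- the negative generator.
  obtain ⟨β, hβ⟩ : ∃ β, β = bb v (wd v [0]) (wd v [1, 2, 3]) := ⟨_, rfl⟩
  have hβ0 : β ≠ 0 := hβ ▸ bb_wd_ne_zero v (by decide) rfl
  have hom : om v (wd v [0]) ((2 / β) • wd v [1, 2, 3]) = hc v ![1, -1, -1, -1] := by
    have := om_cr_one_wd v (a := 0) (L := [1, 2, 3]) (by decide) rfl
    rw [← hβ] at this
    rw [om_smul_right, div_eq_inv_mul, mul_smul, this, inv_smul_smul₀ hβ0]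
    congr 1
    ext i
    fin_cases i <;> rfl
  -- Determinant one makes the matrix invertible in every characteristic.
  have hdet : CartanMatrix.F₄.det = 1 := by decide
  refine isoLie_gMul v (s := ![wd v [0], 0, 0, 0]) (s' := ![(2 / β) • wd v [1, 2, 3], 0, 0, 0])
    CartanMatrix.F₄ (by norm_num) hμ (lie_fourE_fourF v hom) (R_fourE_fourF v _)
    (lie_fourH_fourE v) (fun i => forall_fin_four (R_fourH_zero v i) ?_ ?_ ?_)
    (lie_fourH_fourF v) (fun i => forall_fin_four ?_ ?_ ?_ ?_) ?_
    (forall_fin_four (.inr (wd_ne_zero v (by decide))) (.inl (sg_uv_ne_zero v 3))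
      (.inl (sg_fv_ne_zero v 2 3)) (.inl (sg_fv_ne_zero v 1 2)))
    (forall_fin_four (.inl rfl) (.inr rfl) (.inr rfl) (.inr rfl))
    (forall_fin_four (.inl rfl) (.inr rfl) (.inr rfl) (.inr rfl))
    (fun P Q g1 g2 _ g4 g5 g6 g7 => ?_) (torus_four v _)
  iterate 3 exact (map_zero _).trans (smul_zero _).symm
  · change R v (hc v (fourH i)) ((2 / β) • wd v [1, 2, 3]) = _
    rw [map_smul, R_fourH_one_two_three, smul_comm, neg_smul]
    rfl
  iterate 3 exact (map_zero _).trans (neg_eq_zero.2 (smul_zero _)).symm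
  · have := (Int.castRingHom k).map_det CartanMatrix.F₄
    rw [hdet, map_one] at this
    exact this ▸ one_ne_zero
  · have : wd v [1, 2, 3] ∈ Q := by
      have := Q.smul_mem (2 / β)⁻¹ (g7 0)
      exact (inv_smul_smul₀ (div_ne_zero h2 hβ0) (wd v [1, 2, 3])) ▸ this
    exact eq_top_of_generators_four v g1 g2 (g4 2) (g4 3) (g5 2) (g5 3) (g4 1) (g5 1) (g6 0) this

end FFour

/-! ### Rank three in characteristic `3`: Brown's Lie algebra. -/

section Brown

variable (v : Module.Basis (Fin 3) k V) [NeZero (2 : k)]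

/-- The word formed by `m`, `i`, `j` is a permutation of all three letters, so of all terms
`σ_{u,fₐ}` only the one for the missing letter `m` survives, with nonzero coefficient. -/
theorem uf_mem_of_om {P : Submodule k (so k V)} {i j m : Fin 3} (h : [m, i, j].Nodup)
    (hom : om v (wd v [i]) (wd v [j]) ∈ P) : sg uW (fW v m) ∈ P := by
  have h1 := om_of_degree_low v (by rfl) (wd_mem_dz v [i]) (wd_mem_dz v [j])
  rw [Finset.sum_eq_single m] at h1
  · have h2 : bb v (wd v [m, i]) (wd v [j]) ≠ 0 := bb_wd_ne_zero v h rfl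
    rw [← wd_cons] at h1
    have h3 := P.smul_mem (bb v (wd v [m, i]) (wd v [j]))⁻¹ (P.neg_mem (P.smul_mem 2 hom))
    rwa [h1, neg_neg, inv_smul_smul₀ h2] at h3
  · intro a _ ha
    have aux : ∀ a i j m : Fin 3, [m, i, j].Nodup → a ≠ m → ¬([a, i] ++ [j]).Nodup := by decide
    have h2 := aux a i j m h ha
    rw [← wd_cons, bb_wd, wd_eq_zero v h2, map_zero, mul_zero, zero_smul]
  · exact fun h => absurd (Finset.mem_univ m) h

theorem uv_mem_of_om {P : Submodule k (so k V)} {i j m : Fin 3} (h : [m, i, j].Nodup)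
    (hom : om v (wd v [m, i]) (wd v [m, j]) ∈ P) : sg uW (vW v m) ∈ P := by
  have aux : ∀ i j m : Fin 3, [m, i, j].Nodup → ([i] ++ [m, j]).Nodup ∧ m ∉ [i] := by decide
  have h1 := om_of_degree_high v (by rfl) (wd_mem_dz v [m, i]) (wd_mem_dz v [m, j])
  rw [Finset.sum_eq_single m] at h1
  · have h2 : bb v (wd v [i]) (wd v [m, j]) ≠ 0 := bb_wd_ne_zero v (aux i j m h).1 rfl
    have h4 : an v m (wd v [m, i]) = wd v [i] := by
      rw [wd_cons, an_cr_wd v (aux i j m h).2]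
    rw [h4] at h1
    have h3 := P.smul_mem (bb v (wd v [i]) (wd v [m, j]))⁻¹ (P.neg_mem (P.smul_mem 2 hom))
    rwa [h1, neg_neg, inv_smul_smul₀ h2] at h3
  · intro a _ ha
    rw [wd_cons v m [i], an_cr, if_neg ha, zero_sub, wd_cons v i [], wd_nil, an_cr, an_one,
      map_zero, sub_zero]
    split_ifs
    · rw [bb_neg_left, bb_cr, cr_wd_mem v (by simp), bb_zero_right, neg_zero, neg_zero, zero_smul]
    · rw [map_zero, neg_zero, bb_zero_left, zero_smul]
  · exact fun h => absurd (Finset.mem_univ m) h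

/-- No `σ_{u,·}` is among the generators. The even ones reach all words of length one and two, and
products of such words then supply creation operators for all letters and one annihilation operator,
which yields `1`. -/
theorem eq_top_of_generators_three {P : Submodule k (so k V)} {Q : Submodule k (S k V)}
    (hQ : ∀ x ∈ P, ∀ y ∈ Q, R v x y ∈ Q) (hom : ∀ x ∈ Q, ∀ y ∈ Q, om v x y ∈ P)
    (h01 : sg (fW v 1) (vW v 0) ∈ P) (h12 : sg (fW v 2) (vW v 1) ∈ P)
    (h10 : sg (fW v 0) (vW v 1) ∈ P) (h21 : sg (fW v 1) (vW v 2) ∈ P)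
    (hv2 : wd v [2] ∈ Q) (hv01 : wd v [0, 1] ∈ Q) : Q = ⊤ := by
  have hv1 : wd v [1] ∈ Q := by
    have := hQ _ h12 _ hv2
    rwa [R_fv_of_ne v (by decide), wd_cons, an_cr_wd v (by decide), ← wd_cons] at this
  have hv0 : wd v [0] ∈ Q := by
    have := hQ _ h01 _ hv1
    rwa [R_fv_of_ne v (by decide), wd_cons, an_cr_wd v (by decide), ← wd_cons] at this
  have swap : ∀ i j, wd v [i, j] = -wd v [j, i] := fun i j => by
    rw [wd_cons, wd_cons, wd_cons, wd_cons, cr_cr]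
  have hv10 : wd v [1, 0] ∈ Q := by rw [swap]; exact Q.neg_mem hv01
  have hv20 : wd v [2, 0] ∈ Q := by
    have := hQ _ h21 _ hv10
    rwa [R_fv_of_ne v (by decide), wd_cons, an_cr_wd v (by decide), ← wd_cons] at this
  have hv02 : wd v [0, 2] ∈ Q := by rw [swap]; exact Q.neg_mem hv20
  have hv12 : wd v [1, 2] ∈ Q := by
    have := hQ _ h10 _ hv02
    rwa [R_fv_of_ne v (by decide), wd_cons, an_cr_wd v (by decide), ← wd_cons] at this
  have hv21 : wd v [2, 1] ∈ Q := by rw [swap]; exact Q.neg_mem hv12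
  have hu : ∀ i, sg uW (vW v i) ∈ P := by
    intro i
    fin_cases i
    · exact uv_mem_of_om v (m := 0) (by decide) (hom _ hv01 _ hv02)
    · exact uv_mem_of_om v (m := 1) (by decide) (hom _ hv10 _ hv12)
    · exact uv_mem_of_om v (m := 2) (by decide) (hom _ hv20 _ hv21)
  have hf2 : sg uW (fW v 2) ∈ P := uf_mem_of_om v (m := 2) (by decide) (hom _ hv0 _ hv1)
  have h1 : (1 : S k V) ∈ Q := by
    have := Q.neg_mem (hQ _ hf2 _ hv2)
    rwa [R_uf, LinearMap.neg_apply, neg_neg, wd_cons, an_cr_wd v (by decide), wd_nil] at this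
  refine eq_top_of_cr v h1 fun i s hs => ?_
  have := Q.neg_mem (hQ _ (hu i) s hs)
  rwa [R_uv, LinearMap.neg_apply, neg_neg] at this

/-- The even components of the positive generators of Brown's algebra. -/
def brownE : Fin 3 → so k V := ![sg (fW v 1) (vW v 0), sg (fW v 2) (vW v 1), 0]

/-- The even components of the negative generators of Brown's algebra. -/
def brownF : Fin 3 → so k V := ![sg (fW v 0) (vW v 1), sg (fW v 1) (vW v 2), 0]

/-- The coroots of Brown's algebra. -/
def brownH : Fin 3 → Fin 3 → k := ![![1, -1, 0], ![0, 1, -1], ![-(1 / 2), -(1 / 2), 1 / 2]]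

/-- The positive generators have weights `ε₀-ε₁`, `ε₁-ε₂` and `½(-1,-1,1)`, the last one being odd.
-/
theorem lie_brownE_brownF {s t : S k V} (hom : om v s t = hc v ![-(1 / 2), -(1 / 2), 1 / 2])
    (i j : Fin 3) : ⁅brownE v i, brownF v j⁆ + om v (![0, 0, s] i) (![0, 0, t] j) =
      if i = j then hc v (brownH i) else 0 := by
  fin_cases i <;> fin_cases j <;>
    simp [brownE, brownF, brownH, om_zero_left, om_zero_right, lie_fv_fv, hom, hc_eq,
      Fin.sum_univ_three, sub_eq_add_neg]

theorem R_brownE_brownF (r : k) (i j : Fin 3) :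
    R v (brownE v i) (![0, 0, r • wd v [0, 1]] j) = R v (brownF v j) (![0, 0, wd v [2]] i) := by
  fin_cases i <;> fin_cases j <;>
    simp [brownE, brownF, R_zero, R_fv_wd_of_mem, R_fv_wd_of_notMem]

omit [NeZero (2 : k)] in
theorem forall_fin_three {P : Fin 3 → Prop} (h0 : P 0) (h1 : P 1) (h2 : P 2) (i : Fin 3) :
    P i := by
  fin_cases i
  exacts [h0, h1, h2]

/-- The Cartan matrix of Brown's algebra. -/
abbrev brownC : Matrix (Fin 3) (Fin 3) ℤ := !![2, -1, 0; -1, 2, -1; 0, -1, 0]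

theorem lie_brownH_brownE (i j : Fin 3) :
    ⁅hc v (brownH i), brownE v j⁆ = (brownC i j : k) • brownE v j := by
  have h2 : (2 : k) ≠ 0 := NeZero.ne _
  fin_cases i <;> fin_cases j <;>
    simp [brownE, brownH, lie_hc_sg_fv, brownC] <;> match_scalars <;> field_simp <;> norm_num

theorem lie_brownH_brownF (i j : Fin 3) :
    ⁅hc v (brownH i), brownF v j⁆ = -((brownC i j : k) • brownF v j) := by
  have h2 : (2 : k) ≠ 0 := NeZero.ne _
  fin_cases i <;> fin_cases j <;>
    simp [brownF, brownH, lie_hc_sg_fv, brownC] <;> match_scalars <;> field_simp <;> norm_num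

/-- The odd coroot has eigenvalue `3/4` on its own root vector, so the diagonal entry `0` of the
matrix is where characteristic `3` enters. -/
theorem R_brownH_two (h3 : (3 : k) = 0) (i : Fin 3) :
    R v (hc v (brownH i)) (wd v [2]) = (brownC i 2 : k) • wd v [2] := by
  have h2 : (2 : k) ≠ 0 := NeZero.ne _
  rw [R_hc_wd]
  congr 1
  refine forall_fin_three (P := fun i => (1 / 2 * ∑ a, if a ∈ [2] then (brownH i a : k) else
    -brownH i a) = brownC i 2) ?_ ?_ ?_ i <;> simp [brownH, brownC, Fin.sum_univ_three]
  · field_simp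
    norm_num
  · field_simp
    exact Or.inr (by linear_combination h3)

theorem R_brownH_zero_one (h3 : (3 : k) = 0) (i : Fin 3) :
    R v (hc v (brownH i)) (wd v [0, 1]) = (-(brownC i 2 : k)) • wd v [0, 1] := by
  have h2 : (2 : k) ≠ 0 := NeZero.ne _
  rw [R_hc_wd]
  congr 1
  refine forall_fin_three (P := fun i => (1 / 2 * ∑ a, if a ∈ [0, 1] then (brownH i a : k) else
    -brownH i a) = -(brownC i 2 : k)) ?_ ?_ ?_ i <;> simp [brownH, brownC, Fin.sum_univ_three]
  · field_simp
    norm_num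
  · field_simp
    exact Or.inr (by linear_combination -h3)

omit [NeZero (2 : k)] in
theorem torus_three (r : k) (t : Fin 3 → kˣ) : ∃ (τ : Fin 3 → kˣ) (a : k),
    a ^ 2 * ∏ i, (τ i : k) = 1 ∧
    (∀ i, conjSo v τ (brownE v i) = (t i : k) • brownE v i) ∧
    (∀ i, conjSo v τ (brownF v i) = (t i : k)⁻¹ • brownF v i) ∧
    (∀ i, a • diagS v τ (![0, 0, wd v [2]] i) = (t i : k) • ![0, 0, wd v [2]] i) ∧
    ∀ i, a • diagS v τ (![0, 0, r • wd v [0, 1]] i) =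
      (t i : k)⁻¹ • ![0, 0, r • wd v [0, 1]] i := by
  have ht := fun i => (t i).ne_zero
  -- The even generators force `τ = (t₀t₁y, t₁y, y)` and the odd one forces `a = t₂ / y`; then `a²
  -- τ₀τ₁τ₂ = 1` is linear in `y`.
  obtain ⟨y, hy⟩ : ∃ y : kˣ, y = (t 2 ^ 2 * t 0 * t 1 ^ 2)⁻¹ := ⟨_, rfl⟩
  have hy' : (t 2 : k) ^ 2 * t 0 * t 1 ^ 2 * y = 1 := by
    have := congrArg Units.val (mul_inv_cancel (t 2 ^ 2 * t 0 * t 1 ^ 2))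
    rw [← hy] at this
    simpa only [Units.val_mul, Units.val_pow_eq_pow_val, Units.val_one] using this
  have hy0 := y.ne_zero
  refine ⟨![t 0 * t 1 * y, t 1 * y, y], (t 2 : k) / y, ?_, ?_, ?_, ?_, ?_⟩
  · rw [Fin.prod_univ_three]
    simp only [Matrix.cons_val, Units.val_mul]
    field_simp
    linear_combination hy'
  · refine forall_fin_three ?_ ?_ ?_
    all_goals simp only [brownE, Matrix.cons_val, map_zero, smul_zero, conjSo_fv, Units.val_mul]
    all_goals congr 1; field_simp [ht]
  · refine forall_fin_three ?_ ?_ ?_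
    all_goals simp only [brownF, Matrix.cons_val, map_zero, smul_zero, conjSo_fv, Units.val_mul]
    all_goals congr 1; field_simp [ht]
  · refine forall_fin_three ?_ ?_ ?_
    all_goals simp only [Matrix.cons_val, map_zero, smul_zero, diagS_wd, smul_smul,
      List.map_cons, List.map_nil, List.prod_cons, List.prod_nil]
    congr 1
    field_simp
  · refine forall_fin_three ?_ ?_ ?_
    all_goals simp only [Matrix.cons_val, map_zero, smul_zero, map_smul, diagS_wd, smul_smul,
      List.map_cons, List.map_nil, List.prod_cons, List.prod_nil, Units.val_mul]
    congr 1
    have := ht 2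
    field_simp
    linear_combination r * hy'

theorem isoLie_gMul_three [Infinite k] (h3 : (3 : k) = 0) (hμ : IsLieProduct (gMul v)) :
    IsoLie (gMul v) (Brown k) ∧ LieAlgebra.IsSimple k (Brown k) := by
  have h2 : (2 : k) ≠ 0 := NeZero.ne _
  -- The factor is `1 / β`, half of that for `F₄`, since the coroot here carries the entries `±½`.
  obtain ⟨β, hβ⟩ : ∃ β, β = bb v (wd v [2]) (wd v [0, 1]) := ⟨_, rfl⟩
  have hβ0 : β ≠ 0 := hβ ▸ bb_wd_ne_zero v (by decide) rfl
  have hom : om v (wd v [2]) ((1 / β) • wd v [0, 1]) = hc v ![-(1 / 2), -(1 / 2), 1 / 2] := by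
    have := congrArg (fun x => (1 / β) • (1 / 2 : k) • x)
      (om_cr_one_wd v (a := 2) (L := [0, 1]) (by decide) rfl)
    simp only [← hβ, smul_smul] at this
    rw [om_smul_right]
    convert this using 1
    · congr 1
      field_simp
    · rw [hc_smul]
      congr 1
      ext i
      fin_cases i <;> simp <;> field_simp
  refine isoLie_gMul v (s := ![0, 0, wd v [2]]) (s' := ![0, 0, (1 / β) • wd v [0, 1]])
    brownC le_rfl hμ (lie_brownE_brownF v hom) (R_brownE_brownF v _)
    (lie_brownH_brownE v) (fun i => forall_fin_three ?_ ?_ (R_brownH_two v h3 i))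
    (lie_brownH_brownF v) (fun i => forall_fin_three ?_ ?_ ?_) ?_
    (forall_fin_three (.inl (sg_fv_ne_zero v 0 1)) (.inl (sg_fv_ne_zero v 1 2))
      (.inr (wd_ne_zero v (by decide))))
    (forall_fin_three (.inr rfl) (.inr rfl) (.inl rfl))
    (forall_fin_three (.inr rfl) (.inr rfl) (.inl rfl))
    (fun P Q _ g2 g3 g4 g5 g6 g7 => ?_) (torus_three v _)
  iterate 2 exact (map_zero _).trans (smul_zero _).symm
  iterate 2 exact (map_zero _).trans (neg_eq_zero.2 (smul_zero _)).symm
  · change R v (hc v (brownH i)) ((1 / β) • wd v [0, 1]) = _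
    rw [map_smul, R_brownH_zero_one v h3, smul_comm, neg_smul]
    rfl
  · have hd : brownC.det = -2 := by decide
    have := (Int.castRingHom k).map_det brownC
    rw [hd, map_neg] at this
    refine this ▸ neg_ne_zero.2 ?_
    simpa using h2
  · have : wd v [0, 1] ∈ Q := by
      have := Q.smul_mem (1 / β)⁻¹ (g7 2)
      exact (inv_smul_smul₀ (div_ne_zero one_ne_zero hβ0) (wd v [0, 1])) ▸ this
    exact eq_top_of_generators_three v g2 g3 (g4 0) (g4 1) (g5 0) (g5 1) (g6 2) this

end Brown

/-! ### Dimensions of `so(W,q)` and `S`. -/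

section Dimension

variable {l : ℕ} (v : Module.Basis (Fin l) k V) [NeZero (2 : k)]

theorem pol_ap_self (A : so k V) (x : W k V) : pol (ap A x) x = 0 := by
  have := pol_ap A x x
  rw [pol_comm x, eq_neg_iff_add_eq_zero, ← two_mul] at this
  exact (mul_eq_zero.1 this).resolve_left (NeZero.ne _)

omit [NeZero (2 : k)] in
theorem pol_ap_swap (A : so k V) (x y : W k V) : pol (ap A x) y = -pol (ap A y) x := by
  rw [pol_ap, pol_comm]

include v in
theorem polarBilin_nondegenerate : LinearMap.BilinForm.Nondegenerate (qW k V).polarBilin := by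
  have h : ∀ x : W k V, (∀ y, (qW k V).polarBilin x y = 0) → x = 0 := fun x hx => by
    have hx' : ∀ y, pol y x = 0 := fun y => by rw [pol_comm, pol_def]; exact hx y
    exact W_ext v (by rw [hx', pol_zero_right]) (fun i => by rw [hx', pol_zero_right])
      fun i => by rw [hx', pol_zero_right]
  exact ⟨h, fun x hx => h x fun y => by rw [polar_comm]; exact hx y⟩

/-- The coordinates of the alternating form `q(Ax, y)` in a basis of `W`. -/
def soCoord {n : ℕ} (b : Fin n → W k V) :
    so k V →ₗ[k] {p : Fin n × Fin n // p.1 < p.2} → k where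
  toFun A p := pol (ap A (b p.1.1)) (b p.1.2)
  map_add' A B := by
    funext p
    rw [add_ap, pol_add_left]; rfl
  map_smul' c A := by
    funext p
    rw [smul_ap, pol_smul_left]; rfl

omit [NeZero (2 : k)] in
theorem soCoord_apply {n : ℕ} (b : Fin n → W k V) (A : so k V)
    (p : {p : Fin n × Fin n // p.1 < p.2}) :
    soCoord b A p = pol (ap A (b p.1.1)) (b p.1.2) := rfl

-- A skew map is determined by the entries above the diagonal of the alternating form `q(Ax, y)`,
-- and the `σ`'s of dual basis vectors realise each such entry separately.
include v in
theorem finrank_so {n : ℕ} (hn : Module.finrank k (W k V) = n) :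
    Module.finrank k (so k V) = Fintype.card {p : Fin n × Fin n // p.1 < p.2} := by
  have : FiniteDimensional k V := Module.Finite.of_basis v
  let b := Module.finBasisOfFinrankEq k (W k V) hn
  obtain ⟨d, hd⟩ : ∃ d : Fin n → W k V, ∀ i j, pol (d i) (b j) = if j = i then 1 else 0 :=
    ⟨LinearMap.BilinForm.dualBasis (qW k V).polarBilin (polarBilin_nondegenerate v) b,
      fun i j => by
        rw [pol_def]
        exact LinearMap.BilinForm.apply_dualBasis_left (polarBilin_nondegenerate v) b i j⟩
  have hinj : Function.Injective (soCoord b) := by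
    rw [← LinearMap.ker_eq_bot, LinearMap.ker_eq_bot']
    intro A hA
    have h1 : ∀ i j, i < j → pol (ap A (b i)) (b j) = 0 := fun i j hij => by
      rw [← soCoord_apply b A ⟨(i, j), hij⟩, hA]; rfl
    have h2 : ∀ i j, pol (ap A (b i)) (b j) = 0 := fun i j => by
      rcases lt_trichotomy i j with h | rfl | h
      · exact h1 i j h
      · exact pol_ap_self A _
      · rw [pol_ap_swap, h1 j i h, neg_zero]
    have h3 : ∀ i y, pol (ap A (b i)) y = 0 := fun i y => by
      rw [← b.sum_repr y, pol_sum_right]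
      exact Finset.sum_eq_zero fun j _ => by rw [pol_smul_right, h2, mul_zero]
    have h4 : ∀ x y, pol (ap A x) y = 0 := fun x y => by
      rw [pol_ap, ← b.sum_repr x, pol_comm, pol_sum_right, neg_eq_zero]
      exact Finset.sum_eq_zero fun j _ => by
        rw [pol_smul_right, pol_comm, ← neg_eq_zero, ← mul_neg, ← pol_ap, h3, mul_zero]
    refine so_ext fun x => ?_
    rw [zero_ap]
    have h5 : ∀ y, pol y (ap A x) = 0 := fun y => by rw [pol_comm, h4]
    exact W_ext v (by rw [h5, pol_zero_right]) (fun i => by rw [h5, pol_zero_right])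
      fun i => by rw [h5, pol_zero_right]
  have hsurj : Function.Surjective (soCoord b) := by
    rw [← LinearMap.range_eq_top, eq_top_iff]
    intro c _
    have : c = ∑ p, c p • soCoord b (sg (d p.1.1) (d p.1.2)) := by
      funext q
      rw [Finset.sum_apply, Finset.sum_eq_single q]
      · rw [Pi.smul_apply, soCoord_apply, sg_ap, pol_sub_left, pol_smul_left, pol_smul_left, hd, hd,
          hd, hd, if_pos rfl, if_pos rfl, if_neg q.2.ne, zero_mul, sub_zero, mul_one, smul_eq_mul,
          mul_one]
      · intro p _ hp
        rw [Pi.smul_apply, soCoord_apply, sg_ap, pol_sub_left, pol_smul_left, pol_smul_left, hd, hd,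
          hd, hd]
        have h1 : ¬(q.1.1 = p.1.1 ∧ q.1.2 = p.1.2) := fun h =>
          hp (Subtype.ext (Prod.ext h.1.symm h.2.symm))
        have h2 : ¬(q.1.1 = p.1.2 ∧ q.1.2 = p.1.1) := fun h => by
          have := q.2
          rw [h.1, h.2] at this
          exact lt_asymm this p.2
        simp only [mul_ite, mul_one, mul_zero, ← ite_and]
        rw [if_neg (fun h => h1 h.symm), if_neg (fun h => h2 h.symm), sub_zero, smul_zero]
      · exact fun h => absurd (Finset.mem_univ q) h
    rw [this]
    exact Submodule.sum_mem _ fun p _ => Submodule.smul_mem _ _ ⟨_, rfl⟩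
  rw [(LinearEquiv.ofBijective (soCoord b) ⟨hinj, hsurj⟩).finrank_eq, Module.finrank_fintype_fun_eq_card]

omit [NeZero (2 : k)] in
include v in
theorem finrank_W : Module.finrank k (W k V) = 2 * l + 1 := by
  have : FiniteDimensional k V := Module.Finite.of_basis v
  rw [Module.finrank_prod, Module.finrank_prod, Subspace.dual_finrank_eq,
    Module.finrank_eq_card_basis v, Fintype.card_fin, Module.finrank_self, two_mul]

omit [NeZero (2 : k)] in
include v in
theorem finrank_S : Module.finrank k (S k V) = 2 ^ l := by
  rw [Module.finrank_eq_card_basis v.ExteriorAlgebra, Fintype.card_finset, Fintype.card_fin]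

theorem finrank_so_prod_S (v : Module.Basis (Fin 3) k V) :
    Module.finrank k (so k V × S k V) = 29 := by
  have : FiniteDimensional k V := Module.Finite.of_basis v
  have : FiniteDimensional k (S k V) := Module.Finite.of_basis v.ExteriorAlgebra
  have : FiniteDimensional k (so k V) := FiniteDimensional.finiteDimensional_submodule (so k V).toSubmodule
  rw [Module.finrank_prod, finrank_so v (finrank_W v), finrank_S v]
  rfl

end Dimension

/-! ### Recognition of `osp(1, 2n)`. -/

section Orthosymplectic

open Matrix

variable {n : Type*} [Fintype n] [DecidableEq n] {L M : Type*} [LieRing L] [LieAlgebra k L]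
  [AddCommGroup M] [Module k M] (s : Module.Basis (n ⊕ n) k M)

/-- The coordinates of a vector, as a matrix with one column. -/
def column : M →ₗ[k] Matrix (n ⊕ n) (Fin 1) k where
  toFun x := Matrix.of fun i _ => s.repr x i
  map_add' x y := by ext; simp
  map_smul' c x := by ext; simp

omit [Fintype n] [DecidableEq n] in
theorem column_apply (x : M) (i : n ⊕ n) (j : Fin 1) : column s x i j = s.repr x i := rfl

omit [Fintype n] [DecidableEq n] in
theorem column_injective : Function.Injective (column s) := fun _ _ h =>
  s.repr.injective (Finsupp.ext fun i => congrFun (congrFun h i) 0)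

theorem toMatrix_mul_column (D : Module.End k M) (x : M) :
    LinearMap.toMatrix s s D * column s x = column s (D x) := by
  ext i j
  rw [column_apply, ← LinearMap.toMatrix_mulVec_repr s s]
  rfl

/-- The matrix in `osp(1, 2n)` that belongs to an element of `L ⊕ M`. -/
def superMatrix (ρ : L →ₗ[k] Module.End k M) : (L × M) →ₗ[k] SuperMatrix k (Fin 1) n where
  toFun x := fromBlocks 0 (-((column s x.2)ᵀ * Matrix.J n k)) (column s x.2)
    (LinearMap.toMatrix s s (ρ x.1))
  map_add' x y := by
    rw [fromBlocks_add, Prod.fst_add, Prod.snd_add, map_add, map_add, map_add, transpose_add,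
      Matrix.add_mul, neg_add, add_zero]
  map_smul' c x := by
    rw [RingHom.id_apply, fromBlocks_smul, Prod.smul_fst, Prod.smul_snd, map_smul, map_smul,
      map_smul, transpose_smul, Matrix.smul_mul, smul_neg, smul_zero]

theorem superMatrix_apply (ρ : L →ₗ[k] Module.End k M) (x : L × M) : superMatrix s ρ x =
    fromBlocks 0 (-((column s x.2)ᵀ * Matrix.J n k)) (column s x.2)
      (LinearMap.toMatrix s s (ρ x.1)) := rfl

variable {s} {β : LinearMap.BilinForm k M} (hβ : ∀ i j, β (s i) (s j) = Matrix.J n k i j)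

include hβ

theorem apply_eq_sum (x : M) (j : n ⊕ n) : β x (s j) = ∑ i, s.repr x i * Matrix.J n k i j := by
  conv_lhs => rw [← s.sum_repr x]
  simp only [map_sum, map_smul, LinearMap.sum_apply, LinearMap.smul_apply, hβ, smul_eq_mul]

theorem transpose_toMatrix_mul_J (D : Module.End k M) (i j : n ⊕ n) :
    ((LinearMap.toMatrix s s D)ᵀ * Matrix.J n k) i j = β (D (s i)) (s j) := by
  rw [apply_eq_sum hβ, Matrix.mul_apply]
  simp only [transpose_apply, LinearMap.toMatrix_apply]

theorem J_mul_toMatrix (D : Module.End k M) (i j : n ⊕ n) :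
    (Matrix.J n k * LinearMap.toMatrix s s D) i j = β (s i) (D (s j)) := by
  conv_rhs => rw [← s.sum_repr (D (s j))]
  rw [Matrix.mul_apply]
  simp only [map_sum, map_smul, hβ, smul_eq_mul, LinearMap.toMatrix_apply]
  exact Finset.sum_congr rfl fun _ _ => mul_comm _ _

theorem skew_iff (D : Module.End k M) :
    (LinearMap.toMatrix s s D)ᵀ * Matrix.J n k + Matrix.J n k * LinearMap.toMatrix s s D = 0 ↔
      ∀ x y, β (D x) y = -β x (D y) := by
  constructor
  · intro h
    have h1 : ∀ i j, β (D (s i)) (s j) = -β (s i) (D (s j)) := fun i j => by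
      rw [← transpose_toMatrix_mul_J hβ, ← J_mul_toMatrix hβ, eq_neg_iff_add_eq_zero]
      exact congrFun (congrFun h i) j
    have h2 : β ∘ₗ D = -(β.compl₂ D) := s.ext fun i => s.ext fun j => h1 i j
    exact fun x y => LinearMap.congr_fun (LinearMap.congr_fun h2 x) y
  · intro h
    ext i j
    rw [Matrix.add_apply, transpose_toMatrix_mul_J hβ, J_mul_toMatrix hβ, h, neg_add_cancel]
    rfl

theorem superMatrix_mem {ρ : L →ₗ[k] Module.End k M}
    (hρ : ∀ A x y, β (ρ A x) y = -β x (ρ A y)) (x : L × M) :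
    superMatrix s ρ x ∈ osp k (Fin 1) n := by
  refine (ospCondition_iff _).2 ?_
  rw [superMatrix_apply]
  simp only [toBlocks_fromBlocks₁₁, toBlocks_fromBlocks₁₂, toBlocks_fromBlocks₂₁,
    toBlocks_fromBlocks₂₂]
  refine ⟨by rw [transpose_zero, add_zero], add_neg_cancel _, ?_, (skew_iff hβ _).2 (hρ x.1)⟩
  rw [transpose_neg, neg_neg, transpose_mul, transpose_transpose, Matrix.J_transpose,
    Matrix.neg_mul, neg_add_cancel]

/-- The block for two odd elements is the sum of two column-times-row matrices, which is the rank
one formula `ho` in coordinates; the mixed blocks use that `ρ A` is skew. -/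
theorem superMatrix_mul {μ : (L × M) →ₗ[k] (L × M) →ₗ[k] (L × M)} {ρ : L →ₗ[k] Module.End k M}
    {o : M →ₗ[k] M →ₗ[k] L}
    (hμ : ∀ x y, μ x y = (⁅x.1, y.1⁆ + o x.2 y.2, ρ x.1 y.2 - ρ y.1 x.2))
    (hlie : ∀ A B, ρ ⁅A, B⁆ = ρ A * ρ B - ρ B * ρ A)
    (hρ : ∀ A x y, β (ρ A x) y = -β x (ρ A y))
    (ho : ∀ x y z, ρ (o x y) z = -(β x z • y + β y z • x)) (x y : L × M) :
    superMatrix s ρ (μ x y) = superComm (superMatrix s ρ x) (superMatrix s ρ y) := by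
  have hodd : ∀ x y, LinearMap.toMatrix s s (ρ (o x y)) =
      column s x * (-((column s y)ᵀ * Matrix.J n k)) +
        column s y * (-((column s x)ᵀ * Matrix.J n k)) := fun x y => by
    have e : ∀ x y i j, (column s x * (-((column s y)ᵀ * Matrix.J n k))) i j =
        -(β y (s j) * s.repr x i) := fun x y i j => by
      rw [Matrix.mul_apply, Fin.sum_univ_one, apply_eq_sum hβ, column_apply, Matrix.neg_apply,
        Matrix.mul_apply, mul_neg, mul_comm]
      rfl
    ext i j
    rw [Matrix.add_apply, e, e, LinearMap.toMatrix_apply, ho]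
    simp only [map_neg, map_add, map_smul, Finsupp.coe_neg, Finsupp.coe_add, Finsupp.coe_smul,
      Pi.neg_apply, Pi.add_apply, Pi.smul_apply, smul_eq_mul]
    ring
  have hcol : ∀ A x, (column s (ρ A x))ᵀ * Matrix.J n k =
      -((column s x)ᵀ * Matrix.J n k * LinearMap.toMatrix s s (ρ A)) := fun A x => by
    rw [← toMatrix_mul_column, transpose_mul, Matrix.mul_assoc,
      eq_neg_of_add_eq_zero_left ((skew_iff hβ _).2 (hρ A)), Matrix.mul_neg, Matrix.mul_assoc]
  -- A `1 × 1` matrix equals its transpose while `J` is skew, so the upper left block of the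
  -- commutator vanishes.
  have hzero : ∀ x y, (column s x)ᵀ * Matrix.J n k * column s y +
      (column s y)ᵀ * Matrix.J n k * column s x = 0 := fun x y => by
    have e : ((column s x)ᵀ * Matrix.J n k * column s y)ᵀ =
        -((column s y)ᵀ * Matrix.J n k * column s x) := by
      rw [transpose_mul, transpose_mul, transpose_transpose, Matrix.J_transpose, Matrix.neg_mul,
        Matrix.mul_neg, Matrix.mul_assoc]
    have e' : ((column s x)ᵀ * Matrix.J n k * column s y)ᵀ =
        (column s x)ᵀ * Matrix.J n k * column s y := by
      ext i j
      rw [transpose_apply, Subsingleton.elim i j]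
    rw [← e', e, neg_add_cancel]
  rw [superMatrix_apply, superMatrix_apply, superMatrix_apply, superComm_fromBlocks, hμ]
  simp only
  rw [map_add, map_add, hlie, hodd, map_sub, map_sub, LinearMap.toMatrix_mul,
    LinearMap.toMatrix_mul, transpose_sub, Matrix.sub_mul, hcol, hcol, toMatrix_mul_column,
    toMatrix_mul_column]
  refine congr (congr (congrArg₂ fromBlocks ?_ ?_) ?_) ?_
  · rw [Matrix.mul_zero, Matrix.neg_mul, Matrix.neg_mul, zero_add, sub_zero, ← neg_add, hzero, neg_zero]
  · simp only [Matrix.zero_mul, Matrix.neg_mul]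
    abel
  · simp only [Matrix.mul_zero]
    abel
  · abel

/-- The symplectic analogue of `so_expand`: summing the products of a dual basis `d i` with `D (s
i)` produces `-2 D`, once from each of the two terms of `ho`. -/
theorem exists_rho_eq [NeZero (2 : k)] {ρ : L →ₗ[k] Module.End k M} {o : M →ₗ[k] M →ₗ[k] L}
    (ho : ∀ x y z, ρ (o x y) z = -(β x z • y + β y z • x)) {D : Module.End k M}
    (hD : ∀ x y, β (D x) y = -β x (D y)) : ∃ A, ρ A = D := by
  have h2 : (2 : k) ≠ 0 := NeZero.ne _
  obtain ⟨d, hd⟩ : ∃ d : n ⊕ n → M, ∀ i, d i = -∑ a, Matrix.J n k i a • s a := ⟨_, fun _ => rfl⟩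
  have hJ := Matrix.J_squared n k
  have h1 : ∀ i j, β (d i) (s j) = if i = j then 1 else 0 := fun i j => by
    have := congrFun (congrFun hJ i) j
    rw [Matrix.mul_apply, Matrix.neg_apply, Matrix.one_apply] at this
    rw [hd]
    simp only [map_neg, map_sum, map_smul, LinearMap.neg_apply, LinearMap.sum_apply,
      LinearMap.smul_apply, hβ, smul_eq_mul]
    rw [this, neg_neg]
  have h3 : ∀ y, ∑ i, β (s i) y • d i = -y := fun y => by
    have : ∑ i, (β (s i)).smulRight (d i) = -LinearMap.id := s.ext fun j => by
      rw [LinearMap.sum_apply]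
      simp only [LinearMap.smulRight_apply, hβ, hd, smul_neg, Finset.sum_neg_distrib,
        LinearMap.neg_apply, LinearMap.id_apply, Finset.smul_sum, smul_smul]
      rw [Finset.sum_comm]
      simp only [← Finset.sum_smul]
      congr 1
      have e : ∀ a, ∑ i, Matrix.J n k i j * Matrix.J n k i a = if j = a then 1 else 0 := fun a => by
        have h4 : (Matrix.J n k)ᵀ * Matrix.J n k = 1 := by
          rw [Matrix.J_transpose, Matrix.neg_mul, hJ, neg_neg]
        have := congrFun (congrFun h4 j) a
        rwa [Matrix.mul_apply, Matrix.one_apply] at this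
      simp only [e, ite_smul, one_smul, zero_smul, Finset.sum_ite_eq, Finset.mem_univ, if_true]
    simpa using LinearMap.congr_fun this y
  refine ⟨-(1 / 2 : k) • ∑ i, o (d i) (D (s i)), s.ext fun j => ?_⟩
  rw [map_smul, map_sum, LinearMap.smul_apply, LinearMap.sum_apply]
  simp only [ho, h1, hD, neg_smul, Finset.sum_neg_distrib, Finset.sum_add_distrib, h3, ite_smul,
    one_smul, zero_smul, Finset.sum_ite_eq', Finset.mem_univ, if_true]
  match_scalars
  field_simp
  norm_num

/-- A sum `L ⊕ M` with `L` the symplectic Lie algebra of `M` is an orthosymplectic Lie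
superalgebra. -/
theorem isoSuper_osp [NeZero (2 : k)] {μ : (L × M) →ₗ[k] (L × M) →ₗ[k] (L × M)}
    {ρ : L →ₗ[k] Module.End k M} {o : M →ₗ[k] M →ₗ[k] L}
    (hμ : ∀ x y, μ x y = (⁅x.1, y.1⁆ + o x.2 y.2, ρ x.1 y.2 - ρ y.1 x.2))
    (hlie : ∀ A B, ρ ⁅A, B⁆ = ρ A * ρ B - ρ B * ρ A) (hinj : ∀ A, ρ A = 0 → A = 0)
    (hρ : ∀ A x y, β (ρ A x) y = -β x (ρ A y))
    (ho : ∀ x y z, ρ (o x y) z = -(β x z • y + β y z • x)) :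
    IsoSuper (fun i : ZMod 2 => if i = 0 then Submodule.prod ⊤ ⊥ else Submodule.prod ⊥ ⊤) μ
      (ospGrading k (Fin 1) n) (ospMul k (Fin 1) n) := by
  have h2 : (2 : k) ≠ 0 := NeZero.ne _
  let f : (L × M) →ₗ[k] osp k (Fin 1) n :=
    (superMatrix s ρ).codRestrict _ (superMatrix_mem hβ hρ)
  have hf : ∀ x, (f x : SuperMatrix k (Fin 1) n) = superMatrix s ρ x := fun x => rfl
  have h12 : ∀ x, (f x : SuperMatrix k (Fin 1) n).toBlocks₁₂ =
      -((column s x.2)ᵀ * Matrix.J n k) := fun x => toBlocks_fromBlocks₁₂ _ _ _ _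
  have h21 : ∀ x, (f x : SuperMatrix k (Fin 1) n).toBlocks₂₁ = column s x.2 :=
    fun x => toBlocks_fromBlocks₂₁ _ _ _ _
  have h22 : ∀ x, (f x : SuperMatrix k (Fin 1) n).toBlocks₂₂ = LinearMap.toMatrix s s (ρ x.1) :=
    fun x => toBlocks_fromBlocks₂₂ _ _ _ _
  have h11 : ∀ x, (f x : SuperMatrix k (Fin 1) n).toBlocks₁₁ = 0 :=
    fun x => toBlocks_fromBlocks₁₁ _ _ _ _
  have even : ∀ x : L × M, LinearMap.toMatrix s s (ρ x.1) = 0 → x.1 = 0 := fun x h =>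
    hinj _ ((LinearMap.toMatrix s s).injective (h.trans (map_zero _).symm))
  have odd : ∀ x : L × M, column s x.2 = 0 → x.2 = 0 := fun x h =>
    column_injective s (h.trans (map_zero _).symm)
  have finj : Function.Injective f := by
    rw [← LinearMap.ker_eq_bot, LinearMap.ker_eq_bot']
    intro x hx
    refine Prod.ext (even x ?_) (odd x ?_)
    · rw [← h22, hx]; rfl
    · rw [← h21, hx]; rfl
  have fsurj : Function.Surjective f := by
    rintro ⟨X, hX⟩
    obtain ⟨c1, c2, c3, c4⟩ := (ospCondition_iff X).1 hX
    obtain ⟨A, hA⟩ := exists_rho_eq (D := (LinearMap.toMatrix s s).symm X.toBlocks₂₂) hβ ho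
      ((skew_iff hβ _).1 (by rw [LinearEquiv.apply_symm_apply]; exact c4))
    obtain ⟨x, hx⟩ : ∃ x, column s x = X.toBlocks₂₁ :=
      ⟨s.equivFun.symm fun i => X.toBlocks₂₁ i 0, by
        ext i j
        rw [column_apply, ← s.equivFun_apply, LinearEquiv.apply_symm_apply, Subsingleton.elim j 0]⟩
    refine ⟨(A, x), Subtype.ext ?_⟩
    rw [hf, superMatrix_apply]
    refine Eq.trans ?_ (fromBlocks_toBlocks X)
    refine congr (congr (congrArg₂ fromBlocks ?_ ?_) ?_) ?_
    -- A skew `1 × 1` matrix is zero because `2` is invertible.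
    · ext i j
      have := congrFun (congrFun c1 i) j
      rw [Matrix.add_apply, transpose_apply, Subsingleton.elim i j, ← two_mul] at this
      rw [Subsingleton.elim i j]
      exact ((mul_eq_zero.1 this).resolve_left h2).symm
    · change -((column s x)ᵀ * Matrix.J n k) = _
      rw [hx]
      exact (eq_neg_of_add_eq_zero_right c2).symm
    · exact hx
    · change LinearMap.toMatrix s s (ρ A) = _
      rw [hA, LinearEquiv.apply_symm_apply]
  refine ⟨LinearEquiv.ofBijective f ⟨finj, fsurj⟩, fun x y => Subtype.ext ?_, fun i => ?_⟩
  · exact superMatrix_mul hβ hμ hlie hρ ho x y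
  · have key : ∀ x : L × M, (x ∈ (if i = 0 then Submodule.prod ⊤ ⊥ else Submodule.prod ⊥ ⊤ : Submodule k (L × M))) ↔
        f x ∈ ospGrading k (Fin 1) n i := fun x => by
      change _ ↔ if i = 0 then _ ∧ _ else _ ∧ _
      by_cases hi : i = 0
      · rw [if_pos hi, if_pos hi, Submodule.mem_prod, h12, h21]
        refine ⟨fun h => ?_, fun h => ⟨trivial, odd x h.2⟩⟩
        have h0 : x.2 = 0 := h.2
        rw [h0, map_zero, transpose_zero, Matrix.zero_mul, neg_zero]
        exact ⟨rfl, rfl⟩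
      · rw [if_neg hi, if_neg hi, Submodule.mem_prod, h11, h22]
        refine ⟨fun h => ?_, fun h => ⟨even x h.2, trivial⟩⟩
        have h0 : x.1 = 0 := h.1
        rw [h0, map_zero, map_zero]
        exact ⟨rfl, rfl⟩
    refine le_antisymm ?_ fun X hX => ?_
    · rintro _ ⟨x, hx, rfl⟩
      exact (key x).1 hx
    · obtain ⟨x, rfl⟩ := fsurj X
      exact ⟨x, (key x).2 hX, rfl⟩

end Orthosymplectic

/-! ### Ranks one and two. -/

section SmallRank

variable {l : ℕ} (v : Module.Basis (Fin l) k V) [NeZero (2 : k)]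

theorem R_R_om (A : so k V) (r s t : S k V) : R v A (R v (om v r s) t) =
    R v (om v (R v A r) s) t + R v (om v r (R v A s)) t + R v (om v r s) (R v A t) := by
  have := LinearMap.congr_fun (R_lie v A (om v r s)) t
  rw [lie_om, R_add, LinearMap.add_apply, LinearMap.sub_apply, Module.End.mul_apply,
    Module.End.mul_apply] at this
  rw [this, sub_add_cancel]

omit [NeZero (2 : k)] in
theorem bb_wd_tp (L : List (Fin l)) : bb v (wd v L) (tp v) = if L = [] then 1 else 0 := by
  cases L with
  | nil => rw [wd_nil, bb_one_tp, if_pos rfl]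
  | cons i L => rw [wd_cons, bb_cr, cr_tp, bb_zero_right, neg_zero, if_neg (List.cons_ne_nil i L)]

/-- The difference of the two sides is equivariant, so words in the position `(1, w, tp v)` suffice.
For `l ≤ 2` the value of `gg` is `l/2` in every codegree below `l`, and `l` in codegree `l`, where
both terms on the right contribute. -/
theorem R_om_of_le_two (h1 : 1 ≤ l) (h2 : l ≤ 2) (r s t : S k V) : (4 : k) • R v (om v r s) t =
    -((l : k) • (bb v r t • s + bb v s t • r)) := by
  rw [eq_neg_iff_add_eq_zero]
  refine eq_zero_of_equivariant v
    (fun r s t => (4 : k) • R v (om v r s) t + (l : k) • (bb v r t • s + bb v s t • r))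
    ?_ ?_ ?_ ?_ ?_ ?_ r s t
  · intro r r' s t
    simp only [om_add_left, R_add, LinearMap.add_apply, bb_add_left]; module
  · intro c r s t
    simp only [om_smul_left, R_smul, LinearMap.smul_apply, bb_smul_left]; module
  · intro r s t t'
    simp only [map_add, bb_add_right]; module
  · intro c r s t
    simp only [map_smul, bb_smul_right]; module
  · intro A r s t
    simp only [map_add, map_smul, R_R_om, bb_R v A]; module
  · intro s
    induction s using wd_induction v with
    | h0 => simp only [om_zero_right, R_zero, LinearMap.zero_apply, bb_zero_left, smul_zero,
        zero_smul, add_zero]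
    | hadd s t hs ht =>
      have := congrArg₂ (· + ·) hs ht
      simp only [add_zero] at this
      rw [← this]
      simp only [om_add_right, R_add, LinearMap.add_apply, bb_add_left]; module
    | hsmul c s hs =>
      have := congrArg (c • ·) hs
      simp only [smul_zero] at this
      rw [← this]
      simp only [om_smul_right, R_smul, LinearMap.smul_apply, bb_smul_left]; module
    | hwd L hL =>
      have hl : L.length ≤ l := by simpa using hL.length_le_card
      have h := R_om_one_wd v hL
      have n2 : (2 : k) ≠ 0 := NeZero.ne _
      have e : (4 : k) • R v (om v 1 (wd v L)) (tp v) =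
          -((2 * gg k l (l - L.length)) • wd v L) := by
        rw [show (4 : k) = 2 * 2 by norm_num, mul_smul, h, smul_neg, smul_smul]
      rw [e, bb_one_tp, bb_wd_tp]
      rcases L.eq_nil_or_concat' with rfl | ⟨L', i, rfl⟩
      · rw [if_pos rfl, wd_nil]
        obtain rfl | rfl : l = 1 ∨ l = 2 := by omega
        all_goals
          simp [gg]
          try module
      · have hn : L' ++ [i] ≠ [] := by simp
        have hlen : (L' ++ [i]).length = L'.length + 1 := by simp
        rw [if_neg hn]
        rw [hlen] at hl ⊢
        have hg : 2 * gg k l (l - (L'.length + 1)) = l := by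
          obtain rfl | rfl : l = 1 ∨ l = 2 := by omega
          · obtain h0 : L'.length = 0 := by omega
            rw [h0]
            simp [gg, n2]
          · obtain h0 | h0 : L'.length = 0 ∨ L'.length = 1 := by omega
            · rw [h0]
              simp [gg]
            · rw [h0]
              simp [gg, n2]
        rw [hg]
        module

/-- The factor `l / 4` is the one of `R_om_of_le_two`. The family `s` is a basis because its Gram
matrix is invertible and `2 ^ l = 2 * l` for these `l`. -/
theorem isoSuper_gMul (h1 : 1 ≤ l) (h2 : l ≤ 2) (s : Fin l ⊕ Fin l → S k V)
    (hs : ∀ i j, (l : k) / 4 * bb v (s i) (s j) = Matrix.J (Fin l) k i j) :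
    IsoSuper (gGrading k V) (gMul v) (ospGrading k (Fin 1) (Fin l)) (ospMul k (Fin 1) (Fin l)) := by
  have n4 : (4 : k) ≠ 0 := by
    rw [show (4 : k) = 2 * 2 by norm_num]
    exact mul_ne_zero (NeZero.ne _) (NeZero.ne _)
  obtain ⟨β, hb⟩ : ∃ β : LinearMap.BilinForm k (S k V), ∀ x y, β x y = (l : k) / 4 * bb v x y :=
    ⟨((l : k) / 4) • b v, fun x y => by unfold bb; rfl⟩
  have hβ : ∀ i j, β (s i) (s j) = Matrix.J (Fin l) k i j := fun i j => by rw [hb, hs]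
  have hli : LinearIndependent k s := by
    rw [Fintype.linearIndependent_iff]
    intro g hg i
    have h : Matrix.vecMul g (Matrix.J (Fin l) k) = 0 := by
      funext j
      have := congrArg (fun x => β x (s j)) hg
      simp only [map_sum, map_smul, LinearMap.sum_apply, LinearMap.smul_apply, hβ, map_zero,
        LinearMap.zero_apply, smul_eq_mul] at this
      exact this
    have h' := congrArg (fun x => Matrix.vecMul x (Matrix.J (Fin l) k)) h
    simp only [Matrix.vecMul_vecMul, Matrix.J_squared, Matrix.vecMul_neg, Matrix.vecMul_one,
      Matrix.zero_vecMul, neg_eq_zero] at h'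
    exact congrFun h' i
  have hcard : Fintype.card (Fin l ⊕ Fin l) = Module.finrank k (S k V) := by
    rw [finrank_S v, Fintype.card_sum, Fintype.card_fin]
    obtain rfl | rfl : l = 1 ∨ l = 2 := by omega
    · rfl
    · rfl
  have : Nonempty (Fin l ⊕ Fin l) := ⟨.inl ⟨0, h1⟩⟩
  refine isoSuper_osp (s := basisOfLinearIndependentOfCardEqFinrank hli hcard) (β := β)
    (ρ := rho v) (o := oddMul v) (fun i j => ?_) (fun _ _ => rfl) ?_ ?_ ?_ ?_
  · rw [coe_basisOfLinearIndependentOfCardEqFinrank, hβ]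
  · simpa only [rho_eq_R] using R_lie v
  · intro A hA
    rw [rho_eq_R] at hA
    exact eq_zero_of_R v hA
  · intro A x y
    rw [hb, hb, rho_eq_R, bb_R, mul_neg]
  · intro x y z
    rw [hb, hb, om_eq, rho_eq_R]
    have := R_om_of_le_two v h1 h2 x y z
    rw [← inv_smul_smul₀ n4 (R v (om v x y) z), this]
    match_scalars <;> field_simp

theorem isoSuper_gMul_one (v : Module.Basis (Fin 1) k V) :
    IsoSuper (gGrading k V) (gMul v) (ospGrading k (Fin 1) (Fin 1)) (ospMul k (Fin 1) (Fin 1)) := by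
  have h2 : (2 : k) ≠ 0 := NeZero.ne _
  have n4 : (4 : k) ≠ 0 := by
    rw [show (4 : k) = 2 * 2 by norm_num]
    exact mul_ne_zero h2 h2
  have ht : Phi v (wd v [0]) = 1 := Phi_tp v
  have p0 : Phi v (wd v []) = 0 := Phi_wd_of_length_ne v (by decide)
  have p2 : Phi v (wd v [0, 0]) = 0 := Phi_wd_of_length_ne v (by decide)
  refine isoSuper_gMul v le_rfl one_le_two
    (Sum.elim (fun _ => wd v []) fun _ => (-4 : k) • wd v [0]) ?_
  rintro (i | i) (j | j) <;> rw [Subsingleton.elim i 0, Subsingleton.elim j 0] <;>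
    simp [bb_neg_left, bb_neg_right, bb_smul_left, bb_smul_right, bb_wd, ht, p0, p2, Matrix.J, n4]

theorem isoSuper_gMul_two (v : Module.Basis (Fin 2) k V) :
    IsoSuper (gGrading k V) (gMul v) (ospGrading k (Fin 1) (Fin 2)) (ospMul k (Fin 1) (Fin 2)) := by
  have h2 : (2 : k) ≠ 0 := NeZero.ne _
  have n4 : (4 : k) ≠ 0 := by
    rw [show (4 : k) = 2 * 2 by norm_num]
    exact mul_ne_zero h2 h2
  have ht : Phi v (wd v [0, 1]) = 1 := Phi_tp v
  have ht' : Phi v (wd v [1, 0]) = -1 := by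
    rw [wd_cons, wd_cons, cr_cr, map_neg, ← wd_cons, ← wd_cons, ht]
  have p0 : Phi v (wd v []) = 0 := Phi_wd_of_length_ne v (by decide)
  have p1 : ∀ i, Phi v (wd v [i]) = 0 := fun i => Phi_wd_of_length_ne v (by simp)
  have p2 : ∀ i, Phi v (wd v [i, i]) = 0 := fun i => by rw [wd_eq_zero v (by simp), map_zero]
  have p3 : ∀ i j m, Phi v (wd v [i, j, m]) = 0 := fun i j m => Phi_wd_of_length_ne v (by simp)
  have p4 : ∀ i j m n, Phi v (wd v [i, j, m, n]) = 0 := fun i j m n =>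
    Phi_wd_of_length_ne v (by simp)
  -- The pairs `(1, v₀v₁)` and `(v₀, v₁)` have `b`-values `1` and `-1`; with `l / 4 = 1/2`, the
  -- factors `-2` and `2` bring both to the entry `-1` of `J`.
  refine isoSuper_gMul v one_le_two le_rfl
    (Sum.elim ![wd v [], wd v [0]] ![(-2 : k) • wd v [0, 1], (2 : k) • wd v [1]]) ?_
  rintro (i | i) (j | j) <;> fin_cases i <;> fin_cases j <;>
    simp [bb_neg_left, bb_neg_right, bb_smul_left, bb_smul_right, bb_wd, ht, ht', p0, p1, p2, p3, p4,
      Matrix.J, Nat.choose] <;>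
    field_simp <;> norm_num

end SmallRank

/-! ### The sign `eps` distributes the cases between the two statements. -/

section Main

variable {l : ℕ} (v : Module.Basis (Fin l) k V) [NeZero (2 : k)]

omit [NeZero (2 : k)] in
theorem eps_eq_one_of {l : ℕ} (h : l = 3 ∨ l = 4) : eps k l = 1 := by
  rcases h with rfl | rfl <;> simp [eps] <;> norm_num [Nat.choose]

omit [NeZero (2 : k)] in
theorem eps_eq_neg_one_of {l : ℕ} (h : l = 1 ∨ l = 2 ∨ l = 5 ∨ l = 6) : eps k l = -1 := by
  rcases h with rfl | rfl | rfl | rfl <;> simp [eps] <;> norm_num [Nat.choose]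

theorem one_ne_neg_one_of_two : (1 : k) ≠ -1 := fun h => by
  rw [eq_neg_iff_add_eq_zero, one_add_one_eq_two] at h
  exact NeZero.ne _ h

theorem isLieProduct_gMul (hl : 1 ≤ l) :
    IsLieProduct (gMul v) ↔ (l = 3 ∧ CharP k 3) ∨ l = 4 := by
  rw [isLieProduct_gMul_iff v hl, jac_eq_zero_iff, cf_eq_zero_iff hl]
  constructor
  · rintro ⟨he, h⟩
    have aux : ¬(l = 1 ∨ l = 2 ∨ l = 5 ∨ l = 6) := fun h =>
      one_ne_neg_one_of_two (he.symm.trans (eps_eq_neg_one_of h))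
    tauto
  · intro h
    exact ⟨eps_eq_one_of (by tauto), by tauto⟩

theorem isLieSuperProduct_gMul (hl : 1 ≤ l) : IsLieSuperProduct (gGrading k V) (gMul v) ↔
    l = 1 ∨ l = 2 ∨ (l = 5 ∧ CharP k 5) ∨ (l = 6 ∧ CharP k 3) := by
  rw [isLieSuperProduct_gMul_iff v hl, jac_eq_zero_iff, cf_eq_zero_iff hl]
  constructor
  · rintro ⟨he, h⟩
    have aux : ¬(l = 3 ∨ l = 4) := fun h =>
      one_ne_neg_one_of_two ((eps_eq_one_of h).symm.trans he)
    tauto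
  · intro h
    exact ⟨eps_eq_neg_one_of (by tauto), by tauto⟩

end Main

end SpinLie

end

theorem theorem3p1 {k : Type*} [Field k] [IsAlgClosed k] [NeZero (2 : k)]
    {V : Type*} [AddCommGroup V] [Module k V] (l : ℕ) (hl : 1 ≤ l)
    (v : Module.Basis (Fin l) k V) :
    -- when `g` is a Lie algebra, and which one
    ((SpinLie.IsLieProduct (SpinLie.gMul v) ↔ (l = 3 ∧ CharP k 3) ∨ l = 4) ∧
      (l = 3 ∧ CharP k 3 →
        SpinLie.IsoLie (SpinLie.gMul v) (SpinLie.Brown k) ∧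
        LieAlgebra.IsSimple k (SpinLie.Brown k) ∧
        Module.finrank k (SpinLie.Brown k) = 29) ∧
      (l = 4 →
        SpinLie.IsoLie (SpinLie.gMul v) (SpinLie.TypeF4 k) ∧
        LieAlgebra.IsSimple k (SpinLie.TypeF4 k))) ∧
    -- when `g` is a Lie superalgebra, and which one
    ((SpinLie.IsLieSuperProduct (SpinLie.gGrading k V) (SpinLie.gMul v) ↔
        l = 1 ∨ l = 2 ∨ (l = 5 ∧ CharP k 5) ∨ (l = 6 ∧ CharP k 3)) ∧
      (SpinLie.IsLieSuperProduct (SpinLie.gGrading k V) (SpinLie.gMul v) →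
        ∀ x ∈ SpinLie.gGrading k V 1, SpinLie.gMul v (SpinLie.gMul v x x) x = 0) ∧
      (l = 1 →
        SpinLie.IsoSuper (SpinLie.gGrading k V) (SpinLie.gMul v)
          (SpinLie.ospGrading k (Fin 1) (Fin 1)) (SpinLie.ospMul k (Fin 1) (Fin 1))) ∧
      (l = 2 →
        SpinLie.IsoSuper (SpinLie.gGrading k V) (SpinLie.gMul v)
          (SpinLie.ospGrading k (Fin 1) (Fin 2)) (SpinLie.ospMul k (Fin 1) (Fin 2))) ∧
      ((l = 5 ∧ CharP k 5) ∨ (l = 6 ∧ CharP k 3) →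
        SpinLie.IsGradedSimple (SpinLie.gGrading k V) (SpinLie.gMul v))) := by
  -- Algebraic closedness enters only through this: the characters of the torus must be distinct.
  have : Infinite k := IsAlgClosed.instInfinite
  refine ⟨⟨SpinLie.isLieProduct_gMul v hl, ?_, ?_⟩, SpinLie.isLieSuperProduct_gMul v hl,
    fun h x hx => SpinLie.gMul_gMul_self v hl h hx, ?_, ?_, ?_⟩
  · rintro ⟨rfl, h3⟩
    have h := SpinLie.isoLie_gMul_three v (by exact_mod_cast CharP.cast_eq_zero k 3)
      ((SpinLie.isLieProduct_gMul v hl).2 (.inl ⟨rfl, h3⟩))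
    obtain ⟨e, -⟩ := h.1
    exact ⟨h.1, h.2, e.finrank_eq.symm.trans (SpinLie.finrank_so_prod_S v)⟩
  · rintro rfl
    exact SpinLie.isoLie_gMul_four v ((SpinLie.isLieProduct_gMul v hl).2 (.inr rfl))
  · rintro rfl
    exact SpinLie.isoSuper_gMul_one v
  · rintro rfl
    exact SpinLie.isoSuper_gMul_two v
  · intro h
    exact SpinLie.isGradedSimple_gMul v (by omega)
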